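/- Let $n,m\ge 1$ and $1<p<\infty$, $p'=p/(p-1)$. A weight (locally integrable, a.e. positive function) $w$ on $\mathbb{R}^n\times\mathbb{R}^m$ belongs to $A_p=A_p(\mathbb{R}^n\times\mathbb{R}^m)$ if $[w]_{A_p}:=\sup_R\langle w\rangle_R\langle w^{1-p'}\rangle_R^{p-1}<\infty$, the supremum being over all $R=I\times J$ with $I\subset\mathbb{R}^n$, $J\subset\mathbb{R}^m$ axis-parallel cubes and $\langle g\rangle_R=|R|^{-1}\int_R g$. A dyadic grid in $\mathbb{R}^d$ is a family of cubes $x_k+2^{-k}(j+[0,1)^d)$, $k\in\mathbb{Z}$, $j\in\mathbb{Z}^d$, where the points $x_k\in\mathbb{R}^d$ satisfy $x_k-x_{k+1}\in 2^{-k-1}\mathbb{Z}^d$ for all $k$. For a weight $w$, a locally integrable $b\colon\mathbb{R}^{n+m}\to\mathbb{C}$ belongs to $\mathrm{bmo}(w)$ if $$\|b\|_{\mathrm{bmo}(w)}:=\sup_{\mathcal{D}^n,\mathcal{D}^m}\ \sup_{R\in\mathcal{D}^n\times\mathcal{D}^m}\frac1{w(R)}\int_R|b-\langle b\rangle_R|<\infty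 ,$$ the outer supremum being over all dyadic grids $\mathcal{D}^n$ in $\mathbb{R}^n$ and $\mathcal{D}^m$ in $\mathbb{R}^m$. Here and below, $R\in\mathcal{D}^n\times\mathcal{D}^m$ means $R=I\times J$ with $I\in\mathcal{D}^n$, $J\in\mathcal{D}^m$. For fixed dyadic grids $\mathcal{D}^n,\mathcal{D}^m$ put $$M^b_{\mathcal{D}^n,\mathcal{D}^m}f=\sup_{R\in\mathcal{D}^n\times\mathcal{D}^m}\frac{1_R}{|R|}\int_R|b-\langle b\rangle_R||f|,\qquad M^{b_1,b_2}_{\mathcal{D}^n,\mathcal{D}^m}f=\sup_{R\in\mathcal{D}^n\times\mathcal{D}^m}\frac{1_R}{|R|}\int_R|b_1-\langle b_1\rangle_R||b_2-\langle b_2\rangle_R||f|.$$ For all $K,L\geq 0$ there is a finite constant $C$, depending only on $n,m,p,K,L$, such that the following holds for all $\mu,\lambda\in A_p$ with $[\mu]_{A_p}\le K$ and $[\lambda]_{A_p}\le L$, with $\nu=\mu^{1/p}\lambda^{-1/p}$, and for all dyadic grids $\mathcal{D}^n,\mathcal{D}^m$. (i) If $b\in\mathrm{bmo}(\nu)$,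 then $M^b_{\mathcal{D}^n,\mathcal{D}^m}$ maps $L^p(\mu)$ into $L^p(\lambda)$ and, for all $f\in L^p(\mu)$, $$\|M^b_{\mathcal{D}^n,\mathcal{D}^m}f\|_{L^p(\lambda)}\le C\,\|b\|_{\mathrm{bmo}(\nu)}\|f\|_{L^p(\mu)}.$$ (ii) If $\theta_1,\theta_2\in[0,1]$, $\theta_1+\theta_2=1$, and $b_i\in\mathrm{bmo}(\nu^{\theta_i})$ for $i=1,2$, then $M^{b_1,b_2}_{\mathcal{D}^n,\mathcal{D}^m}$ maps $L^p(\mu)$ into $L^p(\lambda)$ and, for all $f\in L^p(\mu)$, $$\|M^{b_1,b_2}_{\mathcal{D}^n,\mathcal{D}^m}f\|_{L^p(\lambda)}\le C\,\|b_1\|_{\mathrm{bmo}(\nu^{\theta_1})}\|b_2\|_{\mathrm{bmo}(\nu^{\theta_2})}\|f\|_{L^p(\mu)}.$$ -/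

import Mathlib

open MeasureTheory
open scoped ENNReal NNReal

noncomputable section

namespace BiParam

/-- The product space `ℝⁿ × ℝᵐ` with its Lebesgue measure (only boxes and Lebesgue measure are
used below, no norm). -/
abbrev Space (n m : ℕ) : Type := (Fin n → ℝ) × (Fin m → ℝ)

/-- The half-open axis-parallel cube with corner `a` and side length `h`. -/
def cube {n : ℕ} (a : Fin n → ℝ) (h : ℝ) : Set (Fin n → ℝ) :=
  Set.univ.pi fun i => Set.Ico (a i) (a i + h)

/-- A dyadic grid in `ℝⁿ`: the cubes of generation `k` are the translates by `2⁻ᵏ ℤⁿ` of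
`shift k + [0, 2⁻ᵏ)ⁿ`, and generation `k + 1` refines generation `k`. -/
structure DyadicGrid (n : ℕ) where
  shift : ℤ → Fin n → ℝ
  nested : ∀ (k : ℤ) (i : Fin n),
    ∃ z : ℤ, shift k i - shift (k + 1) i = (z : ℝ) * (2 : ℝ) ^ (-(k + 1))

/-- The collection of all cubes of a dyadic grid. -/
def DyadicGrid.cubes {n : ℕ} (D : DyadicGrid n) : Set (Set (Fin n → ℝ)) :=
  {I | ∃ (k : ℤ) (j : Fin n → ℤ),
    I = cube (fun i => D.shift k i + (j i : ℝ) * (2 : ℝ) ^ (-k)) ((2 : ℝ) ^ (-k))}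

/-- The bi-parameter `A_p` constant
`sup_R ⟨w⟩_R ⟨w ^ (1 - p')⟩_R ^ (p - 1)`, the supremum being over all `R = I × J` with `I`, `J`
axis-parallel cubes of arbitrary positive side lengths. -/
def apConst {n m : ℕ} (p : ℝ) (w : Space n m → ℝ) : ℝ≥0∞ :=
  ⨆ (a : Fin n → ℝ) (h : ℝ) (_ : 0 < h) (c : Fin m → ℝ) (l : ℝ) (_ : 0 < l),
    ((volume (cube a h ×ˢ cube c l))⁻¹ *
        ∫⁻ x in cube a h ×ˢ cube c l, ENNReal.ofReal (w x)) *
      ((volume (cube a h ×ˢ cube c l))⁻¹ *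
        ∫⁻ x in cube a h ×ˢ cube c l,
          ENNReal.ofReal (w x ^ (1 - Real.conjExponent p))) ^ (p - 1)

/-- `w ∈ A_p(ℝⁿ × ℝᵐ)`: a locally integrable, a.e. positive function with finite `A_p` constant. -/
structure IsApWeight {n m : ℕ} (p : ℝ) (w : Space n m → ℝ) : Prop where
  locallyIntegrable : LocallyIntegrable w volume
  ae_pos : ∀ᵐ x, 0 < w x
  apConst_lt_top : apConst p w < ∞

/-- The measure `w dx`. -/
def weightMeasure {n m : ℕ} (w : Space n m → ℝ) : Measure (Space n m) :=
  volume.withDensity fun x => ENNReal.ofReal (w x)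

/-- The weight `μ ^ (1/p) λ ^ (-1/p)`. -/
def bloomWeight {n m : ℕ} (p : ℝ) (mu lam : Space n m → ℝ) : Space n m → ℝ :=
  fun x => mu x ^ (1 / p) * lam x ^ (-(1 / p))

/-- The dyadic weighted little BMO norm
`sup_{R ∈ D × E} w(R)⁻¹ ∫_R |b - ⟨b⟩_R|`. -/
def bmoNormDyadic {n m : ℕ} (D : DyadicGrid n) (E : DyadicGrid m)
    (w : Space n m → ℝ) (b : Space n m → ℂ) : ℝ≥0∞ :=
  ⨆ (I ∈ D.cubes) (J ∈ E.cubes),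
    (∫⁻ x in I ×ˢ J, ‖b x - ⨍ y in I ×ˢ J, b y‖ₑ) / weightMeasure w (I ×ˢ J)

/-- The weighted little BMO norm: the supremum of the dyadic norms over all dyadic grids. -/
def bmoNorm {n m : ℕ} (w : Space n m → ℝ) (b : Space n m → ℂ) : ℝ≥0∞ :=
  ⨆ (D : DyadicGrid n) (E : DyadicGrid m), bmoNormDyadic D E w b

/-- `b ∈ bmo(w)`. -/
structure MemBmo {n m : ℕ} (w : Space n m → ℝ) (b : Space n m → ℂ) : Prop where
  locallyIntegrable : LocallyIntegrable b volume
  bmoNorm_lt_top : bmoNorm w b < ∞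

/-- The maximal function `sup_{R ∈ D × E} 1_R |R|⁻¹ ∫_R |b - ⟨b⟩_R| |f|`. -/
def maximalOne {n m : ℕ} (D : DyadicGrid n) (E : DyadicGrid m) (b f : Space n m → ℂ)
    (x : Space n m) : ℝ≥0∞ :=
  ⨆ (I ∈ D.cubes) (J ∈ E.cubes), (I ×ˢ J).indicator
    (fun _ => (volume (I ×ˢ J))⁻¹ *
      ∫⁻ y in I ×ˢ J, ‖b y - ⨍ z in I ×ˢ J, b z‖ₑ * ‖f y‖ₑ) x

/-- The maximal function
`sup_{R ∈ D × E} 1_R |R|⁻¹ ∫_R |b₁ - ⟨b₁⟩_R| |b₂ - ⟨b₂⟩_R| |f|`. -/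
def maximalTwo {n m : ℕ} (D : DyadicGrid n) (E : DyadicGrid m) (b₁ b₂ f : Space n m → ℂ)
    (x : Space n m) : ℝ≥0∞ :=
  ⨆ (I ∈ D.cubes) (J ∈ E.cubes), (I ×ˢ J).indicator
    (fun _ => (volume (I ×ˢ J))⁻¹ *
      ∫⁻ y in I ×ˢ J, ‖b₁ y - ⨍ z in I ×ˢ J, b₁ z‖ₑ * ‖b₂ y - ⨍ z in I ×ˢ J, b₂ z‖ₑ * ‖f y‖ₑ) x

end BiParam

end

/-! Write `M₁`, `M₂` for the dyadic maximal operators in each variable and `M = M₁ + M₂M₁`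
(`strongMax`). The whole theorem rests on an integral domination on rectangles: `∫_R |b - ⟨b⟩_R| g ≤
C ‖b‖ ∫_R ν M g` (`BiOsc.setLIntegral_le`), hence pointwise `M^b f ≤ C ‖b‖ M(ν M|f|)`. Since `ν^p λ
= μ` and `M` is bounded on `L^p(λ)` and on `L^p(μ)`, this gives (i). For two symbols
`BiOsc.setLIntegral_mul_le` produces `M(ν^θ₁ M(ν^θ₂ M|f|))` and its mirror image. Each
multiplication by a power of `ν` moves between the weights `μ^t λ^(1-t)`, which by Hölder are `A_p`
with the same bound (`RectAp.mul`).

One parameter. In a cell `Q` select the maximal subcells on which `|b - ⟨b⟩_Q|` has average above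
`4B⟨w⟩_Q`. They fill at most half of `Q`, so with `E` their complement the `A_∞` property yields
`⟨w⟩_Q ∫_Q g = w(Q)⟨g⟩_Q ≤ Λ ∫_E w Mg`. Off the selected cells the oscillation is controlled by
`B⟨w⟩_Q`. On each of them it is so controlled up to the oscillation about the average of the
subcell, which is the same problem again. The sets `E` of different stages are disjoint, so
constants do not accumulate. Replacing `b` by its averages of generation `N` makes the recursion
finite, and Lebesgue differentiation with Fatou's lemma removes `N`. For products of two
oscillations the cross terms are one-symbol problems inside the selected cells; they cause the
nested maximal functions.

Two parameters. Split `b - ⟨b⟩_{I×J}` as `(b - ⟨b(·,y)⟩_I) + (⟨b(·,y)⟩_I - ⟨b⟩_{I×J})`. One summand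
is an oscillation in `x` of a slice, the other an oscillation in `y` relative to the weight `y ↦
⟨w(·,y)⟩_I`. The conditions on slices hold for almost every `y`, by shrinking the rectangle in the
second variable. The `A_∞` property of `ν^θ` follows from `⟨ν^θ⟩⟨ν^(-θ)⟩ ≤ K²` and Cauchy–Schwarz.
The weighted bounds for `M₁` and `M₂` come from a pointwise estimate that reduces them to a maximal
inequality valid for every measure (`lintegral_maxFn_rpow_le`). -/

open Set Filter Topology

set_option linter.unusedSectionVars false

/-! ### Cell systems and the weak type estimate. -/

/-- A refining sequence of countable measurable partitions, given by the index of the cell of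
generation `k` that contains a point. -/
structure CellSystem (X ι : Type*) [MeasurableSpace X] where
  idx : ℤ → X → ι
  measurableSet_fiber : ∀ k i, MeasurableSet (idx k ⁻¹' {i})
  idx_of_succ : ∀ k x y, idx (k + 1) x = idx (k + 1) y → idx k x = idx k y

namespace CellSystem

variable {X ι : Type*} [MeasurableSpace X] (D : CellSystem X ι)

/-- The cell of generation `k` containing `x`. -/
def cell (k : ℤ) (x : X) : Set X := {y | D.idx k y = D.idx k x}

/-- `S` is a union of cells of generation `k`. -/
def Saturated (k : ℤ) (S : Set X) : Prop := ∀ ⦃x y⦄, D.idx k x = D.idx k y → x ∈ S → y ∈ S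

/-- The average of `g` over the cell of generation `k` containing `x`. -/
noncomputable def avg (ρ : Measure X) (k : ℤ) (g : X → ℝ≥0∞) (x : X) : ℝ≥0∞ :=
  (ρ (D.cell k x))⁻¹ * ∫⁻ y in D.cell k x, g y ∂ρ

/-- The maximal function of the cell system with respect to the measure `ρ`. -/
noncomputable def maxFn (ρ : Measure X) (g : X → ℝ≥0∞) (x : X) : ℝ≥0∞ :=
  ⨆ k, D.avg ρ k g x

theorem idx_mono {j k : ℤ} (h : j ≤ k) {x y : X} (hxy : D.idx k x = D.idx k y) :
    D.idx j x = D.idx j y := by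
  induction k, h using Int.leInduction with
  | base => exact hxy
  | succ k _ ih => exact ih (D.idx_of_succ k x y hxy)

theorem mem_cell {k : ℤ} {x y : X} : y ∈ D.cell k x ↔ D.idx k y = D.idx k x := Iff.rfl

theorem self_mem_cell (k : ℤ) (x : X) : x ∈ D.cell k x := rfl

theorem cell_eq {k : ℤ} {x y : X} (h : D.idx k x = D.idx k y) : D.cell k x = D.cell k y := by
  ext z; simp [cell, h]

theorem cell_mono {j k : ℤ} (h : j ≤ k) (x : X) : D.cell k x ⊆ D.cell j x :=
  fun _ hy => D.idx_mono h hy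

theorem measurableSet_cell (k : ℤ) (x : X) : MeasurableSet (D.cell k x) :=
  D.measurableSet_fiber k (D.idx k x)

theorem saturated_cell {j k : ℤ} (h : j ≤ k) (x : X) : D.Saturated k (D.cell j x) :=
  fun _ _ hyz hy => (D.idx_mono h hyz).symm.trans hy

variable {D} in
theorem Saturated.cell_subset {k : ℤ} {S : Set X} (hS : D.Saturated k S) {x : X} (hx : x ∈ S) :
    D.cell k x ⊆ S := fun _ hy => hS (Eq.symm hy) hx

theorem avg_congr_idx (ρ : Measure X) {j k : ℤ} (h : j ≤ k) (g : X → ℝ≥0∞) {x y : X}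
    (hxy : D.idx k x = D.idx k y) : D.avg ρ j g x = D.avg ρ j g y := by
  simp only [avg, D.cell_eq (D.idx_mono h hxy)]

theorem avg_le_maxFn (ρ : Measure X) (k : ℤ) (g : X → ℝ≥0∞) (x : X) :
    D.avg ρ k g x ≤ D.maxFn ρ g x := le_iSup (fun k => D.avg ρ k g x) k

theorem avg_mono (ρ : Measure X) (k : ℤ) {g h : X → ℝ≥0∞} (hgh : ∀ x, g x ≤ h x) (x : X) :
    D.avg ρ k g x ≤ D.avg ρ k h x := by
  unfold avg; gcongr; exact hgh _

theorem maxFn_mono (ρ : Measure X) {g h : X → ℝ≥0∞} (hgh : ∀ x, g x ≤ h x) (x : X) :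
    D.maxFn ρ g x ≤ D.maxFn ρ h x := iSup_mono fun k => D.avg_mono ρ k hgh x

section Countable

variable [Countable ι]

variable {D} in
theorem Saturated.measurableSet {k : ℤ} {S : Set X} (hS : D.Saturated k S) : MeasurableSet S := by
  have : S = ⋃ i ∈ D.idx k '' S, D.idx k ⁻¹' {i} := by
    ext x
    simp only [mem_image, mem_iUnion, mem_preimage, mem_singleton_iff, exists_prop]
    constructor
    · intro hx; exact ⟨_, ⟨x, hx, rfl⟩, rfl⟩
    · rintro ⟨i, ⟨y, hy, rfl⟩, h⟩; exact hS h.symm hy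
  rw [this]
  exact MeasurableSet.biUnion (to_countable _) fun i _ => D.measurableSet_fiber k i

theorem measurable_of_idx {β : Type*} [MeasurableSpace β] {k : ℤ} {f : X → β}
    (h : ∀ x y, D.idx k x = D.idx k y → f x = f y) : Measurable f := fun s _ =>
  Saturated.measurableSet (D := D) (k := k) fun x y hxy hx => by
    rw [mem_preimage, ← h x y hxy]; exact hx

theorem measurable_avg (ρ : Measure X) (k : ℤ) (g : X → ℝ≥0∞) : Measurable (D.avg ρ k g) :=
  D.measurable_of_idx fun _ _ h => D.avg_congr_idx ρ le_rfl g h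

theorem measurable_maxFn (ρ : Measure X) (g : X → ℝ≥0∞) : Measurable (D.maxFn ρ g) :=
  Measurable.iSup fun k => D.measurable_avg ρ k g

variable {D} in
/-- An integral inequality that holds on cells holds on unions of cells. -/
theorem Saturated.setLIntegral_le {k : ℤ} {S : Set X} (hS : D.Saturated k S) {ρ ρ' : Measure X}
    {f g : X → ℝ≥0∞}
    (h : ∀ x ∈ S, ∫⁻ y in D.cell k x, f y ∂ρ ≤ ∫⁻ y in D.cell k x, g y ∂ρ') :
    ∫⁻ y in S, f y ∂ρ ≤ ∫⁻ y in S, g y ∂ρ' := by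
  have hU : S = ⋃ i, S ∩ D.idx k ⁻¹' {i} := by ext x; simp
  have hm : ∀ i, MeasurableSet (S ∩ D.idx k ⁻¹' {i}) := fun i =>
    hS.measurableSet.inter (D.measurableSet_fiber k i)
  have hd : Pairwise (Function.onFun Disjoint fun i => S ∩ D.idx k ⁻¹' {i}) := by
    intro i j hij
    refine Set.disjoint_left.2 fun x hx hx' => hij ?_
    exact hx.2.symm.trans hx'.2
  rw [hU, lintegral_iUnion hm hd, lintegral_iUnion hm hd]
  refine ENNReal.tsum_le_tsum fun i => ?_
  rcases (S ∩ D.idx k ⁻¹' {i}).eq_empty_or_nonempty with h0 | ⟨x, hx, hxi⟩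
  · simp [h0]
  · have : S ∩ D.idx k ⁻¹' {i} = D.cell k x := by
      ext y
      simp only [mem_inter_iff, mem_preimage, mem_singleton_iff, mem_cell]
      rw [mem_preimage, mem_singleton_iff] at hxi
      rw [hxi]
      exact ⟨fun h => h.2, fun h => ⟨hS (hxi.trans h.symm) hx, h⟩⟩
    rw [this]
    exact h x hx

/-- The weak type estimate. -/
theorem mul_measure_lt_maxFn_le (ρ : Measure X) (g : X → ℝ≥0∞) (t : ℝ≥0∞) :
    t * ρ {x | t < D.maxFn ρ g x} ≤ ∫⁻ x, g x ∂ρ := by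
  -- Generations are unbounded below, so a coarsest cell with large average need not exist. Only
  -- generations from `-n` on are admitted, and `n` tends to infinity by monotone convergence.
  let A : ℕ → Set X := fun n => {x | ∃ k : ℤ, -(n : ℤ) ≤ k ∧ t < D.avg ρ k g x}
  have hA : {x | t < D.maxFn ρ g x} = ⋃ n, A n := by
    ext x
    simp only [mem_ofPred_eq, maxFn, lt_iSup_iff, mem_iUnion, A]
    constructor
    · rintro ⟨k, hk⟩; exact ⟨k.natAbs, k, by omega, hk⟩
    · rintro ⟨_, k, _, hk⟩; exact ⟨k, hk⟩
  have hmono : Monotone A := fun a b hab x ⟨k, hk, h⟩ => ⟨k, by omega, h⟩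
  rw [hA, hmono.measure_iUnion, ENNReal.mul_iSup]
  refine iSup_le fun n => ?_
  let Ω : ℤ → Set X := fun k => {x | -(n : ℤ) ≤ k ∧ t < D.avg ρ k g x ∧
    ∀ j, -(n : ℤ) ≤ j → j < k → ¬ t < D.avg ρ j g x}
  have hsat : ∀ k, D.Saturated k (Ω k) := by
    rintro k x y hxy ⟨h1, h2, h3⟩
    refine ⟨h1, by rwa [← D.avg_congr_idx ρ le_rfl g hxy], fun j hj hjk => ?_⟩
    rw [← D.avg_congr_idx ρ hjk.le g hxy]; exact h3 j hj hjk
  have hU : A n = ⋃ k, Ω k := by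
    ext x
    simp only [A, mem_ofPred_eq, mem_iUnion, Ω]
    constructor
    · rintro hx
      obtain ⟨k, ⟨hk1, hk2⟩, hk3⟩ := Int.exists_least_of_bdd
        (P := fun k => -(n : ℤ) ≤ k ∧ t < D.avg ρ k g x) ⟨-(n : ℤ), fun z hz => hz.1⟩ hx
      exact ⟨k, hk1, hk2, fun j hj hjk h => absurd (hk3 j ⟨hj, h⟩) (by omega)⟩
    · rintro ⟨k, h1, h2, _⟩; exact ⟨k, h1, h2⟩
  have hd : Pairwise (Function.onFun Disjoint Ω) := by
    intro i j hij
    refine Set.disjoint_left.2 fun x hx hx' => ?_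
    rcases lt_or_gt_of_ne hij with h | h
    · exact hx'.2.2 i hx.1 h hx.2.1
    · exact hx.2.2 j hx'.1 h hx'.2.1
  have hm : ∀ k, MeasurableSet (Ω k) := fun k => (hsat k).measurableSet
  calc t * ρ (A n) = ∫⁻ _ in A n, t ∂ρ := by rw [setLIntegral_const]
    _ = ∑' k, ∫⁻ _ in Ω k, t ∂ρ := by rw [hU, lintegral_iUnion hm hd]
    _ ≤ ∑' k, ∫⁻ x in Ω k, g x ∂ρ := by
        refine ENNReal.tsum_le_tsum fun k => (hsat k).setLIntegral_le fun x hx => ?_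
        rw [setLIntegral_const]
        -- No assumption on the measure of the cell is needed: for measure `0` or `∞` the
        -- conventions of `ℝ≥0∞` make the average `0`.
        have h := hx.2.1
        rw [avg, mul_comm, ← div_eq_mul_inv] at h
        exact ENNReal.mul_le_of_le_div h.le
    _ = ∫⁻ x in A n, g x ∂ρ := by rw [hU, lintegral_iUnion hm hd]
    _ ≤ ∫⁻ x, g x ∂ρ := setLIntegral_le_lintegral _ _

/-- Since `g ≤ g 1_{g > t} + t` and the average of the constant `t` is at most `t`, a value of the
maximal function above `2t` forces that of the truncated function above `t`. This is the form of the
weak type bound that can be integrated in `t`. -/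
theorem mul_measure_two_mul_lt_maxFn_le (ρ : Measure X) {g : X → ℝ≥0∞} (t : ℝ≥0∞) :
    t * ρ {x | 2 * t < D.maxFn ρ g x} ≤ ∫⁻ x, {x | t < g x}.indicator g x ∂ρ := by
  refine le_trans ?_ (D.mul_measure_lt_maxFn_le ρ ({x | t < g x}.indicator g) t)
  refine mul_le_mul_right (measure_mono fun x hx => ?_) t
  rw [mem_ofPred_eq] at hx ⊢
  have : D.maxFn ρ g x ≤ D.maxFn ρ ({x | t < g x}.indicator g) x + t := by
    refine iSup_le fun k => le_trans ?_ (add_le_add_left (D.avg_le_maxFn ρ k _ x) t)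
    calc D.avg ρ k g x ≤ (ρ (D.cell k x))⁻¹ *
          ∫⁻ y in D.cell k x, ({x | t < g x}.indicator g y + t) ∂ρ := by
          unfold avg
          gcongr with y
          by_cases hy : t < g y
          · simp [indicator, hy]
          · exact (not_lt.1 hy).trans le_add_self
      _ = D.avg ρ k ({x | t < g x}.indicator g) x + (ρ (D.cell k x))⁻¹ * (t * ρ (D.cell k x)) := by
          rw [lintegral_add_right _ measurable_const, mul_add, setLIntegral_const, avg]
      _ ≤ _ := by
          gcongr
          rw [mul_left_comm]
          exact mul_le_of_le_one_right' (ENNReal.inv_mul_le_one _)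
  rw [two_mul] at hx
  by_contra h
  exact absurd (lt_of_lt_of_le hx (this.trans (add_le_add_left (not_lt.1 h) t))) (lt_irrefl _)

end Countable

end CellSystem

/-! ### Dyadic level sums and the universal maximal inequality on `L^q`. -/

theorem ENNReal.rpow_le_tsum_zpow {q : ℝ} (hq : 0 < q) (y : ℝ≥0∞) :
    y ^ q ≤ ∑' k : ℤ, {k : ℤ | 2 * (2 : ℝ≥0∞) ^ k < y}.indicator
      (fun k => ((2 : ℝ≥0∞) ^ (k + 2)) ^ q) k := by
  rcases eq_or_ne y 0 with rfl | h0
  · simp [hq]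
  rcases eq_or_ne y ∞ with rfl | hy
  · have h2 : ∀ k : ℤ, 2 * (2 : ℝ≥0∞) ^ k < ∞ := fun k =>
      ENNReal.mul_lt_top (by simp) (ENNReal.zpow_lt_top (by simp) (by simp) k)
    refine le_of_le_of_eq le_top (Eq.symm (top_unique ?_))
    calc ∞ = ∑' _ : ℕ, (1 : ℝ≥0∞) := (ENNReal.tsum_const_eq_top_of_ne_zero one_ne_zero).symm
      _ ≤ ∑' k : ℕ, {k : ℤ | 2 * (2 : ℝ≥0∞) ^ k < ∞}.indicator
          (fun k => ((2 : ℝ≥0∞) ^ (k + 2)) ^ q) (k : ℤ) := by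
          refine ENNReal.tsum_le_tsum fun k => ?_
          rw [indicator_of_mem (mem_ofPred_eq ▸ h2 _)]
          refine ENNReal.one_le_rpow ?_ hq
          have : ((k : ℤ) + 2) = ((k + 2 : ℕ) : ℤ) := by push_cast; ring
          rw [this, zpow_natCast]
          exact one_le_pow₀ (by norm_num)
      _ ≤ _ := ENNReal.tsum_comp_le_tsum_of_injective Nat.cast_injective _
  -- With `2^n < y ≤ 2^(n+1)`, the single term `k = n - 1` suffices: its threshold is `2^n` and its
  -- value `(2^(n+1))^q`.
  obtain ⟨n, hn1, hn2⟩ := ENNReal.exists_mem_Ioc_zpow h0 hy (y := 2) (by norm_num) (by simp)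
  refine le_trans ?_ (ENNReal.le_tsum (n - 1))
  have e : 2 * (2 : ℝ≥0∞) ^ (n - 1) = 2 ^ n := by
    rw [ENNReal.zpow_sub (by simp) (by simp), zpow_one, mul_comm, mul_assoc,
      ENNReal.inv_mul_cancel (by simp) (by simp), mul_one]
  rw [indicator_of_mem (by rw [mem_ofPred_eq, e]; exact hn1)]
  have : n - 1 + 2 = n + 1 := by ring
  rw [this]
  gcongr

theorem ENNReal.tsum_zpow_rpow_le {r : ℝ} (hr : 0 < r) (y : ℝ≥0∞) :
    ∑' k : ℤ, {k : ℤ | (2 : ℝ≥0∞) ^ k < y}.indicator (fun k => ((2 : ℝ≥0∞) ^ k) ^ r) k ≤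
      (1 - (2⁻¹ : ℝ≥0∞) ^ r)⁻¹ * y ^ r := by
  rcases eq_or_ne y 0 with rfl | h0
  · simp
  rcases eq_or_ne y ∞ with rfl | hy
  · rw [ENNReal.top_rpow_of_pos hr, ENNReal.mul_top]
    · exact le_top
    · simp [ENNReal.sub_eq_top_iff]
  -- Every index that contributes satisfies `k ≤ n`, so `k = n - j` turns the sum into a geometric
  -- series of ratio `2^(-r)`.
  obtain ⟨n, hn1, hn2⟩ := ENNReal.exists_mem_Ioc_zpow h0 hy (y := 2) (by norm_num) (by simp)
  have hinj : Function.Injective fun j : ℕ => n - (j : ℤ) := fun a b h => by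
    simp only at h; omega
  rw [← hinj.tsum_eq]
  · rw [← ENNReal.tsum_geometric, mul_comm, ← ENNReal.tsum_mul_left]
    refine ENNReal.tsum_le_tsum fun j => ?_
    refine (indicator_le_self _ _ _).trans ?_
    rw [ENNReal.zpow_sub (by simp) (by simp), zpow_natCast, ENNReal.mul_rpow_of_nonneg _ _ hr.le,
      ENNReal.inv_pow, ← ENNReal.rpow_natCast, ← ENNReal.rpow_mul, mul_comm (j : ℝ) r,
      ENNReal.rpow_mul, ENNReal.rpow_natCast]
    gcongr
  · intro k hk
    have hk : (2 : ℝ≥0∞) ^ k < y := by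
      by_contra h
      exact hk (indicator_of_notMem (by rwa [mem_ofPred_eq]) _)
    have : k < n + 1 := by
      by_contra h
      have := ENNReal.zpow_le_of_le (x := 2) (by norm_num) (not_lt.1 h)
      exact absurd (hk.trans_le (hn2.trans this)) (lt_irrefl _)
    exact ⟨(n - k).toNat, by simp only; omega⟩

namespace CellSystem

variable {X ι : Type*} [MeasurableSpace X] [Countable ι] (D : CellSystem X ι)

/-- The constant of the universal maximal inequality on `L^q`. -/
noncomputable def doobConst (q : ℝ) : ℝ≥0∞ := 4 ^ q * (1 - (2⁻¹ : ℝ≥0∞) ^ (q - 1))⁻¹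

theorem doobConst_ne_top {q : ℝ} (hq : 1 < q) : doobConst q ≠ ∞ := by
  refine ENNReal.mul_ne_top (ENNReal.rpow_ne_top_of_nonneg (by linarith) (by simp)) ?_
  rw [ENNReal.inv_ne_top]
  exact (tsub_pos_of_lt (ENNReal.rpow_lt_one (by simp) (by linarith))).ne'

/-- The maximal function with respect to `ρ` is bounded on `L^q(ρ)`, whatever the measure. -/
theorem lintegral_maxFn_rpow_le (ρ : Measure X) {q : ℝ} (hq : 1 < q) {g : X → ℝ≥0∞}
    (hg : Measurable g) :
    ∫⁻ x, D.maxFn ρ g x ^ q ∂ρ ≤ doobConst q * ∫⁻ x, g x ^ q ∂ρ := by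
  have hM := D.measurable_maxFn ρ g
  have hz : ∀ k : ℤ, (2 : ℝ≥0∞) ^ k ≠ 0 := fun k =>
    (ENNReal.zpow_pos (by simp) (by simp) k).ne'
  have hz' : ∀ k : ℤ, (2 : ℝ≥0∞) ^ k ≠ ∞ := fun k =>
    (ENNReal.zpow_lt_top (by simp) (by simp) k).ne
  calc ∫⁻ x, D.maxFn ρ g x ^ q ∂ρ
      ≤ ∫⁻ x, ∑' k : ℤ, {x | 2 * (2 : ℝ≥0∞) ^ k < D.maxFn ρ g x}.indicator
          (fun _ => ((2 : ℝ≥0∞) ^ (k + 2)) ^ q) x ∂ρ :=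
        lintegral_mono fun x => ENNReal.rpow_le_tsum_zpow (by linarith) _
    _ = ∑' k : ℤ, ((2 : ℝ≥0∞) ^ (k + 2)) ^ q * ρ {x | 2 * (2 : ℝ≥0∞) ^ k < D.maxFn ρ g x} := by
        have hs : ∀ k : ℤ, MeasurableSet {x | 2 * (2 : ℝ≥0∞) ^ k < D.maxFn ρ g x} := fun k =>
          measurableSet_lt measurable_const hM
        rw [lintegral_tsum fun k => (measurable_const.indicator (hs k)).aemeasurable]
        exact tsum_congr fun k => lintegral_indicator_const (hs k) _
    _ ≤ ∑' k : ℤ, ∫⁻ x, 4 ^ q * (g x * {x | (2 : ℝ≥0∞) ^ k < g x}.indicator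
          (fun _ => ((2 : ℝ≥0∞) ^ k) ^ (q - 1)) x) ∂ρ := by
        refine ENNReal.tsum_le_tsum fun k => ?_
        -- One factor `2^k` is spent on the weak type bound; the remaining power `q - 1 > 0` is what
        -- gets summed over the levels below `g x`.
        have e1 : ((2 : ℝ≥0∞) ^ (k + 2)) ^ q = 4 ^ q * ((2 : ℝ≥0∞) ^ k) ^ (q - 1) * 2 ^ k := by
          have : (2 : ℝ≥0∞) ^ (k + 2) = 4 * 2 ^ k := by
            rw [ENNReal.zpow_add (by simp) (by simp), mul_comm]; norm_num
          rw [this, ENNReal.mul_rpow_of_nonneg _ _ (by linarith), mul_assoc]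
          congr 1
          conv_rhs => rw [← ENNReal.rpow_one ((2 : ℝ≥0∞) ^ k), ← ENNReal.rpow_mul,
            ← ENNReal.rpow_add _ _ (hz k) (hz' k)]
          congr 1; ring
        rw [e1, mul_assoc]
        have hm : MeasurableSet {x | (2 : ℝ≥0∞) ^ k < g x} := measurableSet_lt measurable_const hg
        calc _ ≤ 4 ^ q * ((2 : ℝ≥0∞) ^ k) ^ (q - 1) *
              ∫⁻ x, {x | (2 : ℝ≥0∞) ^ k < g x}.indicator g x ∂ρ := by
              gcongr; exact D.mul_measure_two_mul_lt_maxFn_le ρ _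
          _ = _ := by
              rw [← lintegral_const_mul _ (hg.indicator hm)]
              refine lintegral_congr fun x => ?_
              by_cases hx : (2 : ℝ≥0∞) ^ k < g x
              · simp [indicator, hx]; ring
              · simp [indicator, hx]
    _ = ∫⁻ x, 4 ^ q * (g x * ∑' k : ℤ, {k : ℤ | (2 : ℝ≥0∞) ^ k < g x}.indicator
          (fun k => ((2 : ℝ≥0∞) ^ k) ^ (q - 1)) k) ∂ρ := by
        rw [← lintegral_tsum]
        · refine lintegral_congr fun x => ?_
          rw [ENNReal.tsum_mul_left, ENNReal.tsum_mul_left]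
          rfl
        · intro k
          exact ((hg.mul (measurable_const.indicator
            (measurableSet_lt measurable_const hg))).const_mul _).aemeasurable
    _ ≤ ∫⁻ x, doobConst q * g x ^ q ∂ρ := by
        refine lintegral_mono fun x => ?_
        have : g x ^ q = g x * g x ^ (q - 1) := by
          conv_rhs => rw [← ENNReal.rpow_one (g x), ← ENNReal.rpow_mul, one_mul,
            ← ENNReal.rpow_add_of_nonneg _ _ zero_le_one (by linarith)]
          congr 1; ring
        simp only
        refine (mul_le_mul_right (mul_le_mul_right
          (ENNReal.tsum_zpow_rpow_le (r := q - 1) (by linarith) (g x)) _) _).trans_eq ?_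
        rw [this, doobConst]
        ring
    _ = _ := lintegral_const_mul _ (hg.pow_const q)

end CellSystem

/-! ### Muckenhoupt's theorem on regular cell systems. -/

theorem MeasureTheory.setLIntegral_withDensity_eq {X : Type*} [MeasurableSpace X] {ρ : Measure X}
    {w : X → ℝ≥0∞} (hw : Measurable w) (g : X → ℝ≥0∞) (hg : Measurable g) {Q : Set X}
    (hQ : MeasurableSet Q) :
    ∫⁻ y in Q, g y ∂(ρ.withDensity w) = ∫⁻ y in Q, w y * g y ∂ρ :=
  setLIntegral_withDensity_eq_setLIntegral_mul _ hw hg hQ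

namespace CellSystem

variable {X ι : Type*} [MeasurableSpace X]

/-- Cells have positive finite measure, and the measures of a cell and its parent are comparable. -/
structure Regular (D : CellSystem X ι) (ρ : Measure X) (A : ℝ≥0∞) : Prop where
  ne_zero : ∀ k x, ρ (D.cell k x) ≠ 0
  ne_top : ∀ k x, ρ (D.cell k x) ≠ ∞
  doubling : ∀ k x, ρ (D.cell k x) ≤ A * ρ (D.cell (k + 1) x)

variable {D : CellSystem X ι} {ρ : Measure X}

theorem setLIntegral_cell_eq {A : ℝ≥0∞} (hD : D.Regular ρ A) (k : ℤ) (g : X → ℝ≥0∞) (x : X) :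
    ∫⁻ y in D.cell k x, g y ∂ρ = ρ (D.cell k x) * D.avg ρ k g x := by
  rw [avg, ← mul_assoc, ENNReal.mul_inv_cancel (hD.ne_zero k x) (hD.ne_top k x), one_mul]

theorem avg_succ_le {A : ℝ≥0∞} (hD : D.Regular ρ A) (k : ℤ) (g : X → ℝ≥0∞) (x : X) :
    D.avg ρ (k + 1) g x ≤ A * D.avg ρ k g x := by
  have h : (ρ (D.cell (k + 1) x))⁻¹ ≤ A * (ρ (D.cell k x))⁻¹ := by
    rw [← div_eq_mul_inv, ENNReal.le_div_iff_mul_le (.inl (hD.ne_zero k x))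
      (.inl (hD.ne_top k x)), mul_comm, ← div_eq_mul_inv]
    exact ENNReal.div_le_of_le_mul (hD.doubling k x)
  unfold avg
  rw [← mul_assoc]
  gcongr
  exact D.cell_mono (by omega) x

/-- Put `σ = w^s`, and let `G` be the `σ`-maximal function of `f/σ`. On the cell `Q` one has `G ≥
∫_Q f / σ(Q)`, so the `w`-average of `G^(p-1)/w` over `Q` is at least `(|Q|/w(Q)) (∫_Q f /
σ(Q))^(p-1)`. The `A_p` condition compares this with `(∫_Q f / |Q|)^(p-1)`. Only maximal functions
taken with respect to their own measure remain, and these need no property of the weight. -/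
theorem avg_pow_le_maxFn_withDensity {A : ℝ≥0∞} (hD : D.Regular ρ A) {p s : ℝ} (hp : 1 < p)
    {K : ℝ≥0∞} (hK : K ≠ ∞) {w : X → ℝ≥0∞} (hw : Measurable w)
    (hw0 : ∀ x, w x ≠ 0) (hwt : ∀ x, w x ≠ ∞)
    (hA : ∀ k x, (∫⁻ y in D.cell k x, w y ∂ρ) * (∫⁻ y in D.cell k x, w y ^ s ∂ρ) ^ (p - 1) ≤
      K * ρ (D.cell k x) ^ p) {f : X → ℝ≥0∞} [Countable ι] (hf : Measurable f) (k : ℤ) (x : X) :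
    D.avg ρ k f x ^ (p - 1) ≤ K * D.maxFn (ρ.withDensity w) (fun y =>
      D.maxFn (ρ.withDensity fun y => w y ^ s) (fun y => f y * (w y ^ s)⁻¹) y ^ (p - 1) *
        (w y)⁻¹) x := by
  set σ : X → ℝ≥0∞ := fun y => w y ^ s
  have hσ : Measurable σ := hw.pow_const s
  have hσ0 : ∀ x, σ x ≠ 0 := fun x => by simp [σ, ENNReal.rpow_eq_zero_iff, hw0, hwt]
  have hσt : ∀ x, σ x ≠ ∞ := fun x => by simp [σ, ENNReal.rpow_eq_top_iff, hw0, hwt]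
  set G := D.maxFn (ρ.withDensity σ) fun y => f y * (σ y)⁻¹
  have hG : Measurable G := D.measurable_maxFn _ _
  have hr : 0 < p - 1 := by linarith
  set Q := D.cell k x with hQ
  have hQm : MeasurableSet Q := D.measurableSet_cell k x
  set V := ρ Q with hV
  have hV0 : V ≠ 0 := hD.ne_zero k x
  have hVt : V ≠ ∞ := hD.ne_top k x
  have pos : ∀ u : X → ℝ≥0∞, Measurable u → (∀ x, u x ≠ 0) → ∫⁻ y in Q, u y ∂ρ ≠ 0 := by
    intro u hu hu0
    have : Function.support u = univ := by ext; simp [hu0]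
    rw [← pos_iff_ne_zero, setLIntegral_pos_iff hu, this, univ_inter]
    exact pos_iff_ne_zero.2 hV0
  set W := ∫⁻ y in Q, w y ∂ρ with hWdef
  set S := ∫⁻ y in Q, σ y ∂ρ with hSdef
  have hW0 : W ≠ 0 := pos w hw hw0
  have hS0 : S ≠ 0 := pos σ hσ hσ0
  have hWS : W * S ^ (p - 1) ≤ K * V ^ p := hA k x
  have hfin : W * S ^ (p - 1) ≠ ∞ := ne_top_of_le_ne_top
    (ENNReal.mul_ne_top hK (ENNReal.rpow_ne_top_of_nonneg (by linarith) hVt)) hWS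
  have hSp0 : S ^ (p - 1) ≠ 0 := by simp [ENNReal.rpow_eq_zero_iff, hS0, hp.le]
  have hWt : W ≠ ∞ := fun h => hfin (by rw [h, ENNReal.top_mul hSp0])
  have hSpt : S ^ (p - 1) ≠ ∞ := fun h => hfin (by rw [h, ENNReal.mul_top hW0])
  have hG' : ∀ y ∈ Q, S⁻¹ * (∫⁻ z in Q, f z ∂ρ) ≤ G y := by
    intro y hy
    refine le_trans (le_of_eq ?_) (D.avg_le_maxFn (ρ.withDensity σ) k _ y)
    rw [avg, D.cell_eq (x := y) (y := x) hy, ← hQ, withDensity_apply _ hQm,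
      setLIntegral_withDensity_eq hσ (fun y => f y * (σ y)⁻¹) (hf.mul hσ.inv) hQm]
    congr 1
    refine lintegral_congr fun z => ?_
    rw [mul_left_comm, ENNReal.mul_inv_cancel (hσ0 z) (hσt z), mul_one]
  have h1 : W⁻¹ * (V * (S⁻¹ * (∫⁻ z in Q, f z ∂ρ)) ^ (p - 1)) ≤
      D.maxFn (ρ.withDensity w) (fun y => G y ^ (p - 1) * (w y)⁻¹) x := by
    refine le_trans ?_ (D.avg_le_maxFn (ρ.withDensity w) k _ x)
    rw [avg, ← hQ, withDensity_apply _ hQm, setLIntegral_withDensity_eq hw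
      (fun y => G y ^ (p - 1) * (w y)⁻¹) ((hG.pow_const _).mul hw.inv) hQm]
    gcongr
    calc V * (S⁻¹ * (∫⁻ z in Q, f z ∂ρ)) ^ (p - 1)
        = ∫⁻ _ in Q, (S⁻¹ * (∫⁻ z in Q, f z ∂ρ)) ^ (p - 1) ∂ρ := by
          rw [setLIntegral_const, mul_comm]
      _ ≤ _ := by
          refine setLIntegral_mono' hQm fun y hy => ?_
          rw [mul_left_comm, ENNReal.mul_inv_cancel (hw0 y) (hwt y), mul_one]
          gcongr
          exact hG' y hy
  refine le_trans ?_ (mul_le_mul_right h1 K)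
  rw [avg, ENNReal.mul_rpow_of_nonneg _ _ hr.le, ENNReal.mul_rpow_of_nonneg _ _ hr.le]
  have h2 : V⁻¹ ^ (p - 1) ≤ K * W⁻¹ * V * (S⁻¹ ^ (p - 1)) := by
    have hVp0 : V ^ p ≠ 0 := by simp [ENNReal.rpow_eq_zero_iff, hV0, hVt]
    have hVpt : V ^ p ≠ ∞ := ENNReal.rpow_ne_top_of_nonneg (by linarith) hVt
    have e : V⁻¹ ^ (p - 1) = V * (V ^ p)⁻¹ := by
      rw [← ENNReal.rpow_neg_one, ← ENNReal.rpow_neg_one (V ^ p), ← ENNReal.rpow_mul,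
        ← ENNReal.rpow_mul]
      nth_rewrite 2 [← ENNReal.rpow_one V]
      rw [← ENNReal.rpow_add _ _ hV0 hVt]
      congr 1; ring
    have e2 : (V ^ p)⁻¹ ≤ K * (W * S ^ (p - 1))⁻¹ := by
      rw [← div_eq_mul_inv, ENNReal.le_div_iff_mul_le (.inl (mul_ne_zero hW0 hSp0)) (.inl hfin),
        mul_comm, ← div_eq_mul_inv]
      exact ENNReal.div_le_of_le_mul hWS
    rw [e]
    refine (mul_le_mul_right e2 V).trans_eq ?_
    rw [ENNReal.mul_inv (.inl hW0) (.inl hWt), ENNReal.inv_rpow]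
    ring
  refine (mul_le_mul_left h2 _).trans_eq ?_
  ring

/-- The constant of the weighted maximal inequality on `L^p(w)`, `w ∈ A_p`. -/
noncomputable def maxConst (p : ℝ) (K : ℝ≥0∞) : ℝ≥0∞ :=
  K ^ (p / (p - 1)) * doobConst (p / (p - 1)) * doobConst p

theorem maxConst_ne_top {p : ℝ} (hp : 1 < p) {K : ℝ≥0∞} (hK : K ≠ ∞) : maxConst p K ≠ ∞ := by
  have hr : 0 < p - 1 := by linarith
  have h1 : 1 < p / (p - 1) := by rw [one_lt_div hr]; linarith
  exact ENNReal.mul_ne_top (ENNReal.mul_ne_top (ENNReal.rpow_ne_top_of_nonneg (by linarith) hK)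
    (doobConst_ne_top h1)) (doobConst_ne_top hp)

/-- Muckenhoupt's theorem for the maximal function of a cell system. -/
theorem lintegral_maxFn_rpow_mul_le [Countable ι] {A : ℝ≥0∞} (hD : D.Regular ρ A) {p s : ℝ}
    (hp : 1 < p) (hs : s * (p - 1) = -1)
    {K : ℝ≥0∞} (hK : K ≠ ∞) {w : X → ℝ≥0∞} (hw : Measurable w)
    (hw0 : ∀ x, w x ≠ 0) (hwt : ∀ x, w x ≠ ∞)
    (hA : ∀ k x, (∫⁻ y in D.cell k x, w y ∂ρ) * (∫⁻ y in D.cell k x, w y ^ s ∂ρ) ^ (p - 1) ≤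
      K * ρ (D.cell k x) ^ p) {f : X → ℝ≥0∞} (hf : Measurable f) :
    ∫⁻ x, D.maxFn ρ f x ^ p * w x ∂ρ ≤ maxConst p K * ∫⁻ x, f x ^ p * w x ∂ρ := by
  have hr : 0 < p - 1 := by linarith
  have hq1 : 1 < p / (p - 1) := by rw [one_lt_div hr]; linarith
  set q := p / (p - 1) with hq
  have hqr : (p - 1) * q = p := by rw [hq]; field_simp
  have hσ : Measurable fun y => w y ^ s := hw.pow_const s
  have hσ0 : ∀ x, w x ^ s ≠ 0 := fun x => by simp [ENNReal.rpow_eq_zero_iff, hw0, hwt]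
  have hσt : ∀ x, w x ^ s ≠ ∞ := fun x => by simp [ENNReal.rpow_eq_top_iff, hw0, hwt]
  set G := D.maxFn (ρ.withDensity fun y => w y ^ s) fun y => f y * (w y ^ s)⁻¹ with hGdef
  have hG : Measurable G := D.measurable_maxFn _ _
  set h : X → ℝ≥0∞ := fun y => G y ^ (p - 1) * (w y)⁻¹ with hh
  have hhm : Measurable h := (hG.pow_const _).mul hw.inv
  have hpt : ∀ x, D.maxFn ρ f x ^ p ≤ K ^ q * D.maxFn (ρ.withDensity w) h x ^ q := by
    intro x
    rw [← hqr, ENNReal.rpow_mul, ← ENNReal.mul_rpow_of_nonneg _ _ (by linarith)]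
    refine ENNReal.rpow_le_rpow ?_ (by linarith)
    rw [← ENNReal.le_rpow_inv_iff hr]
    refine iSup_le fun k => ?_
    rw [ENNReal.le_rpow_inv_iff hr]
    exact avg_pow_le_maxFn_withDensity hD hp hK hw hw0 hwt hA hf k x
  -- With `q = p'` one has `1 - q = s`, so `h^q w = G^p σ`: the bound on `L^q(w)` hands over to a
  -- bound on `L^p(σ)`.
  have hwp : ∀ x, w x ^ (1 - q) = w x ^ s := by
    intro x
    congr 1
    have : s = -1 / (p - 1) := by field_simp; linarith
    rw [hq, this]; field_simp; ring
  -- Dually `σ^(1-p) = w`, so `(f/σ)^p σ = f^p w` closes the circle.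
  have hwp2 : ∀ x, (w x ^ s) ^ (1 - p) = w x := by
    intro x
    rw [← ENNReal.rpow_mul]
    have : s * (1 - p) = 1 := by linarith
    rw [this, ENNReal.rpow_one]
  have split : ∀ (a u : ℝ≥0∞) (t : ℝ), 1 < t → u ≠ 0 → u ≠ ∞ →
      u * (a * u⁻¹) ^ t = a ^ t * u ^ (1 - t) := by
    intro a u t ht hu hut
    rw [ENNReal.mul_rpow_of_nonneg _ _ (by linarith), ENNReal.inv_rpow, ← ENNReal.rpow_neg,
      sub_eq_add_neg, ENNReal.rpow_add _ _ hu hut, ENNReal.rpow_one]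
    ring
  calc ∫⁻ x, D.maxFn ρ f x ^ p * w x ∂ρ
      ≤ ∫⁻ x, K ^ q * (w x * D.maxFn (ρ.withDensity w) h x ^ q) ∂ρ := by
        refine lintegral_mono fun x => (mul_le_mul_left (hpt x) _).trans_eq ?_
        ring
    _ = K ^ q * ∫⁻ x, D.maxFn (ρ.withDensity w) h x ^ q ∂(ρ.withDensity w) := by
        rw [lintegral_const_mul, lintegral_withDensity_eq_lintegral_mul _ hw]
        · rfl
        · exact (D.measurable_maxFn _ _).pow_const _
        · exact hw.mul ((D.measurable_maxFn _ _).pow_const _)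
    _ ≤ K ^ q * (doobConst q * ∫⁻ x, h x ^ q ∂(ρ.withDensity w)) := by
        gcongr; exact D.lintegral_maxFn_rpow_le _ hq1 hhm
    _ = K ^ q * (doobConst q * ∫⁻ x, G x ^ p ∂(ρ.withDensity fun y => w y ^ s)) := by
        rw [lintegral_withDensity_eq_lintegral_mul _ hw (hhm.pow_const _),
          lintegral_withDensity_eq_lintegral_mul _ hσ (hG.pow_const _)]
        congr 3 with x
        simp only [Pi.mul_apply, hh]
        rw [split _ _ _ hq1 (hw0 x) (hwt x), hwp, ← ENNReal.rpow_mul, hqr, mul_comm]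
    _ ≤ K ^ q * (doobConst q * (doobConst p * ∫⁻ x, (f x * (w x ^ s)⁻¹) ^ p
          ∂(ρ.withDensity fun y => w y ^ s))) := by
        gcongr; exact D.lintegral_maxFn_rpow_le _ hp (hf.mul hσ.inv)
    _ = maxConst p K * ∫⁻ x, f x ^ p * w x ∂ρ := by
        rw [← setLIntegral_univ, setLIntegral_withDensity_eq hσ (fun y => (f y * (w y ^ s)⁻¹) ^ p)
          ((hf.mul hσ.inv).pow_const _) MeasurableSet.univ, setLIntegral_univ, maxConst,
          mul_assoc, mul_assoc]
        congr 4 with x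
        rw [split _ _ _ hp (hσ0 x) (hσt x), hwp2]

end CellSystem

/-! ### Stopping cells and domination of oscillations in one parameter. -/

namespace CellSystem

variable {X ι : Type*} [MeasurableSpace X] [Countable ι]
variable {D : CellSystem X ι} {ρ : Measure X} {A : ℝ≥0∞}

/-- Selection of the maximal subcells, up to generation `N`, of a cell of generation `k` on which
one of two functions has a large average. -/
structure Stopping (D : CellSystem X ι) (ρ : Measure X) (A : ℝ≥0∞) (k N : ℤ) (x₀ : X)
    (u₁ u₂ : X → ℝ≥0∞) (a₁ a₂ : ℝ≥0∞) (Ω : ℤ → Set X) : Prop where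
  saturated : ∀ j, D.Saturated j (Ω j)
  disjoint : Pairwise (Function.onFun Disjoint Ω)
  subset : ∀ j, Ω j ⊆ D.cell k x₀
  lt : ∀ j, ∀ x ∈ Ω j, k < j
  le : ∀ j, ∀ x ∈ Ω j, j ≤ N
  avg_le₁ : ∀ j, ∀ x ∈ Ω j, D.avg ρ j u₁ x ≤ A * (4 * a₁)
  avg_le₂ : ∀ j, ∀ x ∈ Ω j, D.avg ρ j u₂ x ≤ A * (4 * a₂)
  avg_le_compl₁ : ∀ x ∈ D.cell k x₀ \ ⋃ j, Ω j, D.avg ρ N u₁ x ≤ 4 * a₁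
  avg_le_compl₂ : ∀ x ∈ D.cell k x₀ \ ⋃ j, Ω j, D.avg ρ N u₂ x ≤ 4 * a₂
  measure_le : ρ (D.cell k x₀) ≤ 2 * ρ (D.cell k x₀ \ ⋃ j, Ω j)

/-- The set where averages are large has small measure. -/
theorem four_mul_measure_iUnion_le (hD : D.Regular ρ A) {k : ℤ} {x₀ : X} {u : X → ℝ≥0∞}
    {a : ℝ≥0∞} (hu : ∫⁻ y in D.cell k x₀, u y ∂ρ ≤ a * ρ (D.cell k x₀)) {Ω : ℤ → Set X}
    (hs : ∀ j, D.Saturated j (Ω j)) (hd : Pairwise (Function.onFun Disjoint Ω))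
    (hsub : ∀ j, Ω j ⊆ D.cell k x₀) (hΩ : ∀ j, ∀ x ∈ Ω j, 4 * a < D.avg ρ j u x) :
    4 * ρ (⋃ j, Ω j) ≤ ρ (D.cell k x₀) := by
  have hm : ∀ j, MeasurableSet (Ω j) := fun j => (hs j).measurableSet
  rcases eq_or_ne a 0 with rfl | ha0
  · have : ∀ j, Ω j = ∅ := by
      intro j
      refine eq_empty_of_forall_notMem fun x hx => ?_
      have h := hΩ j x hx
      rw [mul_zero, avg] at h
      have h0 : ∫⁻ y in D.cell j x, u y ∂ρ ≤ ∫⁻ y in D.cell k x₀, u y ∂ρ :=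
        lintegral_mono_set (((hs j).cell_subset hx).trans (hsub j))
      rw [zero_mul] at hu
      rw [nonpos_iff_eq_zero.1 (h0.trans hu), mul_zero] at h
      exact lt_irrefl _ h
    simp [this]
  rcases eq_or_ne a ∞ with rfl | hat
  · have : ∀ j, Ω j = ∅ := by
      intro j
      refine eq_empty_of_forall_notMem fun x hx => ?_
      have h := hΩ j x hx
      rw [ENNReal.mul_top (by simp)] at h
      exact not_top_lt h
    simp [this]
  rw [← ENNReal.mul_le_mul_iff_right ha0 hat]
  refine le_trans ?_ hu
  calc a * (4 * ρ (⋃ j, Ω j)) = ∫⁻ _ in ⋃ j, Ω j, 4 * a ∂ρ := by rw [setLIntegral_const]; ring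
    _ = ∑' j, ∫⁻ _ in Ω j, 4 * a ∂ρ := lintegral_iUnion hm hd _
    _ ≤ ∑' j, ∫⁻ y in Ω j, u y ∂ρ := by
        refine ENNReal.tsum_le_tsum fun j => (hs j).setLIntegral_le fun x hx => ?_
        rw [setLIntegral_const, setLIntegral_cell_eq hD, mul_comm]
        gcongr
        exact (hΩ j x hx).le
    _ = ∫⁻ y in ⋃ j, Ω j, u y ∂ρ := (lintegral_iUnion hm hd _).symm
    _ ≤ _ := lintegral_mono_set (iUnion_subset hsub)

theorem avg_le_of_setLIntegral_le {k : ℤ} {x : X} {u : X → ℝ≥0∞}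
    {a : ℝ≥0∞} (hu : ∫⁻ y in D.cell k x, u y ∂ρ ≤ a * ρ (D.cell k x)) : D.avg ρ k u x ≤ a := by
  rw [avg, mul_comm, ← div_eq_mul_inv]
  exact ENNReal.div_le_of_le_mul hu

/-- The selected cells are the coarsest ones, of generation in `(k, N]`, where one of the averages
exceeds four times its bound. The parent of a selected cell is not of this kind, and doubling bounds
the average on the cell itself. The factor 4 gives each function at most a quarter of the cell,
leaving half for the complement. -/
theorem exists_stopping (hD : D.Regular ρ A) (k N : ℤ) (hkN : k ≤ N) (x₀ : X)
    {u₁ u₂ : X → ℝ≥0∞} {a₁ a₂ : ℝ≥0∞}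
    (h₁ : ∫⁻ y in D.cell k x₀, u₁ y ∂ρ ≤ a₁ * ρ (D.cell k x₀))
    (h₂ : ∫⁻ y in D.cell k x₀, u₂ y ∂ρ ≤ a₂ * ρ (D.cell k x₀)) :
    ∃ Ω, Stopping D ρ A k N x₀ u₁ u₂ a₁ a₂ Ω := by
  set bad : ℤ → X → Prop := fun j x => 4 * a₁ < D.avg ρ j u₁ x ∨ 4 * a₂ < D.avg ρ j u₂ x
  have hbad : ∀ {i j x y}, i ≤ j → D.idx j x = D.idx j y → (bad i x ↔ bad i y) := by
    intro i j x y hij h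
    simp only [bad, D.avg_congr_idx ρ hij _ h]
  set Ω : ℤ → Set X := fun j => {x | x ∈ D.cell k x₀ ∧ k < j ∧ j ≤ N ∧ bad j x ∧
    ∀ i, k < i → i < j → ¬ bad i x} with hΩdef
  have hs : ∀ j, D.Saturated j (Ω j) := by
    rintro j x y hxy ⟨h1, h2, h3, h4, h5⟩
    exact ⟨D.saturated_cell h2.le x₀ hxy h1, h2, h3, (hbad le_rfl hxy).1 h4,
      fun i hi hij h => h5 i hi hij ((hbad hij.le hxy).2 h)⟩
  have hd : Pairwise (Function.onFun Disjoint Ω) := by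
    intro i j hij
    refine Set.disjoint_left.2 fun x hx hx' => ?_
    rcases lt_or_gt_of_ne hij with h | h
    · exact hx'.2.2.2.2 i hx.2.1 h hx.2.2.2.1
    · exact hx.2.2.2.2 j hx'.2.1 h hx'.2.2.2.1
  have hm : ∀ j, MeasurableSet (Ω j) := fun j => (hs j).measurableSet
  have hk : ∀ x ∈ D.cell k x₀, ¬ bad k x := by
    intro x hx
    have hx' : D.cell k x = D.cell k x₀ := D.cell_eq hx
    rw [← hx'] at h₁ h₂
    have l4 : ∀ a : ℝ≥0∞, a ≤ 4 * a := fun a => le_mul_of_one_le_left' (by norm_num)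
    simp only [bad, not_or, not_lt]
    exact ⟨(avg_le_of_setLIntegral_le h₁).trans (l4 _),
      (avg_le_of_setLIntegral_le h₂).trans (l4 _)⟩
  -- The parent is either the starting cell, which is good by hypothesis, or a strictly intermediate
  -- generation, which is good because `j` is the earliest bad one.
  have hprev : ∀ j, ∀ x ∈ Ω j, ¬ bad (j - 1) x := by
    rintro j x ⟨h1, h2, h3, h4, h5⟩
    rcases eq_or_lt_of_le (show k ≤ j - 1 by omega) with h | h
    · rw [← h]; exact hk x h1
    · exact h5 _ h (by omega)
  have hcompl : ∀ x ∈ D.cell k x₀ \ ⋃ j, Ω j, ¬ bad N x := by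
    rintro x ⟨hx, hx'⟩ hN
    have hkN' : k < N := lt_of_le_of_ne hkN (by rintro rfl; exact hk x hx hN)
    obtain ⟨j, ⟨hj1, hj2⟩, hj3⟩ := Int.exists_least_of_bdd (P := fun j => k < j ∧ bad j x)
      ⟨k, fun z hz => hz.1.le⟩ ⟨N, hkN', hN⟩
    refine hx' (mem_iUnion.2 ⟨j, hx, hj1, hj3 N ⟨hkN', hN⟩, hj2, fun i hi hij h => ?_⟩)
    exact absurd (hj3 i ⟨hi, h⟩) (by omega)
  refine ⟨Ω, hs, hd, fun j x hx => hx.1, fun j x hx => hx.2.1, fun j x hx => hx.2.2.1, ?_, ?_,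
    fun x hx => ?_, fun x hx => ?_, ?_⟩
  · intro j x hx
    have h := hprev j x hx
    simp only [bad, not_or, not_lt] at h
    have := avg_succ_le hD (j - 1) u₁ x
    rw [sub_add_cancel] at this
    exact this.trans (mul_le_mul_right h.1 A)
  · intro j x hx
    have h := hprev j x hx
    simp only [bad, not_or, not_lt] at h
    have := avg_succ_le hD (j - 1) u₂ x
    rw [sub_add_cancel] at this
    exact this.trans (mul_le_mul_right h.2 A)
  · have h := hcompl x hx
    simp only [bad, not_or, not_lt] at h
    exact h.1
  · have h := hcompl x hx
    simp only [bad, not_or, not_lt] at h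
    exact h.2
  · have key : ∀ (u : X → ℝ≥0∞) (a : ℝ≥0∞),
        ∫⁻ y in D.cell k x₀, u y ∂ρ ≤ a * ρ (D.cell k x₀) →
        4 * ρ (⋃ j, Ω j ∩ {x | 4 * a < D.avg ρ j u x}) ≤ ρ (D.cell k x₀) := by
      intro u a hu
      refine four_mul_measure_iUnion_le hD hu ?_ ?_ ?_ fun j x hx => hx.2
      · rintro j x y hxy ⟨h, h'⟩
        refine ⟨hs j hxy h, ?_⟩
        rw [mem_ofPred_eq] at h' ⊢
        rwa [← D.avg_congr_idx ρ le_rfl u hxy]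
      · exact fun i j hij => (hd hij).mono inter_subset_left inter_subset_left
      · exact fun j x hx => hx.1.1
    have h4 : 4 * ρ (⋃ j, Ω j) ≤ 2 * ρ (D.cell k x₀) := by
      have hsub : (⋃ j, Ω j) ⊆ (⋃ j, Ω j ∩ {x | 4 * a₁ < D.avg ρ j u₁ x}) ∪
          ⋃ j, Ω j ∩ {x | 4 * a₂ < D.avg ρ j u₂ x} := by
        intro x hx
        obtain ⟨j, hj⟩ := mem_iUnion.1 hx
        rcases hj.2.2.2.1 with h | h
        · exact .inl (mem_iUnion.2 ⟨j, hj, h⟩)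
        · exact .inr (mem_iUnion.2 ⟨j, hj, h⟩)
      calc _ ≤ 4 * _ := mul_le_mul_right ((measure_mono hsub).trans (measure_union_le _ _)) 4
        _ ≤ _ := by rw [mul_add, two_mul]; exact add_le_add (key u₁ a₁ h₁) (key u₂ a₂ h₂)
    have hU : MeasurableSet (⋃ j, Ω j) := MeasurableSet.iUnion hm
    have hsubU : (⋃ j, Ω j) ⊆ D.cell k x₀ := iUnion_subset fun j x hx => hx.1
    have hfin := hD.ne_top k x₀
    have hUfin : ρ (⋃ j, Ω j) ≠ ∞ := ne_top_of_le_ne_top hfin (measure_mono hsubU)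
    have hsum := measure_sdiff_add_inter (μ := ρ) (D.cell k x₀) hU
    rw [inter_eq_self_of_subset_right hsubU] at hsum
    have hEfin : ρ (D.cell k x₀ \ ⋃ j, Ω j) ≠ ∞ :=
      ne_top_of_le_ne_top hfin (measure_mono sdiff_subset)
    rw [← hsum] at h4 ⊢
    lift ρ (⋃ j, Ω j) to ℝ≥0 using hUfin with b
    lift ρ (D.cell k x₀ \ ⋃ j, Ω j) to ℝ≥0 using hEfin with e
    norm_cast at h4 ⊢
    rw [← NNReal.coe_le_coe] at h4 ⊢
    push_cast at h4 ⊢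
    linarith

/-- Downward induction on the generation, along stopping cells. -/
theorem setLIntegral_le_of_stopping {N : ℤ} {Φ : ℤ → X → ℝ≥0∞} {H : X → ℝ≥0∞}
    (hstep : ∀ k ≤ N, ∀ x₀, ∃ Ω : ℤ → Set X, (∀ j, D.Saturated j (Ω j)) ∧
      Pairwise (Function.onFun Disjoint Ω) ∧ (∀ j, Ω j ⊆ D.cell k x₀) ∧
      (∀ j, ∀ x ∈ Ω j, k < j) ∧ (∀ j, ∀ x ∈ Ω j, j ≤ N) ∧
      ∫⁻ x in D.cell k x₀, Φ k x ∂ρ ≤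
        ∫⁻ x in D.cell k x₀ \ ⋃ j, Ω j, H x ∂ρ + ∑' j, ∫⁻ x in Ω j, Φ j x ∂ρ) :
    ∀ k ≤ N, ∀ S, D.Saturated k S → ∫⁻ x in S, Φ k x ∂ρ ≤ ∫⁻ x in S, H x ∂ρ := by
  -- The induction is on `N - k`. Stopping cells have generation in `(k, N]`, so at `k = N` there
  -- are none and the recursion ends.
  have main : ∀ n : ℕ, ∀ k ≤ N, N - k ≤ n → ∀ S, D.Saturated k S →
      ∫⁻ x in S, Φ k x ∂ρ ≤ ∫⁻ x in S, H x ∂ρ := by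
    intro n
    induction n using Nat.strong_induction_on with
    | _ n ih =>
      intro k hk hn S hS
      refine hS.setLIntegral_le fun x₀ _ => ?_
      obtain ⟨Ω, hs, hd, hsub, hlt, hle, hΦ⟩ := hstep k hk x₀
      have hm : ∀ j, MeasurableSet (Ω j) := fun j => (hs j).measurableSet
      refine hΦ.trans ?_
      have : ∑' j, ∫⁻ x in Ω j, Φ j x ∂ρ ≤ ∑' j, ∫⁻ x in Ω j, H x ∂ρ := by
        refine ENNReal.tsum_le_tsum fun j => ?_
        rcases (Ω j).eq_empty_or_nonempty with h0 | ⟨x, hx⟩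
        · simp [h0]
        · have h1 := hlt j x hx
          have h2 := hle j x hx
          exact ih (N - j).toNat (by omega) j h2 (by omega) _ (hs j)
      -- The complement and the stopping cells partition the cell, so the integrals of `H` add up
      -- exactly and the constant does not grow with the number of stages.
      refine (add_le_add_right this _).trans ?_
      rw [← lintegral_iUnion hm hd, add_comm]
      have := lintegral_inter_add_sdiff (μ := ρ) H (D.cell k x₀) (MeasurableSet.iUnion hm)
      rw [inter_eq_self_of_subset_right (iUnion_subset hsub)] at this
      exact this.le
  exact fun k hk S hS => main (N - k).toNat k hk (by omega) S hS

/-- Splitting of an integral along stopping cells. -/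
theorem setLIntegral_cell_le_add_tsum {k : ℤ} {x₀ : X} {Ω : ℤ → Set X}
    (hs : ∀ j, D.Saturated j (Ω j)) (hd : Pairwise (Function.onFun Disjoint Ω))
    (hsub : ∀ j, Ω j ⊆ D.cell k x₀) {F R : X → ℝ≥0∞} {G : ℤ → X → ℝ≥0∞} (hR : Measurable R)
    (hE : ∀ x ∈ D.cell k x₀ \ ⋃ j, Ω j, F x ≤ R x) (hΩ : ∀ j, ∀ x ∈ Ω j, F x ≤ G j x + R x) :
    ∫⁻ x in D.cell k x₀, F x ∂ρ ≤
      ∫⁻ x in D.cell k x₀, R x ∂ρ + ∑' j, ∫⁻ x in Ω j, G j x ∂ρ := by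
  have hm : ∀ j, MeasurableSet (Ω j) := fun j => (hs j).measurableSet
  have hU : MeasurableSet (⋃ j, Ω j) := MeasurableSet.iUnion hm
  have e := fun H : X → ℝ≥0∞ => lintegral_inter_add_sdiff (μ := ρ) H (D.cell k x₀) hU
  simp only [inter_eq_self_of_subset_right (iUnion_subset hsub)] at e
  rw [← e F, ← e R, lintegral_iUnion hm hd, lintegral_iUnion hm hd]
  have h1 : ∑' j, ∫⁻ x in Ω j, F x ∂ρ ≤
      ∑' j, ∫⁻ x in Ω j, R x ∂ρ + ∑' j, ∫⁻ x in Ω j, G j x ∂ρ := by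
    rw [← ENNReal.tsum_add]
    refine ENNReal.tsum_le_tsum fun j => ?_
    rw [add_comm, ← lintegral_add_right _ hR]
    exact setLIntegral_mono' (hm j) fun x hx => hΩ j x hx
  have h2 : ∫⁻ x in D.cell k x₀ \ ⋃ j, Ω j, F x ∂ρ ≤ ∫⁻ x in D.cell k x₀ \ ⋃ j, Ω j, R x ∂ρ :=
    setLIntegral_mono' ((D.measurableSet_cell k x₀).diff hU) hE
  refine (add_le_add h1 h2).trans_eq ?_
  ring

/-- A quantitative `A_∞` condition on cells. -/
def AInfty (D : CellSystem X ι) (ρ : Measure X) (Λ : ℝ≥0∞) (w : X → ℝ≥0∞) : Prop :=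
  ∀ k x (E : Set X), MeasurableSet E → E ⊆ D.cell k x → ρ (D.cell k x) ≤ 2 * ρ E →
    ∫⁻ y in D.cell k x, w y ∂ρ ≤ Λ * ∫⁻ y in E, w y ∂ρ

/-- The average can be moved from `w` to `g`, since `⟨w⟩_Q ∫_Q g = w(Q)⟨g⟩_Q`. Then `A_∞` replaces
`w(Q)` by `w(E)`, and `⟨g⟩_Q` is at most the maximal function on `E`. This is how a bound
proportional to `⟨w⟩_Q` is paid for on the complement of the stopping cells alone. -/
theorem AInfty.avg_mul_setLIntegral_le {Λ : ℝ≥0∞} {w : X → ℝ≥0∞} (hw : AInfty D ρ Λ w)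
    (hwm : Measurable w) {k : ℤ} {x : X} {E : Set X} (hE : MeasurableSet E)
    (hEs : E ⊆ D.cell k x) (hρ : ρ (D.cell k x) ≤ 2 * ρ E) (g : X → ℝ≥0∞) :
    D.avg ρ k w x * ∫⁻ y in D.cell k x, g y ∂ρ ≤ Λ * ∫⁻ y in E, w y * D.maxFn ρ g y ∂ρ := by
  calc D.avg ρ k w x * ∫⁻ y in D.cell k x, g y ∂ρ
      = (∫⁻ y in D.cell k x, w y ∂ρ) * D.avg ρ k g x := by rw [avg, avg]; ring
    _ ≤ (Λ * ∫⁻ y in E, w y ∂ρ) * D.avg ρ k g x := by gcongr; exact hw k x E hE hEs hρ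
    _ = Λ * ∫⁻ y in E, w y * D.avg ρ k g x ∂ρ := by
        rw [lintegral_mul_const _ hwm, mul_assoc]
    _ ≤ _ := by
        gcongr 1
        refine setLIntegral_mono' hE fun y hy => ?_
        gcongr
        rw [D.avg_congr_idx ρ le_rfl g (x := x) (y := y) (hEs hy).symm]
        exact D.avg_le_maxFn ρ k g y

/-- The average of a complex function over the cell of generation `k` containing `x`. -/
noncomputable def cavg (D : CellSystem X ι) (ρ : Measure X) (k : ℤ) (b : X → ℂ) (x : X) : ℂ :=
  ⨍ y in D.cell k x, b y ∂ρ

theorem cavg_congr_idx {k : ℤ} (b : X → ℂ) {x y : X}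
    (hxy : D.idx k x = D.idx k y) : D.cavg ρ k b x = D.cavg ρ k b y := by
  simp only [cavg, D.cell_eq hxy]

theorem measurable_cavg (k : ℤ) (b : X → ℂ) : Measurable (D.cavg ρ k b) :=
  D.measurable_of_idx fun _ _ h => cavg_congr_idx b h

theorem enorm_setAverage_sub_le {Q : Set X} (h0 : ρ Q ≠ 0) (ht : ρ Q ≠ ∞) {b : X → ℂ}
    (hb : IntegrableOn b Q ρ) (c : ℂ) :
    ‖(⨍ y in Q, b y ∂ρ) - c‖ₑ ≤ (ρ Q)⁻¹ * ∫⁻ y in Q, ‖b y - c‖ₑ ∂ρ := by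
  have hc : IntegrableOn (fun _ => c) Q ρ := integrableOn_const ht
  have : (⨍ y in Q, b y ∂ρ) - c = ⨍ y in Q, (b y - c) ∂ρ := by
    rw [setAverage_eq, setAverage_eq, integral_sub hb hc, smul_sub, setIntegral_const, smul_smul,
      inv_mul_cancel₀, one_smul]
    rw [measureReal_def]
    exact (ENNReal.toReal_pos h0 ht).ne'
  rw [this, setAverage_eq']
  refine (enorm_integral_le_lintegral_enorm _).trans_eq ?_
  rw [lintegral_smul_measure]
  rfl

theorem enorm_cavg_sub_le (hD : D.Regular ρ A) {b : X → ℂ} {k : ℤ} {x : X}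
    (hb : IntegrableOn b (D.cell k x) ρ) (c : ℂ) :
    ‖D.cavg ρ k b x - c‖ₑ ≤ D.avg ρ k (fun y => ‖b y - c‖ₑ) x :=
  enorm_setAverage_sub_le (hD.ne_zero k x) (hD.ne_top k x) hb c

/-- Weighted bounded mean oscillation over the cells. -/
structure HasOsc (D : CellSystem X ι) (ρ : Measure X) (B : ℝ≥0∞) (w : X → ℝ≥0∞) (b : X → ℂ) :
    Prop where
  integrableOn : ∀ k x, IntegrableOn b (D.cell k x) ρ
  osc_le : ∀ k x, ∫⁻ y in D.cell k x, ‖b y - D.cavg ρ k b x‖ₑ ∂ρ ≤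
    B * ∫⁻ y in D.cell k x, w y ∂ρ

theorem HasOsc.le_mul_measure (hD : D.Regular ρ A) {B : ℝ≥0∞} {w : X → ℝ≥0∞} {b : X → ℂ}
    (hb : HasOsc D ρ B w b) (k : ℤ) (x : X) :
    ∫⁻ y in D.cell k x, ‖b y - D.cavg ρ k b x‖ₑ ∂ρ ≤
      (B * D.avg ρ k w x) * ρ (D.cell k x) := by
  refine (hb.osc_le k x).trans_eq ?_
  rw [setLIntegral_cell_eq hD]; ring

/-- The constant in the domination of a mean oscillation. -/
noncomputable def oscConst (A Λ : ℝ≥0∞) : ℝ≥0∞ := (4 + A * 4) * Λ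

/-- With `a = B⟨w⟩_Q`, the oscillation is at most `4a` on the complement of the stopping cells. On a
stopping cell it is at most `4Aa` plus the oscillation about the average of that cell. The terms in
`a` are absorbed by `AInfty.avg_mul_setLIntegral_le` and the rest is the recursion. -/
theorem setLIntegral_enorm_cavg_sub_mul_le (hD : D.Regular ρ A) {Λ B : ℝ≥0∞} {w : X → ℝ≥0∞}
    (hwm : Measurable w) (hw : AInfty D ρ Λ w) {b : X → ℂ} (hb : HasOsc D ρ B w b)
    {g : X → ℝ≥0∞} (hg : Measurable g) (N : ℤ) :
    ∀ k ≤ N, ∀ S, D.Saturated k S →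
      ∫⁻ x in S, ‖D.cavg ρ N b x - D.cavg ρ k b x‖ₑ * g x ∂ρ ≤
        ∫⁻ x in S, oscConst A Λ * B * (w x * D.maxFn ρ g x) ∂ρ := by
  refine setLIntegral_le_of_stopping
    (Φ := fun k x => ‖D.cavg ρ N b x - D.cavg ρ k b x‖ₑ * g x) fun k hk x₀ => ?_
  set a := B * D.avg ρ k w x₀ with ha
  -- There is only one symbol, so it occupies both slots of the stopping construction.
  obtain ⟨Ω, hΩ⟩ := exists_stopping hD k N hk x₀ (hb.le_mul_measure hD k x₀)
    (hb.le_mul_measure hD k x₀)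
  refine ⟨Ω, hΩ.saturated, hΩ.disjoint, hΩ.subset, hΩ.lt, hΩ.le, ?_⟩
  have hc : ∀ x ∈ D.cell k x₀, D.cavg ρ k b x = D.cavg ρ k b x₀ := fun x hx => cavg_congr_idx b hx
  have hwM : Measurable fun x => w x * D.maxFn ρ g x := hwm.mul (D.measurable_maxFn ρ g)
  have hEm : MeasurableSet (D.cell k x₀ \ ⋃ j, Ω j) :=
    (D.measurableSet_cell k x₀).diff (MeasurableSet.iUnion fun j => (hΩ.saturated j).measurableSet)
  have h1 := setLIntegral_cell_le_add_tsum (ρ := ρ) hΩ.saturated hΩ.disjoint hΩ.subset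
    (F := fun x => ‖D.cavg ρ N b x - D.cavg ρ k b x‖ₑ * g x)
    (G := fun j x => ‖D.cavg ρ N b x - D.cavg ρ j b x‖ₑ * g x)
    (R := fun x => (4 + A * 4) * a * g x) (hg.const_mul _) ?_ ?_
  · refine h1.trans (add_le_add_left ?_ _)
    rw [lintegral_const_mul _ hg, lintegral_const_mul _ hwM]
    have h2 := hw.avg_mul_setLIntegral_le hwm hEm sdiff_subset hΩ.measure_le g
    calc (4 + A * 4) * a * ∫⁻ x in D.cell k x₀, g x ∂ρ
        = (4 + A * 4) * B * (D.avg ρ k w x₀ * ∫⁻ x in D.cell k x₀, g x ∂ρ) := by rw [ha]; ring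
      _ ≤ (4 + A * 4) * B * _ := mul_le_mul_right h2 _
      _ = _ := by rw [oscConst]; ring
  · intro x hx
    have := (enorm_cavg_sub_le hD (hb.integrableOn N x) _).trans (hΩ.avg_le_compl₁ x hx)
    rw [hc x hx.1, add_mul, add_mul]
    exact (mul_le_mul_left this _).trans le_self_add
  · intro j x hx
    have h2 := (enorm_cavg_sub_le hD (hb.integrableOn j x) _).trans (hΩ.avg_le₁ j x hx)
    rw [hc x (hΩ.subset j hx), ← add_mul]
    gcongr
    calc ‖D.cavg ρ N b x - D.cavg ρ k b x₀‖ₑ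
        = ‖(D.cavg ρ N b x - D.cavg ρ j b x) + (D.cavg ρ j b x - D.cavg ρ k b x₀)‖ₑ := by
          congr 1; ring
      _ ≤ _ := enorm_add_le _ _
      _ ≤ _ := by
          gcongr
          refine h2.trans ?_
          rw [add_mul, ← mul_assoc]
          exact le_add_self

/-- The grouping fits both uses: in the stopping recursion the first three terms are local to a
stopping cell and the last is the constant part, and on rectangles these are the four combinations
of oscillations in `x` and in `y`. -/
theorem mul_mul_le_of_le_add {α₁ α₂ e₁ e₂ g : ℝ≥0∞} {β₁ β₂ : ℝ≥0∞} (h₁ : β₁ ≤ α₁ + e₁)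
    (h₂ : β₂ ≤ α₂ + e₂) :
    β₁ * β₂ * g ≤ (α₁ * α₂ * g + e₁ * (α₂ * g) + e₂ * (α₁ * g)) + e₁ * e₂ * g := by
  refine (mul_le_mul_left (mul_le_mul' h₁ h₂) g).trans_eq ?_
  ring

theorem enorm_cavg_sub_le_add (hD : D.Regular ρ A) {b : X → ℂ} {j N : ℤ} {x : X} {c : ℂ}
    {e : ℝ≥0∞} (hb : IntegrableOn b (D.cell j x) ρ)
    (h : D.avg ρ j (fun y => ‖b y - c‖ₑ) x ≤ e) :
    ‖D.cavg ρ N b x - c‖ₑ ≤ ‖D.cavg ρ N b x - D.cavg ρ j b x‖ₑ + e := by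
  refine le_trans ?_ (add_le_add_right ((enorm_cavg_sub_le hD hb c).trans h) _)
  refine le_trans (le_of_eq ?_) (enorm_add_le _ _)
  congr 1; ring

/-- The constant in the domination of a product of two mean oscillations. -/
noncomputable def oscConstTwo (A Λ : ℝ≥0∞) : ℝ≥0∞ := 2 * oscConst A Λ ^ 2

/-- Stopping cells are selected for both symbols at once. Besides the recursive product and a
constant term, the expansion leaves cross terms such as `a₁ |b₂ - ⟨b₂⟩| g` on the stopping cells.
The one-symbol estimate sums these to `a₁ ∫_Q w₂ Mg`, and transferring `a₁ = B₁⟨w₁⟩_Q` to the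
complement with `w₂ Mg` in the role of `g` gives `w₁ M(w₂ Mg)`. -/
theorem setLIntegral_enorm_cavg_sub_mul_mul_le (hD : D.Regular ρ A) {Λ B₁ B₂ : ℝ≥0∞}
    {w₁ w₂ : X → ℝ≥0∞} (hwm₁ : Measurable w₁) (hw₁ : AInfty D ρ Λ w₁) (hwm₂ : Measurable w₂)
    (hw₂ : AInfty D ρ Λ w₂) {b₁ b₂ : X → ℂ} (hb₁ : HasOsc D ρ B₁ w₁ b₁)
    (hb₂ : HasOsc D ρ B₂ w₂ b₂) {g : X → ℝ≥0∞} (hg : Measurable g) (N : ℤ) :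
    ∀ k ≤ N, ∀ S, D.Saturated k S →
      ∫⁻ x in S, ‖D.cavg ρ N b₁ x - D.cavg ρ k b₁ x‖ₑ * ‖D.cavg ρ N b₂ x - D.cavg ρ k b₂ x‖ₑ *
        g x ∂ρ ≤
      ∫⁻ x in S, oscConstTwo A Λ * B₁ * B₂ *
        (w₁ x * D.maxFn ρ (fun y => w₂ y * D.maxFn ρ g y) x +
          w₂ x * D.maxFn ρ (fun y => w₁ y * D.maxFn ρ g y) x) ∂ρ := by
  refine setLIntegral_le_of_stopping (Φ := fun k x => ‖D.cavg ρ N b₁ x - D.cavg ρ k b₁ x‖ₑ *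
    ‖D.cavg ρ N b₂ x - D.cavg ρ k b₂ x‖ₑ * g x) fun k hk x₀ => ?_
  set c : ℝ≥0∞ := 4 + A * 4 with hcdef
  set a₁ := B₁ * D.avg ρ k w₁ x₀ with ha₁
  set a₂ := B₂ * D.avg ρ k w₂ x₀ with ha₂
  obtain ⟨Ω, hΩ⟩ := exists_stopping hD k N hk x₀ (hb₁.le_mul_measure hD k x₀)
    (hb₂.le_mul_measure hD k x₀)
  refine ⟨Ω, hΩ.saturated, hΩ.disjoint, hΩ.subset, hΩ.lt, hΩ.le, ?_⟩
  have hm : ∀ j, MeasurableSet (Ω j) := fun j => (hΩ.saturated j).measurableSet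
  have hc : ∀ (b : X → ℂ), ∀ x ∈ D.cell k x₀, D.cavg ρ k b x = D.cavg ρ k b x₀ :=
    fun b x hx => cavg_congr_idx b hx
  have hMg := D.measurable_maxFn ρ g
  have hEm : MeasurableSet (D.cell k x₀ \ ⋃ j, Ω j) :=
    (D.measurableSet_cell k x₀).diff (MeasurableSet.iUnion hm)
  have hle4 : ∀ a : ℝ≥0∞, 4 * a ≤ c * a := fun a => by
    rw [hcdef, add_mul]; exact le_self_add
  have hleA : ∀ a : ℝ≥0∞, A * (4 * a) ≤ c * a := fun a => by
    rw [hcdef, add_mul, ← mul_assoc]; exact le_add_self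
  have hα : ∀ (b : X → ℂ) (j : ℤ), Measurable fun x => ‖D.cavg ρ N b x - D.cavg ρ j b x‖ₑ :=
    fun b j => ((measurable_cavg N b).sub (measurable_cavg j b)).enorm
  have h1 := setLIntegral_cell_le_add_tsum (ρ := ρ) hΩ.saturated hΩ.disjoint hΩ.subset
    (F := fun x => ‖D.cavg ρ N b₁ x - D.cavg ρ k b₁ x‖ₑ *
      ‖D.cavg ρ N b₂ x - D.cavg ρ k b₂ x‖ₑ * g x)
    (G := fun j x => ‖D.cavg ρ N b₁ x - D.cavg ρ j b₁ x‖ₑ *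
      ‖D.cavg ρ N b₂ x - D.cavg ρ j b₂ x‖ₑ * g x +
      c * a₁ * (‖D.cavg ρ N b₂ x - D.cavg ρ j b₂ x‖ₑ * g x) +
      c * a₂ * (‖D.cavg ρ N b₁ x - D.cavg ρ j b₁ x‖ₑ * g x))
    (R := fun x => (c * a₁) * (c * a₂) * g x) (hg.const_mul _) ?_ ?_
  · refine h1.trans ?_
    have hsum : ∀ {w : X → ℝ≥0∞} {b : X → ℂ} {B : ℝ≥0∞}, Measurable w → AInfty D ρ Λ w →
        HasOsc D ρ B w b →
        ∑' j, ∫⁻ x in Ω j, ‖D.cavg ρ N b x - D.cavg ρ j b x‖ₑ * g x ∂ρ ≤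
          oscConst A Λ * B * ∫⁻ x in D.cell k x₀, w x * D.maxFn ρ g x ∂ρ := by
      intro w b B hwm hw hb
      calc _ ≤ ∑' j, ∫⁻ x in Ω j, oscConst A Λ * B * (w x * D.maxFn ρ g x) ∂ρ := by
            refine ENNReal.tsum_le_tsum fun j => ?_
            rcases (Ω j).eq_empty_or_nonempty with h0 | ⟨x, hx⟩
            · simp [h0]
            · exact setLIntegral_enorm_cavg_sub_mul_le hD hwm hw hb hg N j (hΩ.le j x hx) _
                (hΩ.saturated j)
        _ = ∫⁻ x in ⋃ j, Ω j, oscConst A Λ * B * (w x * D.maxFn ρ g x) ∂ρ :=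
            (lintegral_iUnion hm hΩ.disjoint _).symm
        _ ≤ ∫⁻ x in D.cell k x₀, oscConst A Λ * B * (w x * D.maxFn ρ g x) ∂ρ :=
            lintegral_mono_set (iUnion_subset hΩ.subset)
        _ = _ := lintegral_const_mul _ (hwm.mul hMg)
    have htwo : ∀ {w w' : X → ℝ≥0∞}, Measurable w → AInfty D ρ Λ w →
        D.avg ρ k w x₀ * ∫⁻ x in D.cell k x₀, w' x * D.maxFn ρ g x ∂ρ ≤
          Λ * ∫⁻ x in D.cell k x₀ \ ⋃ j, Ω j,
            w x * D.maxFn ρ (fun y => w' y * D.maxFn ρ g y) x ∂ρ := fun hwm hw =>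
      hw.avg_mul_setLIntegral_le hwm hEm sdiff_subset hΩ.measure_le _
    have hR : ∫⁻ x in D.cell k x₀, (c * a₁) * (c * a₂) * g x ∂ρ ≤
        c ^ 2 * Λ * B₁ * B₂ * (D.avg ρ k w₁ x₀ *
          ∫⁻ x in D.cell k x₀, w₂ x * D.maxFn ρ g x ∂ρ) := by
      rw [lintegral_const_mul _ hg]
      -- Here `E` is the whole cell: only `⟨w₂⟩_Q` is converted, while `⟨w₁⟩_Q` is kept for `htwo`,
      -- which moves to the complement.
      have := hw₂.avg_mul_setLIntegral_le hwm₂ (D.measurableSet_cell k x₀) subset_rfl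
        (le_mul_of_one_le_left' (by norm_num)) g
      calc _ = c ^ 2 * B₁ * B₂ * D.avg ρ k w₁ x₀ *
            (D.avg ρ k w₂ x₀ * ∫⁻ x in D.cell k x₀, g x ∂ρ) := by rw [ha₁, ha₂]; ring
        _ ≤ c ^ 2 * B₁ * B₂ * D.avg ρ k w₁ x₀ * _ := mul_le_mul_right this _
        _ = _ := by ring
    have hG : ∑' j, ∫⁻ x in Ω j, (‖D.cavg ρ N b₁ x - D.cavg ρ j b₁ x‖ₑ *
          ‖D.cavg ρ N b₂ x - D.cavg ρ j b₂ x‖ₑ * g x +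
          c * a₁ * (‖D.cavg ρ N b₂ x - D.cavg ρ j b₂ x‖ₑ * g x) +
          c * a₂ * (‖D.cavg ρ N b₁ x - D.cavg ρ j b₁ x‖ₑ * g x)) ∂ρ =
        ∑' j, ∫⁻ x in Ω j, ‖D.cavg ρ N b₁ x - D.cavg ρ j b₁ x‖ₑ *
          ‖D.cavg ρ N b₂ x - D.cavg ρ j b₂ x‖ₑ * g x ∂ρ +
        c * a₁ * ∑' j, ∫⁻ x in Ω j, ‖D.cavg ρ N b₂ x - D.cavg ρ j b₂ x‖ₑ * g x ∂ρ +
        c * a₂ * ∑' j, ∫⁻ x in Ω j, ‖D.cavg ρ N b₁ x - D.cavg ρ j b₁ x‖ₑ * g x ∂ρ := by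
      rw [← ENNReal.tsum_mul_left, ← ENNReal.tsum_mul_left, ← ENNReal.tsum_add,
        ← ENNReal.tsum_add]
      refine tsum_congr fun j => ?_
      have m₁ : Measurable fun x => ‖D.cavg ρ N b₁ x - D.cavg ρ j b₁ x‖ₑ * g x := (hα b₁ j).mul hg
      have m₂ : Measurable fun x => ‖D.cavg ρ N b₂ x - D.cavg ρ j b₂ x‖ₑ * g x := (hα b₂ j).mul hg
      rw [lintegral_add_right _ (m₁.const_mul _), lintegral_add_right _ (m₂.const_mul _),
        lintegral_const_mul _ m₂, lintegral_const_mul _ m₁]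
    rw [hG]
    set P := ∫⁻ x in D.cell k x₀ \ ⋃ j, Ω j,
      w₁ x * D.maxFn ρ (fun y => w₂ y * D.maxFn ρ g y) x ∂ρ with hP
    set P' := ∫⁻ x in D.cell k x₀ \ ⋃ j, Ω j,
      w₂ x * D.maxFn ρ (fun y => w₁ y * D.maxFn ρ g y) x ∂ρ with hP'
    have hHe : ∫⁻ x in D.cell k x₀ \ ⋃ j, Ω j, oscConstTwo A Λ * B₁ * B₂ *
        (w₁ x * D.maxFn ρ (fun y => w₂ y * D.maxFn ρ g y) x +
          w₂ x * D.maxFn ρ (fun y => w₁ y * D.maxFn ρ g y) x) ∂ρ =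
        oscConstTwo A Λ * B₁ * B₂ * (P + P') := by
      rw [lintegral_const_mul, lintegral_add_right]
      · exact hwm₂.mul (D.measurable_maxFn _ _)
      · exact (hwm₁.mul (D.measurable_maxFn _ _)).add (hwm₂.mul (D.measurable_maxFn _ _))
    rw [hHe]
    have t1 : ∫⁻ x in D.cell k x₀, (c * a₁) * (c * a₂) * g x ∂ρ ≤
        oscConst A Λ ^ 2 * B₁ * B₂ * P := by
      refine (hR.trans (mul_le_mul_right (htwo hwm₁ hw₁) _)).trans_eq ?_
      rw [oscConst]; ring
    have t2 : c * a₁ * ∑' j, ∫⁻ x in Ω j, ‖D.cavg ρ N b₂ x - D.cavg ρ j b₂ x‖ₑ * g x ∂ρ ≤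
        oscConst A Λ ^ 2 * B₁ * B₂ * P := by
      calc _ ≤ c * a₁ * _ := mul_le_mul_right (hsum hwm₂ hw₂ hb₂) _
        _ = c * B₁ * oscConst A Λ * B₂ * (D.avg ρ k w₁ x₀ *
          ∫⁻ x in D.cell k x₀, w₂ x * D.maxFn ρ g x ∂ρ) := by rw [ha₁]; ring
        _ ≤ c * B₁ * oscConst A Λ * B₂ * _ := mul_le_mul_right (htwo hwm₁ hw₁) _
        _ = _ := by rw [oscConst]; ring
    have t3 : c * a₂ * ∑' j, ∫⁻ x in Ω j, ‖D.cavg ρ N b₁ x - D.cavg ρ j b₁ x‖ₑ * g x ∂ρ ≤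
        oscConst A Λ ^ 2 * B₁ * B₂ * P' := by
      calc _ ≤ c * a₂ * _ := mul_le_mul_right (hsum hwm₁ hw₁ hb₁) _
        _ = c * B₂ * oscConst A Λ * B₁ * (D.avg ρ k w₂ x₀ *
          ∫⁻ x in D.cell k x₀, w₁ x * D.maxFn ρ g x ∂ρ) := by rw [ha₂]; ring
        _ ≤ c * B₂ * oscConst A Λ * B₁ * _ := mul_le_mul_right (htwo hwm₂ hw₂) _
        _ = _ := by rw [oscConst]; ring
    set Z := ∑' j, ∫⁻ x in Ω j, ‖D.cavg ρ N b₁ x - D.cavg ρ j b₁ x‖ₑ *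
          ‖D.cavg ρ N b₂ x - D.cavg ρ j b₂ x‖ₑ * g x ∂ρ
    refine (add_le_add t1 (add_le_add (add_le_add le_rfl t2) t3)).trans ?_
    -- The non-recursive terms cost two copies of `P` and one of `P'`. The factor 2 in `oscConstTwo`
    -- covers them with one `P'` to spare.
    have : oscConstTwo A Λ * B₁ * B₂ * (P + P') + Z =
        oscConst A Λ ^ 2 * B₁ * B₂ * P + (Z + oscConst A Λ ^ 2 * B₁ * B₂ * P +
          oscConst A Λ ^ 2 * B₁ * B₂ * P') + oscConst A Λ ^ 2 * B₁ * B₂ * P' := by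
      rw [oscConstTwo]; ring
    rw [this]
    exact le_self_add
  · intro x hx
    have e₁ := ((enorm_cavg_sub_le hD (hb₁.integrableOn N x) _).trans
      (hΩ.avg_le_compl₁ x hx)).trans (hle4 _)
    have e₂ := ((enorm_cavg_sub_le hD (hb₂.integrableOn N x) _).trans
      (hΩ.avg_le_compl₂ x hx)).trans (hle4 _)
    rw [hc b₁ x hx.1, hc b₂ x hx.1]
    exact mul_le_mul_left (mul_le_mul' e₁ e₂) _
  · intro j x hx
    rw [hc b₁ x (hΩ.subset j hx), hc b₂ x (hΩ.subset j hx)]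
    exact mul_mul_le_of_le_add
      (enorm_cavg_sub_le_add hD (hb₁.integrableOn j x) ((hΩ.avg_le₁ j x hx).trans (hleA _)))
      (enorm_cavg_sub_le_add hD (hb₂.integrableOn j x) ((hΩ.avg_le₂ j x hx).trans (hleA _)))

/-- Multiplication is not continuous at `(0, ∞)`, so the product need not converge when `a = 0` and
`g = ∞`; the lower bound is trivial there. -/
theorem mul_le_liminf_mul_const {F : ℤ → ℝ≥0∞} {a : ℝ≥0∞} (h : Tendsto F atTop (𝓝 a))
    (g : ℝ≥0∞) : a * g ≤ liminf (fun N => F N * g) atTop := by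
  rcases eq_or_ne a 0 with rfl | ha
  · simp
  · exact (ENNReal.Tendsto.mul_const h (.inl ha)).liminf_eq.ge

/-- The bound for averages of generation `N` does not depend on `N`, so almost everywhere
convergence and Fatou's lemma transfer it to `b`. -/
theorem HasOsc.setLIntegral_mul_le (hD : D.Regular ρ A) {Λ B : ℝ≥0∞} {w : X → ℝ≥0∞}
    (hwm : Measurable w) (hw : AInfty D ρ Λ w) {b : X → ℂ} (hb : HasOsc D ρ B w b)
    (hlim : ∀ᵐ x ∂ρ, Tendsto (fun N => D.cavg ρ N b x) atTop (𝓝 (b x)))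
    {g : X → ℝ≥0∞} (hg : Measurable g) (k : ℤ) (x₀ : X) :
    ∫⁻ x in D.cell k x₀, ‖b x - D.cavg ρ k b x₀‖ₑ * g x ∂ρ ≤
      oscConst A Λ * B * ∫⁻ x in D.cell k x₀, w x * D.maxFn ρ g x ∂ρ := by
  calc _ ≤ ∫⁻ x in D.cell k x₀,
        liminf (fun N => ‖D.cavg ρ N b x - D.cavg ρ k b x‖ₑ * g x) atTop ∂ρ := by
        refine lintegral_mono_ae ?_
        filter_upwards [ae_restrict_of_ae hlim, ae_restrict_mem (D.measurableSet_cell k x₀)]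
          with x hx hxm
        rw [cavg_congr_idx b (x := x₀) (y := x) (Eq.symm hxm)]
        exact mul_le_liminf_mul_const ((hx.sub_const _).enorm) _
    _ ≤ liminf (fun N => ∫⁻ x in D.cell k x₀,
          ‖D.cavg ρ N b x - D.cavg ρ k b x‖ₑ * g x ∂ρ) atTop :=
        lintegral_liminf_le fun N =>
          (((measurable_cavg N b).sub (measurable_cavg k b)).enorm).mul hg
    _ ≤ _ := by
        refine liminf_le_of_frequently_le' (Eventually.frequently ?_)
        filter_upwards [eventually_ge_atTop k] with N hN
        rw [← lintegral_const_mul]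
        · exact setLIntegral_enorm_cavg_sub_mul_le hD hwm hw hb hg N k hN _
            (D.saturated_cell le_rfl x₀)
        · exact hwm.mul (D.measurable_maxFn _ _)

theorem HasOsc.setLIntegral_mul_mul_le (hD : D.Regular ρ A) {Λ B₁ B₂ : ℝ≥0∞}
    {w₁ w₂ : X → ℝ≥0∞} (hwm₁ : Measurable w₁) (hw₁ : AInfty D ρ Λ w₁) (hwm₂ : Measurable w₂)
    (hw₂ : AInfty D ρ Λ w₂) {b₁ b₂ : X → ℂ} (hb₁ : HasOsc D ρ B₁ w₁ b₁)
    (hb₂ : HasOsc D ρ B₂ w₂ b₂)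
    (hlim₁ : ∀ᵐ x ∂ρ, Tendsto (fun N => D.cavg ρ N b₁ x) atTop (𝓝 (b₁ x)))
    (hlim₂ : ∀ᵐ x ∂ρ, Tendsto (fun N => D.cavg ρ N b₂ x) atTop (𝓝 (b₂ x)))
    {g : X → ℝ≥0∞} (hg : Measurable g) (k : ℤ) (x₀ : X) :
    ∫⁻ x in D.cell k x₀, ‖b₁ x - D.cavg ρ k b₁ x₀‖ₑ * ‖b₂ x - D.cavg ρ k b₂ x₀‖ₑ * g x ∂ρ ≤
      oscConstTwo A Λ * B₁ * B₂ * ∫⁻ x in D.cell k x₀,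
        (w₁ x * D.maxFn ρ (fun y => w₂ y * D.maxFn ρ g y) x +
          w₂ x * D.maxFn ρ (fun y => w₁ y * D.maxFn ρ g y) x) ∂ρ := by
  calc _ ≤ ∫⁻ x in D.cell k x₀, liminf (fun N => ‖D.cavg ρ N b₁ x - D.cavg ρ k b₁ x‖ₑ *
          ‖D.cavg ρ N b₂ x - D.cavg ρ k b₂ x‖ₑ * g x) atTop ∂ρ := by
        refine lintegral_mono_ae ?_
        filter_upwards [ae_restrict_of_ae hlim₁, ae_restrict_of_ae hlim₂,
          ae_restrict_mem (D.measurableSet_cell k x₀)] with x hx₁ hx₂ hxm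
        rw [cavg_congr_idx b₁ (x := x₀) (y := x) (Eq.symm hxm),
          cavg_congr_idx b₂ (x := x₀) (y := x) (Eq.symm hxm)]
        refine mul_le_liminf_mul_const ?_ _
        exact ENNReal.Tendsto.mul (hx₁.sub_const _).enorm (.inr enorm_ne_top)
          (hx₂.sub_const _).enorm (.inr enorm_ne_top)
    _ ≤ liminf (fun N => ∫⁻ x in D.cell k x₀, ‖D.cavg ρ N b₁ x - D.cavg ρ k b₁ x‖ₑ *
          ‖D.cavg ρ N b₂ x - D.cavg ρ k b₂ x‖ₑ * g x ∂ρ) atTop :=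
        lintegral_liminf_le fun N =>
          ((((measurable_cavg N b₁).sub (measurable_cavg k b₁)).enorm).mul
            (((measurable_cavg N b₂).sub (measurable_cavg k b₂)).enorm)).mul hg
    _ ≤ _ := by
        refine liminf_le_of_frequently_le' (Eventually.frequently ?_)
        filter_upwards [eventually_ge_atTop k] with N hN
        rw [← lintegral_const_mul]
        · exact setLIntegral_enorm_cavg_sub_mul_mul_le hD hwm₁ hw₁ hwm₂ hw₂ hb₁ hb₂ hg N k hN _
            (D.saturated_cell le_rfl x₀)
        · exact (hwm₁.mul (D.measurable_maxFn _ _)).add (hwm₂.mul (D.measurable_maxFn _ _))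

end CellSystem

/-! ### Two variables: iterated maximal operators and oscillation on rectangles. -/

namespace CellSystem

variable {X Y ι κ : Type*} [MeasurableSpace X] [MeasurableSpace Y]

/-- The maximal function in the first variable. -/
noncomputable def maxFst (D : CellSystem X ι) (ρ : Measure X) (h : X × Y → ℝ≥0∞) (z : X × Y) :
    ℝ≥0∞ := D.maxFn ρ (fun x => h (x, z.2)) z.1

/-- The maximal function in the second variable. -/
noncomputable def maxSnd (E : CellSystem Y κ) (τ : Measure Y) (h : X × Y → ℝ≥0∞) (z : X × Y) :
    ℝ≥0∞ := E.maxFn τ (fun y => h (z.1, y)) z.2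

/-- An iterated maximal operator that dominates the strong maximal operator. -/
noncomputable def strongMax (D : CellSystem X ι) (E : CellSystem Y κ) (ρ : Measure X)
    (τ : Measure Y) (h : X × Y → ℝ≥0∞) (z : X × Y) : ℝ≥0∞ :=
  maxFst D ρ h z + maxSnd E τ (maxFst D ρ h) z

variable {D : CellSystem X ι} {E : CellSystem Y κ} {ρ : Measure X} {τ : Measure Y}

theorem maxFst_mono {g h : X × Y → ℝ≥0∞} (hgh : ∀ z, g z ≤ h z) (z : X × Y) :
    maxFst D ρ g z ≤ maxFst D ρ h z := D.maxFn_mono ρ (fun _ => hgh _) _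

theorem maxSnd_mono {g h : X × Y → ℝ≥0∞} (hgh : ∀ z, g z ≤ h z) (z : X × Y) :
    maxSnd E τ g z ≤ maxSnd E τ h z := E.maxFn_mono τ (fun _ => hgh _) _

theorem strongMax_mono {g h : X × Y → ℝ≥0∞} (hgh : ∀ z, g z ≤ h z) (z : X × Y) :
    strongMax D E ρ τ g z ≤ strongMax D E ρ τ h z :=
  add_le_add (maxFst_mono hgh z) (maxSnd_mono (maxFst_mono hgh) z)

theorem maxFst_le_strongMax (h : X × Y → ℝ≥0∞) (z : X × Y) :
    maxFst D ρ h z ≤ strongMax D E ρ τ h z := le_self_add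

theorem maxSnd_maxFst_le_strongMax (h : X × Y → ℝ≥0∞) (z : X × Y) :
    maxSnd E τ (maxFst D ρ h) z ≤ strongMax D E ρ τ h z := le_add_self

theorem measurable_slice_fst {β : Type*} [MeasurableSpace β] {f : X × Y → β} (hf : Measurable f)
    (y : Y) : Measurable fun x => f (x, y) := hf.comp measurable_prodMk_right

theorem measurable_slice_snd {β : Type*} [MeasurableSpace β] {f : X × Y → β} (hf : Measurable f)
    (x : X) : Measurable fun y => f (x, y) := hf.comp measurable_prodMk_left

/-- Preimages are countable unions of products of a cell with a measurable set of `y`, the latter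
read off at a chosen representative of each nonempty cell. -/
theorem measurable_of_idx_fst [Countable ι] {β : Type*} [MeasurableSpace β] {k : ℤ}
    {f : X × Y → β} (h : ∀ x x' y, D.idx k x = D.idx k x' → f (x, y) = f (x', y))
    (hm : ∀ x, Measurable fun y => f (x, y)) : Measurable f := by
  intro s hs
  have : f ⁻¹' s = ⋃ i : range (D.idx k),
      (D.idx k ⁻¹' {i.1}) ×ˢ ((fun y => f (i.2.choose, y)) ⁻¹' s) := by
    ext ⟨x, y⟩
    simp only [mem_preimage, mem_iUnion, mem_prod, mem_singleton_iff]
    constructor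
    · intro hx
      refine ⟨⟨D.idx k x, mem_range_self x⟩, rfl, ?_⟩
      rwa [h _ x y (mem_range_self (f := D.idx k) x).choose_spec]
    · rintro ⟨i, hi, hy⟩
      rwa [← h _ x y (i.2.choose_spec.trans hi.symm)]
  rw [this]
  exact MeasurableSet.iUnion fun i => (D.measurableSet_fiber k i.1).prod (hm _ hs)

theorem measurable_maxFst [Countable ι] [SFinite ρ] {h : X × Y → ℝ≥0∞} (hh : Measurable h) :
    Measurable (maxFst D ρ h) := by
  refine Measurable.iSup fun k => ?_
  refine measurable_of_idx_fst (D := D) (k := k) (fun x x' y hx => ?_) fun x => ?_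
  · exact D.avg_congr_idx ρ le_rfl _ hx
  · exact Measurable.const_mul (hh.lintegral_prod_left' (μ := ρ.restrict (D.cell k x)))
      (ρ (D.cell k x))⁻¹

theorem measurable_maxSnd [Countable κ] [SFinite τ] {h : X × Y → ℝ≥0∞} (hh : Measurable h) :
    Measurable (maxSnd E τ h) := by
  have : maxSnd E τ h = maxFst E τ (h ∘ Prod.swap) ∘ Prod.swap := rfl
  rw [this]
  exact (measurable_maxFst (hh.comp measurable_swap)).comp measurable_swap

theorem measurable_strongMax [Countable ι] [Countable κ] [SFinite ρ] [SFinite τ]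
    {h : X × Y → ℝ≥0∞} (hh : Measurable h) : Measurable (strongMax D E ρ τ h) :=
  (measurable_maxFst hh).add (measurable_maxSnd (measurable_maxFst hh))

section Bounded

variable [SFinite ρ] [SFinite τ]

/-- The `A_p` condition on the cells of a cell system. -/
def ApCells (D : CellSystem X ι) (ρ : Measure X) (p s : ℝ) (K : ℝ≥0∞) (w : X → ℝ≥0∞) : Prop :=
  ∀ k x, (∫⁻ y in D.cell k x, w y ∂ρ) * (∫⁻ y in D.cell k x, w y ^ s ∂ρ) ^ (p - 1) ≤
    K * ρ (D.cell k x) ^ p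

variable {A A' : ℝ≥0∞} {p s : ℝ} {K : ℝ≥0∞} {w : X × Y → ℝ≥0∞}

/-- Tonelli reduces this to Muckenhoupt's theorem on slices, and the `A_p` condition on almost every
slice is enough. -/
theorem lintegral_maxFst_rpow_mul_le [Countable ι] (hD : D.Regular ρ A)
    (hp : 1 < p) (hs : s * (p - 1) = -1) (hK : K ≠ ∞) (hw : Measurable w)
    (hw0 : ∀ z, w z ≠ 0) (hwt : ∀ z, w z ≠ ∞)
    (hA : ∀ᵐ y ∂τ, ApCells D ρ p s K fun x => w (x, y)) {f : X × Y → ℝ≥0∞} (hf : Measurable f) :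
    ∫⁻ z, maxFst D ρ f z ^ p * w z ∂(ρ.prod τ) ≤
      maxConst p K * ∫⁻ z, f z ^ p * w z ∂(ρ.prod τ) := by
  have h₁ : Measurable fun z => maxFst D ρ f z ^ p * w z :=
    ((measurable_maxFst hf).pow_const p).mul hw
  have h₂ : Measurable fun z => f z ^ p * w z := (hf.pow_const p).mul hw
  rw [lintegral_prod_symm' _ h₁, lintegral_prod_symm' _ h₂, ← lintegral_const_mul]
  · refine lintegral_mono_ae ?_
    filter_upwards [hA] with y hy
    exact lintegral_maxFn_rpow_mul_le hD hp hs hK (measurable_slice_fst hw _)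
      (fun x => hw0 _) (fun x => hwt _) hy (measurable_slice_fst hf _)
  · exact h₂.lintegral_prod_left'

theorem lintegral_maxSnd_rpow_mul_le [Countable κ] (hE : E.Regular τ A)
    (hp : 1 < p) (hs : s * (p - 1) = -1) (hK : K ≠ ∞) (hw : Measurable w)
    (hw0 : ∀ z, w z ≠ 0) (hwt : ∀ z, w z ≠ ∞)
    (hA : ∀ᵐ x ∂ρ, ApCells E τ p s K fun y => w (x, y)) {f : X × Y → ℝ≥0∞} (hf : Measurable f) :
    ∫⁻ z, maxSnd E τ f z ^ p * w z ∂(ρ.prod τ) ≤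
      maxConst p K * ∫⁻ z, f z ^ p * w z ∂(ρ.prod τ) := by
  have h₁ : Measurable fun z => maxSnd E τ f z ^ p * w z :=
    ((measurable_maxSnd hf).pow_const p).mul hw
  have h₂ : Measurable fun z => f z ^ p * w z := (hf.pow_const p).mul hw
  rw [lintegral_prod _ h₁.aemeasurable, lintegral_prod _ h₂.aemeasurable,
    ← lintegral_const_mul]
  · refine lintegral_mono_ae ?_
    filter_upwards [hA] with x hx
    exact lintegral_maxFn_rpow_mul_le hE hp hs hK (measurable_slice_snd hw _)
      (fun x => hw0 _) (fun x => hwt _) hx (measurable_slice_snd hf _)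
  · exact h₂.lintegral_prod_right'

/-- The constant of the weighted inequality for `strongMax`. -/
noncomputable def strongConst (p : ℝ) (K : ℝ≥0∞) : ℝ≥0∞ :=
  2 ^ (p - 1) * (maxConst p K + maxConst p K * maxConst p K)

theorem strongConst_ne_top (hp : 1 < p) (hK : K ≠ ∞) : strongConst p K ≠ ∞ :=
  ENNReal.mul_ne_top (ENNReal.rpow_ne_top_of_nonneg (by linarith) (by simp))
    (ENNReal.add_ne_top.2 ⟨maxConst_ne_top hp hK,
      ENNReal.mul_ne_top (maxConst_ne_top hp hK) (maxConst_ne_top hp hK)⟩)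

theorem lintegral_strongMax_rpow_mul_le [Countable ι] [Countable κ] (hD : D.Regular ρ A)
    (hE : E.Regular τ A') (hp : 1 < p) (hs : s * (p - 1) = -1) (hK : K ≠ ∞) (hw : Measurable w)
    (hw0 : ∀ z, w z ≠ 0) (hwt : ∀ z, w z ≠ ∞)
    (hA₁ : ∀ᵐ y ∂τ, ApCells D ρ p s K fun x => w (x, y))
    (hA₂ : ∀ᵐ x ∂ρ, ApCells E τ p s K fun y => w (x, y)) {f : X × Y → ℝ≥0∞} (hf : Measurable f) :
    ∫⁻ z, strongMax D E ρ τ f z ^ p * w z ∂(ρ.prod τ) ≤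
      strongConst p K * ∫⁻ z, f z ^ p * w z ∂(ρ.prod τ) := by
  have hM₁ := measurable_maxFst (D := D) (ρ := ρ) hf
  have hM₂ := measurable_maxSnd (E := E) (τ := τ) hM₁
  have h₁ := lintegral_maxFst_rpow_mul_le (τ := τ) hD hp hs hK hw hw0 hwt hA₁ hf
  have h₂ := lintegral_maxSnd_rpow_mul_le (ρ := ρ) hE hp hs hK hw hw0 hwt hA₂ hM₁
  calc _ ≤ ∫⁻ z, 2 ^ (p - 1) * (maxFst D ρ f z ^ p * w z +
          maxSnd E τ (maxFst D ρ f) z ^ p * w z) ∂(ρ.prod τ) := by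
        refine lintegral_mono fun z => ?_
        rw [← add_mul, ← mul_assoc]
        exact mul_le_mul_left (ENNReal.rpow_add_le_mul_rpow_add_rpow _ _ hp.le) _
    _ = 2 ^ (p - 1) * (∫⁻ z, maxFst D ρ f z ^ p * w z ∂(ρ.prod τ) +
          ∫⁻ z, maxSnd E τ (maxFst D ρ f) z ^ p * w z ∂(ρ.prod τ)) := by
        rw [lintegral_const_mul, lintegral_add_right]
        · exact (hM₂.pow_const p).mul hw
        · exact ((hM₁.pow_const p).mul hw).add ((hM₂.pow_const p).mul hw)
    _ ≤ 2 ^ (p - 1) * (maxConst p K * ∫⁻ z, f z ^ p * w z ∂(ρ.prod τ) +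
          maxConst p K * (maxConst p K * ∫⁻ z, f z ^ p * w z ∂(ρ.prod τ))) :=
        mul_le_mul_right (add_le_add h₁ (h₂.trans (mul_le_mul_right h₁ _))) _
    _ = _ := by rw [strongConst]; ring

end Bounded

section Domination

variable [Countable ι] [Countable κ] [SFinite ρ] [SFinite τ] {A A' : ℝ≥0∞}

theorem setLIntegral_prod_cells {h : X × Y → ℝ≥0∞} (hh : Measurable h)
    (k l : ℤ) (x₀ : X) (y₀ : Y) :
    ∫⁻ z in D.cell k x₀ ×ˢ E.cell l y₀, h z ∂(ρ.prod τ) =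
      ∫⁻ y in E.cell l y₀, ∫⁻ x in D.cell k x₀, h (x, y) ∂ρ ∂τ := by
  rw [← Measure.prod_restrict, lintegral_prod_symm' _ hh]

theorem setLIntegral_prod_cells_eq_avg (hD : D.Regular ρ A) {h : X × Y → ℝ≥0∞}
    (hh : Measurable h) (k l : ℤ) (x₀ : X) (y₀ : Y) :
    ∫⁻ z in D.cell k x₀ ×ˢ E.cell l y₀, h z ∂(ρ.prod τ) =
      ρ (D.cell k x₀) * ∫⁻ y in E.cell l y₀, D.avg ρ k (fun x => h (x, y)) x₀ ∂τ := by
  rw [setLIntegral_prod_cells hh, ← lintegral_const_mul]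
  · simp_rw [setLIntegral_cell_eq hD]
  · exact hh.lintegral_prod_left'.const_mul _

theorem measurable_avg_slice {h : X × Y → ℝ≥0∞} (hh : Measurable h) (k : ℤ) (x₀ : X) :
    Measurable fun y => D.avg ρ k (fun x => h (x, y)) x₀ :=
  Measurable.const_mul (hh.lintegral_prod_left' (μ := ρ.restrict (D.cell k x₀))) _

/-- An average over a rectangle is an average in `y` of averages in `x`, hence at most `M₂M₁`. -/
theorem inv_mul_setLIntegral_prod_cells_le (hD : D.Regular ρ A) {h : X × Y → ℝ≥0∞}
    (hh : Measurable h) (k l : ℤ) (z : X × Y) :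
    (ρ.prod τ (D.cell k z.1 ×ˢ E.cell l z.2))⁻¹ *
      ∫⁻ z in D.cell k z.1 ×ˢ E.cell l z.2, h z ∂(ρ.prod τ) ≤ strongMax D E ρ τ h z := by
  rw [setLIntegral_prod_cells_eq_avg hD hh, Measure.prod_prod,
    ENNReal.mul_inv (.inl (hD.ne_zero _ _)) (.inl (hD.ne_top _ _)), mul_mul_mul_comm,
    ENNReal.inv_mul_cancel (hD.ne_zero _ _) (hD.ne_top _ _), one_mul]
  refine le_trans ?_ (maxSnd_maxFst_le_strongMax h z)
  refine le_trans ?_ (E.avg_le_maxFn τ l _ z.2)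
  unfold avg
  gcongr with y
  exact D.avg_le_maxFn ρ k (fun x => h (x, y)) z.1

/-- An average in the first variable of a weighted maximal function in the second variable. -/
theorem avg_mul_maxFn_le {w h : X × Y → ℝ≥0∞} (hw : Measurable w) {G : Y → ℝ≥0∞} (k : ℤ)
    (x₀ : X) (hG : ∀ y, G y ≤ D.avg ρ k (fun x => h (x, y)) x₀) (y : Y) :
    D.avg ρ k (fun x => w (x, y)) x₀ * E.maxFn τ G y ≤
      D.avg ρ k (fun x => w (x, y) * maxSnd E τ (maxFst D ρ h) (x, y)) x₀ := by
  rw [avg, mul_assoc, ← lintegral_mul_const _ (measurable_slice_fst hw _), avg]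
  gcongr 1
  refine setLIntegral_mono' (D.measurableSet_cell k x₀) fun x hx => ?_
  gcongr
  -- The average over the cell is at most `M₁ h (x, y')` for each `x` in it, whatever `y'`. So the
  -- maximal function in `y` can be taken inside the `x`-integral.
  refine E.maxFn_mono τ (fun y' => (hG y').trans ?_) y
  rw [D.avg_congr_idx ρ le_rfl _ (x := x₀) (y := x) (Eq.symm hx)]
  exact D.avg_le_maxFn ρ k (fun x => h (x, y')) x

/-- Weighted little `BMO` on rectangles, in terms of slices. -/
structure BiOsc (D : CellSystem X ι) (E : CellSystem Y κ) (ρ : Measure X) (τ : Measure Y)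
    (Λ B : ℝ≥0∞) (w : X × Y → ℝ≥0∞) (b : X × Y → ℂ) : Prop where
  measurable_weight : Measurable w
  measurable : Measurable b
  aInfty_fst : ∀ᵐ y ∂τ, AInfty D ρ Λ fun x => w (x, y)
  osc_fst : ∀ᵐ y ∂τ, HasOsc D ρ B (fun x => w (x, y)) fun x => b (x, y)
  lim_fst : ∀ᵐ y ∂τ, ∀ᵐ x ∂ρ,
    Tendsto (fun N => D.cavg ρ N (fun x => b (x, y)) x) atTop (𝓝 (b (x, y)))
  aInfty_snd : ∀ k x, AInfty E τ Λ fun y => D.avg ρ k (fun x => w (x, y)) x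
  osc_snd : ∀ k x, HasOsc E τ B (fun y => D.avg ρ k (fun x => w (x, y)) x)
    fun y => D.cavg ρ k (fun x => b (x, y)) x
  lim_snd : ∀ k x, ∀ᵐ y ∂τ,
    Tendsto (fun N => E.cavg τ N (fun y => D.cavg ρ k (fun x => b (x, y)) x) y) atTop
      (𝓝 (D.cavg ρ k (fun x => b (x, y)) x))
  average_eq : ∀ k l x y, ⨍ z in D.cell k x ×ˢ E.cell l y, b z ∂(ρ.prod τ) =
    E.cavg τ l (fun y => D.cavg ρ k (fun x => b (x, y)) x) y

theorem measurable_cavg_slice {b : X × Y → ℂ} (hb : Measurable b) (k : ℤ) (x₀ : X) :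
    Measurable fun y => D.cavg ρ k (fun x => b (x, y)) x₀ := by
  unfold cavg
  simp_rw [setAverage_eq]
  exact ((hb.comp measurable_swap).stronglyMeasurable.integral_prod_right'
    (ν := ρ.restrict (D.cell k x₀))).measurable.const_smul _

variable {Λ B : ℝ≥0∞} {w : X × Y → ℝ≥0∞} {b : X × Y → ℂ}

/-- The contribution of the oscillation in the first variable. -/
theorem BiOsc.lintegral_fst_le (hD : D.Regular ρ A) (h : BiOsc D E ρ τ Λ B w b)
    {g : X × Y → ℝ≥0∞} (hg : Measurable g) (k : ℤ) (x₀ : X) :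
    ∀ᵐ y ∂τ, ∫⁻ x in D.cell k x₀, ‖b (x, y) - D.cavg ρ k (fun x => b (x, y)) x₀‖ₑ * g (x, y) ∂ρ ≤
      oscConst A Λ * B * ∫⁻ x in D.cell k x₀, w (x, y) * maxFst D ρ g (x, y) ∂ρ := by
  filter_upwards [h.aInfty_fst, h.osc_fst, h.lim_fst] with y h₁ h₂ h₃
  exact h₂.setLIntegral_mul_le hD (measurable_slice_fst h.measurable_weight _) h₁ h₃
    (measurable_slice_fst hg _) k x₀

/-- The contribution of the oscillation in the second variable. -/
theorem BiOsc.lintegral_snd_le (hD : D.Regular ρ A) (hE : E.Regular τ A)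
    (h : BiOsc D E ρ τ Λ B w b) {g : X × Y → ℝ≥0∞} (hg : Measurable g) (k l : ℤ) (x₀ : X)
    (y₀ : Y) :
    ∫⁻ y in E.cell l y₀, ‖D.cavg ρ k (fun x => b (x, y)) x₀ -
        ⨍ z in D.cell k x₀ ×ˢ E.cell l y₀, b z ∂(ρ.prod τ)‖ₑ *
        ∫⁻ x in D.cell k x₀, g (x, y) ∂ρ ∂τ ≤
      oscConst A Λ * B * ∫⁻ z in D.cell k x₀ ×ˢ E.cell l y₀,
        w z * maxSnd E τ (maxFst D ρ g) z ∂(ρ.prod τ) := by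
  have hG := measurable_avg_slice (ρ := ρ) (D := D) hg k x₀
  have hc := measurable_cavg_slice (ρ := ρ) (D := D) h.measurable k x₀
  have h1 := (h.osc_snd k x₀).setLIntegral_mul_le hE
    (measurable_avg_slice h.measurable_weight k x₀) (h.aInfty_snd k x₀) (h.lim_snd k x₀) hG l y₀
  have hm : Measurable fun z => w z * maxSnd E τ (maxFst D ρ g) z :=
    h.measurable_weight.mul (measurable_maxSnd (measurable_maxFst hg))
  rw [h.average_eq, setLIntegral_prod_cells_eq_avg hD hm]
  simp_rw [setLIntegral_cell_eq hD k _ x₀]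
  calc _ = ρ (D.cell k x₀) * _ := by
        rw [← lintegral_const_mul]
        · exact lintegral_congr fun y => mul_left_comm _ _ _
        · exact ((hc.sub measurable_const).enorm).mul hG
    _ ≤ ρ (D.cell k x₀) * _ := mul_le_mul_right h1 _
    _ ≤ ρ (D.cell k x₀) * (oscConst A Λ * B * ∫⁻ y in E.cell l y₀,
          D.avg ρ k (fun x => w (x, y) * maxSnd E τ (maxFst D ρ g) (x, y)) x₀ ∂τ) := by
        gcongr with y
        exact avg_mul_maxFn_le h.measurable_weight k x₀ (fun y => le_rfl) y
    _ = _ := by ring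

/-- Domination of the oscillation on a rectangle. -/
theorem BiOsc.setLIntegral_le (hD : D.Regular ρ A) (hE : E.Regular τ A)
    (h : BiOsc D E ρ τ Λ B w b) {g : X × Y → ℝ≥0∞} (hg : Measurable g) (k l : ℤ) (x₀ : X)
    (y₀ : Y) :
    ∫⁻ z in D.cell k x₀ ×ˢ E.cell l y₀, ‖b z -
        ⨍ z in D.cell k x₀ ×ˢ E.cell l y₀, b z ∂(ρ.prod τ)‖ₑ * g z ∂(ρ.prod τ) ≤
      oscConst A Λ * B * 2 * ∫⁻ z in D.cell k x₀ ×ˢ E.cell l y₀,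
        w z * strongMax D E ρ τ g z ∂(ρ.prod τ) := by
  set m := ⨍ z in D.cell k x₀ ×ˢ E.cell l y₀, b z ∂(ρ.prod τ) with hmdef
  set c : Y → ℂ := fun y => D.cavg ρ k (fun x => b (x, y)) x₀
  have hc : Measurable c := measurable_cavg_slice h.measurable k x₀
  have hα : Measurable fun z : X × Y => ‖b z - c z.2‖ₑ * g z :=
    ((h.measurable.sub (hc.comp measurable_snd)).enorm).mul hg
  have hβ : Measurable fun z : X × Y => ‖c z.2 - m‖ₑ * g z :=
    (((hc.comp measurable_snd).sub measurable_const).enorm).mul hg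
  have hM : Measurable fun z => w z * maxFst D ρ g z :=
    h.measurable_weight.mul (measurable_maxFst hg)
  have t1 : ∫⁻ z in D.cell k x₀ ×ˢ E.cell l y₀, ‖b z - c z.2‖ₑ * g z ∂(ρ.prod τ) ≤
      oscConst A Λ * B * ∫⁻ z in D.cell k x₀ ×ˢ E.cell l y₀,
        w z * maxFst D ρ g z ∂(ρ.prod τ) := by
    rw [setLIntegral_prod_cells hα, setLIntegral_prod_cells hM, ← lintegral_const_mul]
    · exact lintegral_mono_ae (ae_restrict_of_ae (h.lintegral_fst_le hD hg k x₀))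
    · exact hM.lintegral_prod_left'
  have t2 : ∫⁻ z in D.cell k x₀ ×ˢ E.cell l y₀, ‖c z.2 - m‖ₑ * g z ∂(ρ.prod τ) ≤
      oscConst A Λ * B * ∫⁻ z in D.cell k x₀ ×ˢ E.cell l y₀,
        w z * maxSnd E τ (maxFst D ρ g) z ∂(ρ.prod τ) := by
    refine le_trans (le_of_eq ?_) (h.lintegral_snd_le hD hE hg k l x₀ y₀)
    rw [setLIntegral_prod_cells hβ]
    refine lintegral_congr fun y => ?_
    rw [← lintegral_const_mul _ (measurable_slice_fst hg _)]
  calc _ ≤ ∫⁻ z in D.cell k x₀ ×ˢ E.cell l y₀, (‖b z - c z.2‖ₑ * g z + ‖c z.2 - m‖ₑ * g z)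
          ∂(ρ.prod τ) := by
        refine lintegral_mono fun z => ?_
        rw [← add_mul]
        gcongr
        exact (le_of_eq (by congr 1; ring)).trans (enorm_add_le (b z - c z.2) (c z.2 - m))
    _ = _ := lintegral_add_right _ hβ
    _ ≤ _ := add_le_add t1 t2
    _ ≤ oscConst A Λ * B * (∫⁻ z in D.cell k x₀ ×ˢ E.cell l y₀,
          w z * strongMax D E ρ τ g z ∂(ρ.prod τ)) + oscConst A Λ * B *
          (∫⁻ z in D.cell k x₀ ×ˢ E.cell l y₀, w z * strongMax D E ρ τ g z ∂(ρ.prod τ)) := by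
        gcongr
        · exact maxFst_le_strongMax g _
        · exact maxSnd_maxFst_le_strongMax g _
    _ = _ := by ring

variable {B' : ℝ≥0∞} {w' : X × Y → ℝ≥0∞} {b' : X × Y → ℂ}

theorem BiOsc.lintegral_fst_fst_le (hD : D.Regular ρ A) (h : BiOsc D E ρ τ Λ B w b)
    (h' : BiOsc D E ρ τ Λ B' w' b')
    {g : X × Y → ℝ≥0∞} (hg : Measurable g) (k : ℤ) (x₀ : X) :
    ∀ᵐ y ∂τ, ∫⁻ x in D.cell k x₀, ‖b (x, y) - D.cavg ρ k (fun x => b (x, y)) x₀‖ₑ *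
      ‖b' (x, y) - D.cavg ρ k (fun x => b' (x, y)) x₀‖ₑ * g (x, y) ∂ρ ≤
      oscConstTwo A Λ * B * B' * ∫⁻ x in D.cell k x₀,
        (w (x, y) * maxFst D ρ (fun z => w' z * maxFst D ρ g z) (x, y) +
          w' (x, y) * maxFst D ρ (fun z => w z * maxFst D ρ g z) (x, y)) ∂ρ := by
  filter_upwards [h.aInfty_fst, h.osc_fst, h.lim_fst, h'.aInfty_fst, h'.osc_fst, h'.lim_fst]
    with y h₁ h₂ h₃ h₁' h₂' h₃'
  exact h₂.setLIntegral_mul_mul_le hD (measurable_slice_fst h.measurable_weight _) h₁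
    (measurable_slice_fst h'.measurable_weight _) h₁' h₂' h₃ h₃'
    (measurable_slice_fst hg _) k x₀

/-- For a fixed cell in `x` this is the two-symbol estimate in `y`, for the averaged symbols,
weights and function. Applying `avg_mul_maxFn_le` at both levels of the nested maximal function
undoes the averaging. -/
theorem BiOsc.lintegral_snd_snd_le (hD : D.Regular ρ A) (hE : E.Regular τ A)
    (h : BiOsc D E ρ τ Λ B w b) (h' : BiOsc D E ρ τ Λ B' w' b')
    {g : X × Y → ℝ≥0∞} (hg : Measurable g) (k l : ℤ) (x₀ : X) (y₀ : Y) :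
    ∫⁻ y in E.cell l y₀, ‖D.cavg ρ k (fun x => b (x, y)) x₀ -
        ⨍ z in D.cell k x₀ ×ˢ E.cell l y₀, b z ∂(ρ.prod τ)‖ₑ *
        ‖D.cavg ρ k (fun x => b' (x, y)) x₀ -
        ⨍ z in D.cell k x₀ ×ˢ E.cell l y₀, b' z ∂(ρ.prod τ)‖ₑ *
        ∫⁻ x in D.cell k x₀, g (x, y) ∂ρ ∂τ ≤
      oscConstTwo A Λ * B * B' * ∫⁻ z in D.cell k x₀ ×ˢ E.cell l y₀,
        (w z * maxSnd E τ (maxFst D ρ fun z => w' z * maxSnd E τ (maxFst D ρ g) z) z +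
          w' z * maxSnd E τ (maxFst D ρ fun z => w z * maxSnd E τ (maxFst D ρ g) z) z)
          ∂(ρ.prod τ) := by
  have hG := measurable_avg_slice (ρ := ρ) (D := D) hg k x₀
  have hc := measurable_cavg_slice (ρ := ρ) (D := D) h.measurable k x₀
  have hc' := measurable_cavg_slice (ρ := ρ) (D := D) h'.measurable k x₀
  have h1 := (h.osc_snd k x₀).setLIntegral_mul_mul_le hE
    (measurable_avg_slice h.measurable_weight k x₀) (h.aInfty_snd k x₀)
    (measurable_avg_slice h'.measurable_weight k x₀) (h'.aInfty_snd k x₀)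
    (h'.osc_snd k x₀) (h.lim_snd k x₀) (h'.lim_snd k x₀) hG l y₀
  have hN : Measurable (maxSnd E τ (maxFst D ρ g)) := measurable_maxSnd (measurable_maxFst hg)
  have hm : ∀ {u v : X × Y → ℝ≥0∞}, Measurable u → Measurable v → Measurable fun z =>
      u z * maxSnd E τ (maxFst D ρ fun z => v z * maxSnd E τ (maxFst D ρ g) z) z :=
    fun hu hv => hu.mul (measurable_maxSnd (measurable_maxFst (hv.mul hN)))
  have hm₁ := hm h.measurable_weight h'.measurable_weight
  have hm₂ := hm h'.measurable_weight h.measurable_weight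
  have key : ∀ {u v : X × Y → ℝ≥0∞}, Measurable u → Measurable v → ∀ y,
      D.avg ρ k (fun x => u (x, y)) x₀ * E.maxFn τ (fun y => D.avg ρ k (fun x => v (x, y)) x₀ *
        E.maxFn τ (fun y => D.avg ρ k (fun x => g (x, y)) x₀) y) y ≤
      D.avg ρ k (fun x => u (x, y) * maxSnd E τ
        (maxFst D ρ fun z => v z * maxSnd E τ (maxFst D ρ g) z) (x, y)) x₀ := fun hu hv y =>
    avg_mul_maxFn_le hu k x₀ (avg_mul_maxFn_le hv k x₀ fun y => le_rfl) y
  rw [h.average_eq, h'.average_eq, lintegral_add_right _ hm₂,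
    setLIntegral_prod_cells_eq_avg hD hm₁, setLIntegral_prod_cells_eq_avg hD hm₂, ← mul_add,
    ← lintegral_add_right _ (measurable_avg_slice hm₂ k x₀)]
  simp_rw [setLIntegral_cell_eq hD k _ x₀]
  calc _ = ρ (D.cell k x₀) * _ := by
        rw [← lintegral_const_mul]
        · exact lintegral_congr fun y => mul_left_comm _ _ _
        · exact (((hc.sub measurable_const).enorm).mul ((hc'.sub measurable_const).enorm)).mul hG
    _ ≤ ρ (D.cell k x₀) * _ := mul_le_mul_right h1 _
    _ ≤ ρ (D.cell k x₀) * (oscConstTwo A Λ * B * B' * ∫⁻ y in E.cell l y₀,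
        (D.avg ρ k (fun x => w (x, y) * maxSnd E τ (maxFst D ρ fun z => w' z *
          maxSnd E τ (maxFst D ρ g) z) (x, y)) x₀ +
        D.avg ρ k (fun x => w' (x, y) * maxSnd E τ (maxFst D ρ fun z => w z *
          maxSnd E τ (maxFst D ρ g) z) (x, y)) x₀) ∂τ) := by
        gcongr with y
        · exact key h.measurable_weight h'.measurable_weight y
        · exact key h'.measurable_weight h.measurable_weight y
    _ = _ := by ring

/-- The mixed contribution: oscillation of `b'` in the first variable and of `b` in the second. -/
theorem BiOsc.lintegral_fst_snd_le (hD : D.Regular ρ A) (hE : E.Regular τ A)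
    (h : BiOsc D E ρ τ Λ B w b) (h' : BiOsc D E ρ τ Λ B' w' b')
    {g : X × Y → ℝ≥0∞} (hg : Measurable g) (k l : ℤ) (x₀ : X) (y₀ : Y) :
    ∫⁻ z in D.cell k x₀ ×ˢ E.cell l y₀, ‖D.cavg ρ k (fun x => b (x, z.2)) x₀ -
        ⨍ z in D.cell k x₀ ×ˢ E.cell l y₀, b z ∂(ρ.prod τ)‖ₑ *
        (‖b' z - D.cavg ρ k (fun x => b' (x, z.2)) x₀‖ₑ * g z) ∂(ρ.prod τ) ≤
      oscConst A Λ ^ 2 * B * B' * ∫⁻ z in D.cell k x₀ ×ˢ E.cell l y₀,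
        w z * maxSnd E τ (maxFst D ρ fun z => w' z * maxFst D ρ g z) z ∂(ρ.prod τ) := by
  have hc := measurable_cavg_slice (ρ := ρ) (D := D) h.measurable k x₀
  have hc' := measurable_cavg_slice (ρ := ρ) (D := D) h'.measurable k x₀
  set m := ⨍ z in D.cell k x₀ ×ˢ E.cell l y₀, b z ∂(ρ.prod τ) with hm
  have hg' : Measurable fun z => w' z * maxFst D ρ g z :=
    h'.measurable_weight.mul (measurable_maxFst hg)
  have hα : Measurable fun z : X × Y => ‖b' z - D.cavg ρ k (fun x => b' (x, z.2)) x₀‖ₑ * g z :=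
    ((h'.measurable.sub (hc'.comp measurable_snd)).enorm).mul hg
  have hβ : Measurable fun y => ‖D.cavg ρ k (fun x => b (x, y)) x₀ - m‖ₑ :=
    (hc.sub measurable_const).enorm
  have hαβ : Measurable fun z : X × Y => ‖D.cavg ρ k (fun x => b (x, z.2)) x₀ - m‖ₑ *
        (‖b' z - D.cavg ρ k (fun x => b' (x, z.2)) x₀‖ₑ * g z) :=
    (hβ.comp measurable_snd).mul hα
  rw [setLIntegral_prod_cells hαβ]
  -- The factor coming from `b` depends on `y` only, so it stays outside while the `x`-oscillation
  -- of `b'` is traded for `w' M₁g`. That product then plays the role of `g` in the bound for the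
  -- second variable.
  calc _ = ∫⁻ y in E.cell l y₀, ‖D.cavg ρ k (fun x => b (x, y)) x₀ - m‖ₑ * ∫⁻ x in D.cell k x₀,
          ‖b' (x, y) - D.cavg ρ k (fun x => b' (x, y)) x₀‖ₑ * g (x, y) ∂ρ ∂τ :=
        lintegral_congr fun y => lintegral_const_mul _ (measurable_slice_fst hα y)
    _ ≤ ∫⁻ y in E.cell l y₀, ‖D.cavg ρ k (fun x => b (x, y)) x₀ - m‖ₑ * (oscConst A Λ * B' *
          ∫⁻ x in D.cell k x₀, w' (x, y) * maxFst D ρ g (x, y) ∂ρ) ∂τ := by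
        refine lintegral_mono_ae (ae_restrict_of_ae ?_)
        filter_upwards [h'.lintegral_fst_le hD hg k x₀] with y hy
        exact mul_le_mul_right hy _
    _ = oscConst A Λ * B' * ∫⁻ y in E.cell l y₀, ‖D.cavg ρ k (fun x => b (x, y)) x₀ - m‖ₑ *
          ∫⁻ x in D.cell k x₀, w' (x, y) * maxFst D ρ g (x, y) ∂ρ ∂τ := by
        rw [← lintegral_const_mul]
        · exact lintegral_congr fun y => mul_left_comm _ _ _
        · exact hβ.mul hg'.lintegral_prod_left'
    _ ≤ oscConst A Λ * B' * _ := mul_le_mul_right (h.lintegral_snd_le hD hE hg' k l x₀ y₀) _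
    _ = _ := by ring

/-- Domination of the product of two oscillations on a rectangle. -/
theorem BiOsc.setLIntegral_mul_le (hD : D.Regular ρ A) (hE : E.Regular τ A)
    (h : BiOsc D E ρ τ Λ B w b) (h' : BiOsc D E ρ τ Λ B' w' b')
    {g : X × Y → ℝ≥0∞} (hg : Measurable g) (k l : ℤ) (x₀ : X) (y₀ : Y) :
    ∫⁻ z in D.cell k x₀ ×ˢ E.cell l y₀, ‖b z -
        ⨍ z in D.cell k x₀ ×ˢ E.cell l y₀, b z ∂(ρ.prod τ)‖ₑ * ‖b' z -
        ⨍ z in D.cell k x₀ ×ˢ E.cell l y₀, b' z ∂(ρ.prod τ)‖ₑ * g z ∂(ρ.prod τ) ≤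
      (2 * oscConstTwo A Λ + oscConst A Λ ^ 2) * B * B' *
        ∫⁻ z in D.cell k x₀ ×ˢ E.cell l y₀,
          (w z * strongMax D E ρ τ (fun z => w' z * strongMax D E ρ τ g z) z +
            w' z * strongMax D E ρ τ (fun z => w z * strongMax D E ρ τ g z) z) ∂(ρ.prod τ) := by
  set R := D.cell k x₀ ×ˢ E.cell l y₀ with hR
  set m := ⨍ z in R, b z ∂(ρ.prod τ) with hm
  set m' := ⨍ z in R, b' z ∂(ρ.prod τ) with hm'
  set c : Y → ℂ := fun y => D.cavg ρ k (fun x => b (x, y)) x₀ with hcdef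
  set c' : Y → ℂ := fun y => D.cavg ρ k (fun x => b' (x, y)) x₀ with hcdef'
  have hc : Measurable c := measurable_cavg_slice h.measurable k x₀
  have hc' : Measurable c' := measurable_cavg_slice h'.measurable k x₀
  have hα : Measurable fun z : X × Y => ‖b z - c z.2‖ₑ :=
    (h.measurable.sub (hc.comp measurable_snd)).enorm
  have hα' : Measurable fun z : X × Y => ‖b' z - c' z.2‖ₑ :=
    (h'.measurable.sub (hc'.comp measurable_snd)).enorm
  have hβ : Measurable fun z : X × Y => ‖c z.2 - m‖ₑ :=
    ((hc.comp measurable_snd).sub measurable_const).enorm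
  have hβ' : Measurable fun z : X × Y => ‖c' z.2 - m'‖ₑ :=
    ((hc'.comp measurable_snd).sub measurable_const).enorm
  have hw := h.measurable_weight
  have hw' := h'.measurable_weight
  have hS := measurable_strongMax (D := D) (E := E) (ρ := ρ) (τ := τ) hg
  have hT : Measurable fun z => w' z * strongMax D E ρ τ (fun z => w z * strongMax D E ρ τ g z) z :=
    hw'.mul (measurable_strongMax (hw.mul hS))
  rw [lintegral_add_right _ hT]
  set P := ∫⁻ z in R, w z * strongMax D E ρ τ (fun z => w' z * strongMax D E ρ τ g z) z
    ∂(ρ.prod τ) with hP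
  set P' := ∫⁻ z in R, w' z * strongMax D E ρ τ (fun z => w z * strongMax D E ρ τ g z) z
    ∂(ρ.prod τ) with hP'
  -- The four pieces involve different compositions of `M₁` and `M₂M₁`. All are below `strongMax` at
  -- each level, so two integrals `P` and `P'` control everything.
  have mono : ∀ (T T' : (X × Y → ℝ≥0∞) → X × Y → ℝ≥0∞), (∀ f z, T f z ≤ strongMax D E ρ τ f z) →
      (∀ f z, T' f z ≤ strongMax D E ρ τ f z) → ∀ u v : X × Y → ℝ≥0∞,
      ∫⁻ z in R, u z * T (fun z => v z * T' g z) z ∂(ρ.prod τ) ≤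
      ∫⁻ z in R, u z * strongMax D E ρ τ (fun z => v z * strongMax D E ρ τ g z) z ∂(ρ.prod τ) :=
    fun T T' hT hT' u v => lintegral_mono fun z => mul_le_mul_right ((hT _ z).trans
      (strongMax_mono (fun z => mul_le_mul_right (hT' g z) _) z)) _
  have i₁ : ∀ f z, maxFst D ρ f z ≤ strongMax D E ρ τ f z := maxFst_le_strongMax
  have i₂ : ∀ f z, maxSnd E τ (maxFst D ρ f) z ≤ strongMax D E ρ τ f z :=
    maxSnd_maxFst_le_strongMax
  have t1 : ∫⁻ z in R, ‖b z - c z.2‖ₑ * ‖b' z - c' z.2‖ₑ * g z ∂(ρ.prod τ) ≤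
      oscConstTwo A Λ * B * B' * (P + P') := by
    have hq : ∀ {u v : X × Y → ℝ≥0∞}, Measurable u → Measurable v →
        Measurable fun z => u z * maxFst D ρ (fun z => v z * maxFst D ρ g z) z :=
      fun hu hv => hu.mul (measurable_maxFst (hv.mul (measurable_maxFst hg)))
    have hq₁ := hq hw hw'
    have hq₂ := hq hw' hw
    have hq₃ : Measurable fun z => w z * maxFst D ρ (fun z => w' z * maxFst D ρ g z) z +
      w' z * maxFst D ρ (fun z => w z * maxFst D ρ g z) z := hq₁.add hq₂
    calc _ = ∫⁻ y in E.cell l y₀, ∫⁻ x in D.cell k x₀, ‖b (x, y) - c y‖ₑ *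
          ‖b' (x, y) - c' y‖ₑ * g (x, y) ∂ρ ∂τ :=
          setLIntegral_prod_cells ((hα.mul hα').mul hg) k l x₀ y₀
      _ ≤ ∫⁻ y in E.cell l y₀, oscConstTwo A Λ * B * B' * ∫⁻ x in D.cell k x₀,
        (w (x, y) * maxFst D ρ (fun z => w' z * maxFst D ρ g z) (x, y) +
          w' (x, y) * maxFst D ρ (fun z => w z * maxFst D ρ g z) (x, y)) ∂ρ ∂τ :=
          lintegral_mono_ae (ae_restrict_of_ae (h.lintegral_fst_fst_le hD h' hg k x₀))
      _ = oscConstTwo A Λ * B * B' * (∫⁻ z in R,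
          w z * maxFst D ρ (fun z => w' z * maxFst D ρ g z) z ∂(ρ.prod τ) + ∫⁻ z in R,
          w' z * maxFst D ρ (fun z => w z * maxFst D ρ g z) z ∂(ρ.prod τ)) := by
          rw [← lintegral_add_right _ hq₂, setLIntegral_prod_cells hq₃, lintegral_const_mul]
          exact hq₃.lintegral_prod_left'
      _ ≤ _ := mul_le_mul_right (add_le_add (mono _ _ i₁ i₁ w w') (mono _ _ i₁ i₁ w' w)) _
  have t2 : ∫⁻ z in R, ‖c z.2 - m‖ₑ * ‖c' z.2 - m'‖ₑ * g z ∂(ρ.prod τ) ≤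
      oscConstTwo A Λ * B * B' * (P + P') := by
    have hq : Measurable fun z => w' z *
        maxSnd E τ (maxFst D ρ fun z => w z * maxSnd E τ (maxFst D ρ g) z) z :=
      hw'.mul (measurable_maxSnd (measurable_maxFst (hw.mul
        (measurable_maxSnd (measurable_maxFst hg)))))
    calc _ = ∫⁻ y in E.cell l y₀, ∫⁻ x in D.cell k x₀, ‖c y - m‖ₑ *
          ‖c' y - m'‖ₑ * g (x, y) ∂ρ ∂τ :=
          setLIntegral_prod_cells ((hβ.mul hβ').mul hg) k l x₀ y₀
      _ = ∫⁻ y in E.cell l y₀, ‖c y - m‖ₑ * ‖c' y - m'‖ₑ *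
          ∫⁻ x in D.cell k x₀, g (x, y) ∂ρ ∂τ :=
          lintegral_congr fun y => lintegral_const_mul _ (measurable_slice_fst hg y)
      _ ≤ _ := h.lintegral_snd_snd_le hD hE h' hg k l x₀ y₀
      _ ≤ _ := by
          rw [lintegral_add_right _ hq]
          exact mul_le_mul_right (add_le_add (mono _ _ i₂ i₂ w w') (mono _ _ i₂ i₂ w' w)) _
  have t3 : ∫⁻ z in R, ‖c z.2 - m‖ₑ * (‖b' z - c' z.2‖ₑ * g z) ∂(ρ.prod τ) ≤
      oscConst A Λ ^ 2 * B * B' * P :=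
    (h.lintegral_fst_snd_le hD hE h' hg k l x₀ y₀).trans
      (mul_le_mul_right (mono _ _ i₂ i₁ w w') _)
  have t4 : ∫⁻ z in R, ‖c' z.2 - m'‖ₑ * (‖b z - c z.2‖ₑ * g z) ∂(ρ.prod τ) ≤
      oscConst A Λ ^ 2 * B' * B * P' :=
    (h'.lintegral_fst_snd_le hD hE h hg k l x₀ y₀).trans
      (mul_le_mul_right (mono _ _ i₂ i₁ w' w) _)
  have hsplit : ∀ (f : X × Y → ℂ) (d : Y → ℂ) (e : ℂ) (z : X × Y),
      ‖f z - e‖ₑ ≤ ‖f z - d z.2‖ₑ + ‖d z.2 - e‖ₑ := fun f d e z =>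
    (le_of_eq (by congr 1; ring)).trans (enorm_add_le (f z - d z.2) (d z.2 - e))
  have m2 : Measurable fun z : X × Y => ‖c z.2 - m‖ₑ * ‖c' z.2 - m'‖ₑ * g z :=
    (hβ.mul hβ').mul hg
  have m3 : Measurable fun z : X × Y => ‖c z.2 - m‖ₑ * (‖b' z - c' z.2‖ₑ * g z) :=
    hβ.mul (hα'.mul hg)
  have m4 : Measurable fun z : X × Y => ‖c' z.2 - m'‖ₑ * (‖b z - c z.2‖ₑ * g z) :=
    hβ'.mul (hα.mul hg)
  calc _ ≤ ∫⁻ z in R, (‖b z - c z.2‖ₑ * ‖b' z - c' z.2‖ₑ * g z +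
          ‖c z.2 - m‖ₑ * (‖b' z - c' z.2‖ₑ * g z) + ‖c' z.2 - m'‖ₑ * (‖b z - c z.2‖ₑ * g z) +
          ‖c z.2 - m‖ₑ * ‖c' z.2 - m'‖ₑ * g z) ∂(ρ.prod τ) :=
        lintegral_mono fun z => mul_mul_le_of_le_add (hsplit b c m z) (hsplit b' c' m' z)
    _ = _ := by
        rw [lintegral_add_right _ m2, lintegral_add_right _ m4, lintegral_add_right _ m3]
    _ ≤ _ := add_le_add (add_le_add (add_le_add t1 t3) t4) t2
    _ = _ := by ring

end Domination

end CellSystem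

/-! ### Dyadic grids as cell systems and Lebesgue differentiation. -/

namespace BiParam

variable {n m : ℕ}

theorem measurableSet_cube (a : Fin n → ℝ) (h : ℝ) : MeasurableSet (cube a h) :=
  MeasurableSet.univ_pi fun _ => measurableSet_Ico

theorem mem_cube {a x : Fin n → ℝ} {h : ℝ} : x ∈ cube a h ↔ ∀ i, a i ≤ x i ∧ x i < a i + h := by
  simp [cube]

theorem volume_cube (a : Fin n → ℝ) (h : ℝ) : volume (cube a h) = ENNReal.ofReal h ^ n := by
  have : cube a h = univ.pi fun i => Ico (a i) ((fun i => a i + h) i) := rfl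
  rw [this, Real.volume_pi_Ico]
  simp

theorem volume_cube_ne_zero (a : Fin n → ℝ) {h : ℝ} (hh : 0 < h) : volume (cube a h) ≠ 0 := by
  rw [volume_cube]
  exact pow_ne_zero _ (ENNReal.ofReal_pos.2 hh).ne'

theorem volume_cube_ne_top (a : Fin n → ℝ) (h : ℝ) : volume (cube a h) ≠ ∞ := by
  rw [volume_cube]
  exact ENNReal.pow_ne_top ENNReal.ofReal_ne_top

theorem Icc_eq_closedBall_of_side (a : Fin n → ℝ) {h : ℝ} (hh : 0 ≤ h) :
    Icc a (fun i => a i + h) = Metric.closedBall (fun i => a i + h / 2) (h / 2) := by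
  rw [closedBall_pi _ (by linarith), ← pi_univ_Icc]
  congr 1
  ext i x
  rw [Real.closedBall_eq_Icc]
  simp only [mem_Icc]
  constructor <;> rintro ⟨h1, h2⟩ <;> constructor <;> linarith

theorem cube_subset_closedBall (a : Fin n → ℝ) {h : ℝ} (hh : 0 ≤ h) :
    cube a h ⊆ Metric.closedBall (fun i => a i + h / 2) (h / 2) := by
  rw [← Icc_eq_closedBall_of_side a hh]
  exact fun x hx => ⟨fun i => (mem_cube.1 hx i).1, fun i => (mem_cube.1 hx i).2.le⟩

theorem cube_ae_eq_closedBall (a : Fin n → ℝ) {h : ℝ} (hh : 0 ≤ h) :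
    cube a h =ᵐ[volume] Metric.closedBall (fun i => a i + h / 2) (h / 2) := by
  rw [← Icc_eq_closedBall_of_side a hh]
  exact Measure.univ_pi_Ico_ae_eq_Icc (f := a) (g := fun i => a i + h)

theorem cube_sub_ae_eq_closedBall (x : Fin n → ℝ) {r : ℝ} (hr : 0 ≤ r) :
    cube (fun i => x i - r) (2 * r) =ᵐ[volume] Metric.closedBall x r := by
  have := cube_ae_eq_closedBall (fun i => x i - r) (h := 2 * r) (by linarith)
  simpa using this

/-- The cell system of a dyadic grid. -/
noncomputable def DyadicGrid.cells (D : DyadicGrid n) :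
    CellSystem (Fin n → ℝ) (Fin n → ℤ) where
  idx k x i := ⌊(x i - D.shift k i) * 2 ^ k⌋
  measurableSet_fiber k j := by
    have : Measurable fun (x : Fin n → ℝ) (i : Fin n) => ⌊(x i - D.shift k i) * 2 ^ k⌋ :=
      measurable_pi_lambda _ fun i => Int.measurable_floor.comp
        (((measurable_pi_apply i).sub measurable_const).mul measurable_const)
    exact this (measurableSet_singleton j)
  idx_of_succ k x y h := by
    funext i
    obtain ⟨z, hz⟩ := D.nested k i
    -- The coarse index is the fine index, translated by the integer `z` of the nesting condition
    -- and halved with integer division, so it is a function of the fine index.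
    have key : ∀ x : Fin n → ℝ, ⌊(x i - D.shift k i) * 2 ^ k⌋ =
        (⌊(x i - D.shift (k + 1) i) * 2 ^ (k + 1)⌋ - z) / (2 : ℕ) := by
      intro x
      rw [← Int.floor_sub_intCast, ← Int.floor_div_natCast]
      congr 1
      have h2 : (2 : ℝ) ^ (k + 1) = 2 * 2 ^ k := by rw [zpow_add_one₀ (by norm_num), mul_comm]
      have h3 : (2 : ℝ) ^ k ≠ 0 := (zpow_pos (by norm_num) k).ne'
      rw [zpow_neg, h2] at hz
      rw [h2, show D.shift k i = D.shift (k + 1) i + z * (2 * 2 ^ k)⁻¹ by linarith]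
      push_cast
      field_simp
      ring
    rw [key, key, congrFun h i]

theorem two_zpow_pos (k : ℤ) : (0 : ℝ) < 2 ^ k := zpow_pos (by norm_num) k

theorem DyadicGrid.fiber_eq (D : DyadicGrid n) (k : ℤ) (j : Fin n → ℤ) :
    D.cells.idx k ⁻¹' {j} =
      cube (fun i => D.shift k i + (j i : ℝ) * (2 : ℝ) ^ (-k)) ((2 : ℝ) ^ (-k)) := by
  ext x
  have h3 : (0 : ℝ) < 2 ^ k := zpow_pos (by norm_num) k
  have key : D.cells.idx k x = j ↔ ∀ i, ⌊(x i - D.shift k i) * 2 ^ k⌋ = j i := funext_iff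
  rw [mem_preimage, mem_singleton_iff, key, mem_cube]
  refine forall_congr' fun i => ?_
  rw [Int.floor_eq_iff, zpow_neg, ← div_eq_mul_inv, ← le_sub_iff_add_le', div_le_iff₀ h3, add_assoc,
    ← one_div, ← add_div, ← sub_lt_iff_lt_add' (b := D.shift k i), lt_div_iff₀ h3,
    ← sub_lt_iff_lt_add']

theorem DyadicGrid.mem_cubes_iff (D : DyadicGrid n) {I : Set (Fin n → ℝ)} :
    I ∈ D.cubes ↔ ∃ k j, I = D.cells.idx k ⁻¹' {j} := by
  simp only [DyadicGrid.cubes, D.fiber_eq, mem_ofPred_eq]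

theorem DyadicGrid.eq_cell (D : DyadicGrid n) {I : Set (Fin n → ℝ)} (hI : I ∈ D.cubes)
    {x : Fin n → ℝ} (hx : x ∈ I) : ∃ k, I = D.cells.cell k x := by
  obtain ⟨k, j, rfl⟩ := D.mem_cubes_iff.1 hI
  refine ⟨k, ?_⟩
  rw [mem_preimage, mem_singleton_iff] at hx
  rw [← hx]; rfl

theorem DyadicGrid.cell_eq_cube (D : DyadicGrid n) (k : ℤ) (x : Fin n → ℝ) :
    ∃ a, D.cells.cell k x = cube a ((2 : ℝ) ^ (-k)) :=
  ⟨_, D.fiber_eq k (D.cells.idx k x)⟩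

theorem DyadicGrid.countable_cubes (D : DyadicGrid n) : D.cubes.Countable := by
  have : D.cubes = range fun q : ℤ × (Fin n → ℤ) => D.cells.idx q.1 ⁻¹' {q.2} := by
    ext I
    rw [D.mem_cubes_iff]
    simp [eq_comm]
  rw [this]
  exact countable_range _

theorem DyadicGrid.measurableSet_of_mem_cubes (D : DyadicGrid n) {I : Set (Fin n → ℝ)}
    (hI : I ∈ D.cubes) : MeasurableSet I := by
  obtain ⟨k, j, rfl⟩ := hI
  exact measurableSet_cube _ _

/-- The sharp constant is `2^n`; a larger one is admitted so that grids of dimensions `n` and `m`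
can share the same `A`. -/
theorem DyadicGrid.regular (D : DyadicGrid n) {A : ℝ≥0∞} (hA : 2 ^ n ≤ A) :
    D.cells.Regular volume A where
  ne_zero k x := by
    obtain ⟨a, ha⟩ := D.cell_eq_cube k x
    rw [ha]; exact volume_cube_ne_zero a (two_zpow_pos _)
  ne_top k x := by
    obtain ⟨a, ha⟩ := D.cell_eq_cube k x
    rw [ha]; exact volume_cube_ne_top a _
  doubling k x := by
    obtain ⟨a, ha⟩ := D.cell_eq_cube k x
    obtain ⟨c, hc⟩ := D.cell_eq_cube (k + 1) x
    rw [ha, hc, volume_cube, volume_cube]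
    have : (2 : ℝ) ^ (-k) = 2 * 2 ^ (-(k + 1)) := by
      rw [← zpow_one_add₀ (by norm_num)]; congr 1; ring
    rw [this, ENNReal.ofReal_mul (by norm_num), mul_pow]
    gcongr
    simpa using hA

/-- Every cube of dyadic side length belongs to a dyadic grid. -/
theorem exists_grid_cube_mem (a : Fin n → ℝ) (k : ℤ) :
    ∃ D : DyadicGrid n, cube a ((2 : ℝ) ^ (-k)) ∈ D.cubes :=
  ⟨⟨fun _ => a, fun _ _ => ⟨0, by simp⟩⟩, k, 0, by simp⟩

theorem tendsto_two_zpow_neg_div_two :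
    Tendsto (fun k : ℤ => (2 : ℝ) ^ (-k) / 2) atTop (𝓝[>] 0) := by
  refine tendsto_nhdsWithin_iff.2 ⟨?_, Eventually.of_forall fun k => half_pos (two_zpow_pos (-k))⟩
  have h1 : Tendsto (fun k : ℤ => (2 : ℝ) ^ k) atTop atTop := by
    refine tendsto_atTop_atTop.2 fun b => ?_
    obtain ⟨N, hN⟩ := pow_unbounded_of_one_lt b (one_lt_two (α := ℝ))
    refine ⟨N, fun a ha => hN.le.trans ?_⟩
    rw [← zpow_natCast]
    exact zpow_le_zpow_right₀ one_le_two ha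
  simpa [Function.comp_def, zpow_neg] using (tendsto_inv_atTop_zero.comp h1).div_const 2

/-- Lebesgue's differentiation theorem along the cells of a dyadic grid. -/
theorem DyadicGrid.ae_tendsto_cavg (D : DyadicGrid n) {b : (Fin n → ℝ) → ℂ}
    (hb : LocallyIntegrable b) :
    ∀ᵐ x, Tendsto (fun N => D.cells.cavg volume N b x) atTop (𝓝 (b x)) := by
  filter_upwards [IsUnifLocDoublingMeasure.ae_tendsto_average (μ := volume) hb 1] with x hx
  choose a ha using fun k => D.cell_eq_cube k x
  -- In the sup norm the closed cell is a closed ball of radius half its side. It contains `x`, so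
  -- the dilation factor 1 suffices.
  have h := hx (fun k i => a k i + (2 : ℝ) ^ (-k) / 2) _ tendsto_two_zpow_neg_div_two (Eventually.of_forall fun k => by
    rw [one_mul]
    refine cube_subset_closedBall (a k) (two_zpow_pos _).le ?_
    rw [← ha]
    exact D.cells.self_mem_cell k x)
  refine h.congr fun k => ?_
  rw [CellSystem.cavg, ha]
  exact setAverage_congr (cube_ae_eq_closedBall (a k) (two_zpow_pos _).le).symm

/-- The cube `[-2 ^ N, 2 ^ N)ⁿ`. -/
def bigCube (n N : ℕ) : Set (Fin n → ℝ) := cube (fun _ => -2 ^ N) (2 ^ (N + 1))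

theorem ball_subset_bigCube (N : ℕ) : Metric.ball 0 (2 ^ N) ⊆ bigCube n N := by
  intro x hx
  rw [mem_ball_zero_iff] at hx
  refine mem_cube.2 fun i => ?_
  have := abs_lt.1 (lt_of_le_of_lt (norm_le_pi_norm x i) hx)
  refine ⟨this.1.le, ?_⟩
  rw [pow_succ]; linarith [this.2]

theorem exists_mem_ball_two_pow (x : Fin n → ℝ) : ∃ N : ℕ, x ∈ Metric.ball 0 ((2 : ℝ) ^ N) := by
  obtain ⟨N, hN⟩ := pow_unbounded_of_one_lt ‖x‖ (one_lt_two (α := ℝ))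
  exact ⟨N, mem_ball_zero_iff.2 hN⟩

/-- The side is a power of 2, so oscillation bounds known only for dyadic side lengths apply on this
exhaustion. -/
theorem bigCube_eq (N : ℕ) :
    bigCube n N = cube (fun _ => -2 ^ N) ((2 : ℝ) ^ (-(-((N : ℤ) + 1)))) := by
  rw [bigCube, neg_neg]
  congr 1

theorem locallyIntegrable_of_bigCube {E : Type*} [NormedAddCommGroup E] {b : (Fin n → ℝ) → E}
    (hb : ∀ N, IntegrableOn b (bigCube n N)) : LocallyIntegrable b := by
  intro x
  obtain ⟨N, hN⟩ := exists_mem_ball_two_pow x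
  exact ⟨_, Metric.isOpen_ball.mem_nhds hN, (hb N).mono_set (ball_subset_bigCube N)⟩

/-- Lebesgue's differentiation theorem along centered balls. -/
theorem ae_tendsto_lintegral_closedBall_div {F : (Fin n → ℝ) → ℝ≥0∞} (hF : Measurable F)
    (hfin : ∀ N, ∫⁻ y in bigCube n N, F y ≠ ∞) :
    ∀ᵐ x, Tendsto (fun r => (∫⁻ y in Metric.closedBall x r, F y) /
      volume (Metric.closedBall x r)) (𝓝[>] 0) (𝓝 (F x)) := by
  -- Differentiation requires a finite integral, so `F` is cut off to each large cube. Small balls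
  -- about a point of an open ball inside the cube do not see the cutoff.
  have h : ∀ N : ℕ, ∀ᵐ x, Tendsto (fun a => (∫⁻ y in a, (bigCube n N).indicator F y) / volume a)
      ((IsUnifLocDoublingMeasure.vitaliFamily (volume : Measure (Fin n → ℝ)) 1).filterAt x)
      (𝓝 ((bigCube n N).indicator F x)) := fun N => by
    refine VitaliFamily.ae_tendsto_lintegral_div' _ (hF.indicator (measurableSet_cube _ _)) ?_
    rw [lintegral_indicator (s := bigCube n N) (measurableSet_cube _ _)]
    exact hfin N
  filter_upwards [ae_all_iff.2 h] with x hx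
  obtain ⟨N, hN⟩ := exists_mem_ball_two_pow x
  have h1 := (hx N).comp (IsUnifLocDoublingMeasure.tendsto_closedBall_filterAt volume
    (fun _ : ℝ => x) (fun r => r) (l := 𝓝[>] 0) tendsto_id (by
      filter_upwards [self_mem_nhdsWithin] with r hr
      rw [one_mul]
      exact Metric.mem_closedBall_self (le_of_lt hr)))
  rw [indicator_of_mem (ball_subset_bigCube N hN)] at h1
  refine h1.congr' ?_
  obtain ⟨ε, hε, hsub⟩ := Metric.isOpen_ball.mem_nhds hN |> Metric.nhds_basis_closedBall.mem_iff.1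
  filter_upwards [Ioo_mem_nhdsGT hε] with r hr
  simp only [Function.comp_apply]
  congr 1
  refine setLIntegral_congr_fun measurableSet_closedBall fun y hy => ?_
  exact indicator_of_mem (ball_subset_bigCube N
    (hsub (Metric.closedBall_subset_closedBall hr.2.le hy))) _

end BiParam

/-! ### Hölder estimates for powers of the Bloom weight. -/

section Holder

variable {Z : Type*} [MeasurableSpace Z] {ρ : Measure Z}

theorem MeasureTheory.setLIntegral_ne_zero_of_ne_zero {w : Z → ℝ≥0∞} (hw : Measurable w)
    (hw0 : ∀ z, w z ≠ 0) {Q : Set Z} (hQ : ρ Q ≠ 0) : ∫⁻ z in Q, w z ∂ρ ≠ 0 := by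
  have : Function.support w = univ := by ext; simp [hw0]
  rw [← pos_iff_ne_zero, setLIntegral_pos_iff hw, this, univ_inter]
  exact pos_iff_ne_zero.2 hQ

/-- Cauchy–Schwarz for `1 = w^(1/2) w^(-1/2)`. -/
theorem measure_sq_le_lintegral_mul_lintegral_inv {w : Z → ℝ≥0∞} (hw : Measurable w)
    (hw0 : ∀ z, w z ≠ 0) (hwt : ∀ z, w z ≠ ∞) (E : Set Z) :
    ρ E ^ 2 ≤ (∫⁻ z in E, w z ∂ρ) * ∫⁻ z in E, (w z)⁻¹ ∂ρ := by
  have h : ρ E ≤ (∫⁻ z in E, w z ∂ρ) ^ (1 / 2 : ℝ) * (∫⁻ z in E, (w z)⁻¹ ∂ρ) ^ (1 / 2 : ℝ) := by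
    refine le_trans (le_of_eq ?_) (ENNReal.lintegral_mul_norm_pow_le (μ := ρ.restrict E)
      hw.aemeasurable hw.inv.aemeasurable (by norm_num) (by norm_num) (by norm_num))
    rw [← setLIntegral_one]
    refine lintegral_congr fun z => ?_
    rw [← ENNReal.mul_rpow_of_nonneg _ _ (by norm_num), Pi.inv_apply,
      ENNReal.mul_inv_cancel (hw0 z) (hwt z), ENNReal.one_rpow]
  refine (pow_le_pow_left' h 2).trans_eq ?_
  rw [mul_pow, ← ENNReal.rpow_natCast, ← ENNReal.rpow_natCast, ← ENNReal.rpow_mul,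
    ← ENNReal.rpow_mul]
  norm_num

variable {p s : ℝ} {K : ℝ≥0∞} {u v : Z → ℝ≥0∞} {Q : Set Z} {θ : ℝ}

/-- The Bloom weight `u ^ (1/p) v ^ (-1/p)`, raised to the power `θ`. -/
noncomputable def bloomPow (p θ : ℝ) (u v : Z → ℝ≥0∞) (z : Z) : ℝ≥0∞ :=
  (u z ^ (1 / p) * v z ^ (-(1 / p))) ^ θ

theorem measurable_bloomPow (hu : Measurable u) (hv : Measurable v) :
    Measurable (bloomPow p θ u v) := ((hu.pow_const _).mul (hv.pow_const _)).pow_const _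

theorem bloomPow_ne_zero (hu0 : ∀ z, u z ≠ 0) (hut : ∀ z, u z ≠ ∞) (hv0 : ∀ z, v z ≠ 0)
    (hvt : ∀ z, v z ≠ ∞) (z : Z) : bloomPow p θ u v z ≠ 0 := by
  simp [bloomPow, ENNReal.rpow_eq_zero_iff, ENNReal.mul_eq_top, hu0, hut, hv0, hvt]

theorem bloomPow_ne_top (hu0 : ∀ z, u z ≠ 0) (hut : ∀ z, u z ≠ ∞) (hv0 : ∀ z, v z ≠ 0)
    (hvt : ∀ z, v z ≠ ∞) (z : Z) : bloomPow p θ u v z ≠ ∞ := by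
  simp [bloomPow, ENNReal.rpow_eq_zero_iff, ENNReal.rpow_eq_top_iff, ENNReal.mul_eq_top,
    hu0, hut, hv0, hvt]

/-- Hölder with exponents `p` and `p'`, since `v^(-1/p) = (v^s)^((p-1)/p)`. -/
theorem lintegral_bloom_le (hp : 1 < p) (hs : s * (p - 1) = -1) (hu : Measurable u)
    (hv : Measurable v) :
    ∫⁻ z in Q, u z ^ (1 / p) * v z ^ (-(1 / p)) ∂ρ ≤
      (∫⁻ z in Q, u z ∂ρ) ^ (1 / p) * (∫⁻ z in Q, v z ^ s ∂ρ) ^ ((p - 1) / p) := by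
  have hp0 : 0 < p := by linarith
  refine le_trans (le_of_eq (lintegral_congr fun z => ?_))
    (ENNReal.lintegral_mul_norm_pow_le (μ := ρ.restrict Q)
      hu.aemeasurable (hv.pow_const s).aemeasurable (by positivity)
      (div_nonneg (by linarith) hp0.le) (by field_simp; ring))
  rw [← ENNReal.rpow_mul]
  congr 2
  rw [← mul_div_assoc, hs, neg_div]

theorem lintegral_rpow_le (hu : Measurable u) (hθ₀ : 0 ≤ θ) (hθ₁ : θ ≤ 1) :
    ∫⁻ z in Q, u z ^ θ ∂ρ ≤ (∫⁻ z in Q, u z ∂ρ) ^ θ * ρ Q ^ (1 - θ) := by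
  have := ENNReal.lintegral_mul_norm_pow_le (μ := ρ.restrict Q) hu.aemeasurable
    (measurable_const (a := (1 : ℝ≥0∞))).aemeasurable hθ₀ (sub_nonneg.2 hθ₁) (by ring)
  simpa using this

theorem lintegral_bloomPow_le (hp : 1 < p) (hs : s * (p - 1) = -1) (hu : Measurable u)
    (hv : Measurable v) (hθ₀ : 0 ≤ θ) (hθ₁ : θ ≤ 1) :
    ∫⁻ z in Q, bloomPow p θ u v z ∂ρ ≤
      ((∫⁻ z in Q, u z ∂ρ) ^ (1 / p) * (∫⁻ z in Q, v z ^ s ∂ρ) ^ ((p - 1) / p)) ^ θ *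
        ρ Q ^ (1 - θ) := by
  refine (lintegral_rpow_le ((hu.pow_const _).mul (hv.pow_const _)) hθ₀ hθ₁).trans ?_
  gcongr
  exact lintegral_bloom_le hp hs hu hv

/-- By this symmetry one Hölder estimate bounds the integrals of both `ν^θ` and `ν^(-θ)`. -/
theorem bloomPow_inv (hu0 : ∀ z, u z ≠ 0) (hut : ∀ z, u z ≠ ∞) (z : Z) :
    (bloomPow p θ u v z)⁻¹ = bloomPow p θ v u z := by
  have h0 : u z ^ (1 / p) ≠ 0 := by simp [ENNReal.rpow_eq_zero_iff, hu0, hut]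
  have ht : u z ^ (1 / p) ≠ ∞ := by simp [ENNReal.rpow_eq_top_iff, hu0, hut]
  rw [bloomPow, bloomPow, ← ENNReal.inv_rpow, ENNReal.mul_inv (.inl h0) (.inl ht),
    ← ENNReal.rpow_neg, ← ENNReal.rpow_neg, neg_neg, mul_comm]

/-- This is the `A_2` condition for `ν^θ`. Hölder on each factor produces the integrals of `u`,
`u^s`, `v`, `v^s`, which regroup into the `A_p` products of `u` and of `v`. The normalization `1 ≤
K` turns the fractional powers of `K` into `K`. -/
theorem lintegral_bloomPow_mul_le (hp : 1 < p) (hs : s * (p - 1) = -1) (hK : 1 ≤ K)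
    (hu : Measurable u) (hv : Measurable v)
    (hAu : (∫⁻ z in Q, u z ∂ρ) * (∫⁻ z in Q, u z ^ s ∂ρ) ^ (p - 1) ≤ K * ρ Q ^ p)
    (hAv : (∫⁻ z in Q, v z ∂ρ) * (∫⁻ z in Q, v z ^ s ∂ρ) ^ (p - 1) ≤ K * ρ Q ^ p)
    (hθ₀ : 0 ≤ θ) (hθ₁ : θ ≤ 1) :
    (∫⁻ z in Q, bloomPow p θ u v z ∂ρ) * (∫⁻ z in Q, bloomPow p θ v u z ∂ρ) ≤ K ^ 2 * ρ Q ^ 2 := by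
  have hp0 : 0 < p := by linarith
  have hr : 0 ≤ 1 / p := by positivity
  have hr1 : 1 / p ≤ 1 := by rw [div_le_one hp0]; exact hp.le
  have hKθ : ∀ t : ℝ, t ≤ 1 → K ^ t ≤ K := fun t ht => by
    simpa using ENNReal.rpow_le_rpow_of_exponent_le hK ht
  have root : ∀ {a a' : ℝ≥0∞}, a * a' ^ (p - 1) ≤ K * ρ Q ^ p →
      a ^ (1 / p) * a' ^ ((p - 1) / p) ≤ K * ρ Q := by
    intro a a' h
    have h1 := ENNReal.rpow_le_rpow h hr
    rw [ENNReal.mul_rpow_of_nonneg _ _ hr, ENNReal.mul_rpow_of_nonneg _ _ hr, ← ENNReal.rpow_mul,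
      ← ENNReal.rpow_mul, mul_one_div_cancel hp0.ne', ENNReal.rpow_one, mul_one_div] at h1
    exact h1.trans (mul_le_mul_left (hKθ _ hr1) _)
  refine (mul_le_mul' (lintegral_bloomPow_le hp hs hu hv hθ₀ hθ₁)
    (lintegral_bloomPow_le hp hs hv hu hθ₀ hθ₁)).trans ?_
  set a := ∫⁻ z in Q, u z ∂ρ
  set a' := ∫⁻ z in Q, u z ^ s ∂ρ
  set c := ∫⁻ z in Q, v z ∂ρ
  set c' := ∫⁻ z in Q, v z ^ s ∂ρ
  set V := ρ Q
  calc _ = ((a ^ (1 / p) * a' ^ ((p - 1) / p)) * (c ^ (1 / p) * c' ^ ((p - 1) / p))) ^ θ *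
        (V ^ (1 - θ)) ^ 2 := by
        simp only [ENNReal.mul_rpow_of_nonneg _ _ hθ₀]; ring
    _ ≤ ((K * V) * (K * V)) ^ θ * (V ^ (1 - θ)) ^ 2 := by
        exact mul_le_mul_left (ENNReal.rpow_le_rpow (mul_le_mul' (root hAu) (root hAv)) hθ₀) _
    _ = (K ^ θ * (V ^ θ * V ^ (1 - θ))) ^ 2 := by
        simp only [ENNReal.mul_rpow_of_nonneg _ _ hθ₀]; ring
    _ = (K ^ θ * V) ^ 2 := by
        rw [← ENNReal.rpow_add_of_nonneg _ _ hθ₀ (sub_nonneg.2 hθ₁), add_sub_cancel,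
          ENNReal.rpow_one]
    _ ≤ (K * V) ^ 2 := pow_le_pow_left' (mul_le_mul_left (hKθ θ hθ₁) _) 2
    _ = _ := mul_pow _ _ _

/-- Powers of Bloom weights satisfy a quantitative `A_∞` condition. -/
theorem setLIntegral_bloomPow_le_of_subset (hp : 1 < p) (hs : s * (p - 1) = -1) (hK : 1 ≤ K)
    (hu : Measurable u) (hv : Measurable v)
    (hu0 : ∀ z, u z ≠ 0) (hut : ∀ z, u z ≠ ∞) (hv0 : ∀ z, v z ≠ 0) (hvt : ∀ z, v z ≠ ∞)
    (hAu : (∫⁻ z in Q, u z ∂ρ) * (∫⁻ z in Q, u z ^ s ∂ρ) ^ (p - 1) ≤ K * ρ Q ^ p)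
    (hAv : (∫⁻ z in Q, v z ∂ρ) * (∫⁻ z in Q, v z ^ s ∂ρ) ^ (p - 1) ≤ K * ρ Q ^ p)
    (hθ₀ : 0 ≤ θ) (hθ₁ : θ ≤ 1) (hQ : ρ Q ≠ ∞) {E : Set Z} (hE : E ⊆ Q)
    (hQE : ρ Q ≤ 2 * ρ E) :
    ∫⁻ z in Q, bloomPow p θ u v z ∂ρ ≤ 4 * K ^ 2 * ∫⁻ z in E, bloomPow p θ u v z ∂ρ := by
  rcases eq_or_ne (ρ E) 0 with h0 | h0
  · have : ρ Q = 0 := by simpa [h0] using hQE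
    rw [setLIntegral_measure_zero _ _ this]
    exact zero_le
  have hEt : ρ E ≠ ∞ := ne_top_of_le_ne_top hQ (measure_mono hE)
  -- After multiplication by `|E|²`, Cauchy–Schwarz on `E` introduces `ν^θ(E) ν^(-θ)(E)`. Enlarging
  -- the last factor to `Q` makes the `A_2` bound applicable, and `|Q|² ≤ 4|E|²` explains the 4.
  rw [← ENNReal.mul_le_mul_iff_left (pow_ne_zero 2 h0) (ENNReal.pow_ne_top hEt)]
  have h1 := measure_sq_le_lintegral_mul_lintegral_inv (ρ := ρ)
    (measurable_bloomPow (p := p) (θ := θ) hu hv)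
    (bloomPow_ne_zero hu0 hut hv0 hvt) (bloomPow_ne_top hu0 hut hv0 hvt) E
  simp_rw [bloomPow_inv hu0 hut] at h1
  calc _ ≤ (∫⁻ z in Q, bloomPow p θ u v z ∂ρ) * ((∫⁻ z in E, bloomPow p θ u v z ∂ρ) *
        ∫⁻ z in Q, bloomPow p θ v u z ∂ρ) := by
        refine mul_le_mul_right (h1.trans (mul_le_mul_right (lintegral_mono_set hE) _)) _
    _ = (∫⁻ z in E, bloomPow p θ u v z ∂ρ) * ((∫⁻ z in Q, bloomPow p θ u v z ∂ρ) *
        ∫⁻ z in Q, bloomPow p θ v u z ∂ρ) := by ring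
    _ ≤ (∫⁻ z in E, bloomPow p θ u v z ∂ρ) * (K ^ 2 * (2 * ρ E) ^ 2) := by
        refine mul_le_mul_right ((lintegral_bloomPow_mul_le hp hs hK hu hv hAu hAv hθ₀ hθ₁).trans
          (mul_le_mul_right (pow_le_pow_left' hQE 2) _)) _
    _ = _ := by ring

end Holder

/-! ### Rectangular `A_p` weights: slices and geometric means. -/

namespace BiParam

variable {n m : ℕ}

theorem setLIntegral_prod_eq {I : Set (Fin n → ℝ)} {J : Set (Fin m → ℝ)} {F : Space n m → ℝ≥0∞}
    (hF : Measurable F) : ∫⁻ z in I ×ˢ J, F z = ∫⁻ y in J, ∫⁻ x in I, F (x, y) := by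
  rw [Measure.volume_eq_prod, ← Measure.prod_restrict, lintegral_prod_symm' _ hF]

/-- An everywhere positive and finite weight on the product space with `A_p` constant at most
`K`. -/
structure RectAp (p s : ℝ) (K : ℝ≥0∞) (w : Space n m → ℝ≥0∞) : Prop where
  measurable : Measurable w
  ne_zero : ∀ z, w z ≠ 0
  ne_top : ∀ z, w z ≠ ∞
  lintegral_ne_top : ∀ (a : Fin n → ℝ) (h : ℝ) (c : Fin m → ℝ) (l : ℝ), 0 < h → 0 < l →
    ∫⁻ z in cube a h ×ˢ cube c l, w z ≠ ∞
  ap_le : ∀ (a : Fin n → ℝ) (h : ℝ) (c : Fin m → ℝ) (l : ℝ), 0 < h → 0 < l →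
    (∫⁻ z in cube a h ×ˢ cube c l, w z) * (∫⁻ z in cube a h ×ˢ cube c l, w z ^ s) ^ (p - 1) ≤
      K * volume (cube a h ×ˢ cube c l) ^ p

theorem volume_prod_cube_ne_zero (a : Fin n → ℝ) {h : ℝ} (c : Fin m → ℝ) {l : ℝ} (hh : 0 < h)
    (hl : 0 < l) : volume (cube a h ×ˢ cube c l) ≠ 0 := by
  rw [Measure.volume_eq_prod, Measure.prod_prod]
  exact mul_ne_zero (volume_cube_ne_zero a hh) (volume_cube_ne_zero c hl)

theorem volume_prod_cube_ne_top (a : Fin n → ℝ) (h : ℝ) (c : Fin m → ℝ) (l : ℝ) :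
    volume (cube a h ×ˢ cube c l) ≠ ∞ := by
  rw [Measure.volume_eq_prod, Measure.prod_prod]
  exact ENNReal.mul_ne_top (volume_cube_ne_top a h) (volume_cube_ne_top c l)

variable {p s : ℝ} {K : ℝ≥0∞} {w : Space n m → ℝ≥0∞}

theorem RectAp.rpow_ne_zero (hw : RectAp p s K w) (t : ℝ) (z) : w z ^ t ≠ 0 := by
  simp [ENNReal.rpow_eq_zero_iff, hw.ne_zero, hw.ne_top]

theorem RectAp.lintegral_rpow_ne_top (hw : RectAp p s K w) (hp : 1 < p) (hK : K ≠ ∞)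
    (a : Fin n → ℝ) {h : ℝ} (c : Fin m → ℝ) {l : ℝ} (hh : 0 < h) (hl : 0 < l) :
    ∫⁻ z in cube a h ×ˢ cube c l, w z ^ s ≠ ∞ := by
  intro htop
  have h1 := hw.ap_le a h c l hh hl
  rw [htop, ENNReal.top_rpow_of_pos (by linarith), ENNReal.mul_top] at h1
  · exact ENNReal.mul_ne_top hK (ENNReal.rpow_ne_top_of_nonneg (by linarith)
      (volume_prod_cube_ne_top a h c l)) (top_le_iff.1 h1)
  · exact setLIntegral_ne_zero_of_ne_zero hw.measurable hw.ne_zero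
      (volume_prod_cube_ne_zero a c hh hl)

theorem RectAp.swap (hw : RectAp p s K w) :
    RectAp (n := m) (m := n) p s K (fun z => w z.swap) := by
  have key : ∀ (F : Space n m → ℝ≥0∞), Measurable F → ∀ (J : Set (Fin m → ℝ))
      (I : Set (Fin n → ℝ)), MeasurableSet I → MeasurableSet J →
      ∫⁻ z in J ×ˢ I, F z.swap = ∫⁻ z in I ×ˢ J, F z := by
    intro F hF J I hI hJ
    have := (Measure.measurePreserving_swap (μ := (volume : Measure (Fin m → ℝ)))
      (ν := (volume : Measure (Fin n → ℝ)))).setLIntegral_comp_preimage (hI.prod hJ) hF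
    rw [preimage_swap_prod] at this
    exact this
  refine ⟨hw.measurable.comp measurable_swap, fun z => hw.ne_zero _, fun z => hw.ne_top _,
    fun a h c l hh hl => ?_, fun a h c l hh hl => ?_⟩
  · rw [key w hw.measurable _ _ (measurableSet_cube _ _) (measurableSet_cube _ _)]
    exact hw.lintegral_ne_top c l a h hl hh
  · rw [key w hw.measurable _ _ (measurableSet_cube _ _) (measurableSet_cube _ _),
      key (fun z => w z ^ s) (hw.measurable.pow_const s) _ _ (measurableSet_cube _ _)
        (measurableSet_cube _ _)]
    refine (hw.ap_le c l a h hl hh).trans_eq ?_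
    simp only [Measure.volume_eq_prod, Measure.prod_prod]
    rw [mul_comm (volume (cube c l))]

/-- By Tonelli this is Lebesgue differentiation of `y ↦ ∫_I F(·, y)`, with half-open cubes and
closed sup-norm balls agreeing up to null sets. It is the device that turns rectangle conditions
into slice conditions. -/
theorem ae_tendsto_slice {F : Space n m → ℝ≥0∞} (hF : Measurable F) (a : Fin n → ℝ) (h : ℝ)
    (hfin : ∀ N, ∫⁻ z in cube a h ×ˢ bigCube m N, F z ≠ ∞) :
    ∀ᵐ y, Tendsto (fun r => (∫⁻ z in cube a h ×ˢ cube (fun i => y i - r) (2 * r), F z) /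
      volume (cube (fun i => y i - r) (2 * r))) (𝓝[>] 0) (𝓝 (∫⁻ x in cube a h, F (x, y))) := by
  filter_upwards [ae_tendsto_lintegral_closedBall_div (F := fun y => ∫⁻ x in cube a h, F (x, y))
    hF.lintegral_prod_left' fun N => by rw [← setLIntegral_prod_eq hF]; exact hfin N] with y hy
  refine hy.congr' ?_
  filter_upwards [self_mem_nhdsWithin] with r hr
  have := cube_sub_ae_eq_closedBall y (le_of_lt hr : 0 ≤ r)
  rw [setLIntegral_prod_eq hF, setLIntegral_congr this, measure_congr this]

/-- The `A_p` inequality on `I × J`, divided by `|J|^p`, passes to the limit as the cube `J` shrinks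
to `y`. -/
theorem RectAp.ae_slice_le (hw : RectAp p s K w) (hp : 1 < p) (hK : K ≠ ∞) (a : Fin n → ℝ)
    {h : ℝ} (hh : 0 < h) :
    ∀ᵐ y, (∫⁻ x in cube a h, w (x, y)) * (∫⁻ x in cube a h, w (x, y) ^ s) ^ (p - 1) ≤
      K * volume (cube a h) ^ p := by
  have hp1 : 0 < p - 1 := by linarith
  filter_upwards [ae_tendsto_slice hw.measurable a h fun N =>
      hw.lintegral_ne_top a h _ _ hh (by positivity),
    ae_tendsto_slice (hw.measurable.pow_const s) a h fun N =>
      hw.lintegral_rpow_ne_top hp hK a _ hh (by positivity)] with y h₁ h₂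
  -- Nonzero limits exclude `0 * ∞`, so the limit of the product is the product of the limits.
  have pos : ∀ t : ℝ, ∫⁻ x in cube a h, w (x, y) ^ t ≠ 0 := fun t =>
    setLIntegral_ne_zero_of_ne_zero ((CellSystem.measurable_slice_fst hw.measurable y).pow_const t)
      (fun x => hw.rpow_ne_zero t _) (volume_cube_ne_zero a hh)
  have pos₁ : ∫⁻ x in cube a h, w (x, y) ≠ 0 := by simpa using pos 1
  have pos₂ : (∫⁻ x in cube a h, w (x, y) ^ s) ^ (p - 1) ≠ 0 := by
    simp [ENNReal.rpow_eq_zero_iff, pos s, hp.le]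
  refine le_of_tendsto (ENNReal.Tendsto.mul h₁ (.inl pos₁) (h₂.ennrpow_const (p - 1))
    (.inl pos₂)) ?_
  filter_upwards [self_mem_nhdsWithin] with r hr
  have hr : 0 < 2 * r := by have : 0 < r := hr; linarith
  have h3 := hw.ap_le a h (fun i => y i - r) (2 * r) hh hr
  set V := volume (cube (fun i => y i - r) (2 * r)) with hV
  have hV0 : V ≠ 0 := volume_cube_ne_zero _ hr
  have hVt : V ≠ ∞ := volume_cube_ne_top _ _
  rw [Measure.volume_eq_prod, Measure.prod_prod, ← hV, ENNReal.mul_rpow_of_nonneg _ _ (by linarith),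
    ← mul_assoc] at h3
  rw [ENNReal.div_rpow_of_nonneg _ _ hp1.le, div_eq_mul_inv, div_eq_mul_inv, mul_mul_mul_comm]
  have e : V⁻¹ * (V ^ (p - 1))⁻¹ = (V ^ p)⁻¹ := by
    rw [← ENNReal.mul_inv (.inl hV0) (.inl hVt)]
    congr 1
    nth_rewrite 1 [← ENNReal.rpow_one V]
    rw [← ENNReal.rpow_add _ _ hV0 hVt]
    congr 1; ring
  rw [e, ← div_eq_mul_inv]
  exact ENNReal.div_le_of_le_mul h3

/-- A grid has countably many cubes, so the exceptional null sets can be united. -/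
theorem DyadicGrid.ae_forall_cell (D : DyadicGrid n) {P : (Fin m → ℝ) → Set (Fin n → ℝ) → Prop}
    (h : ∀ (a : Fin n → ℝ) (k : ℤ), ∀ᵐ y, P y (cube a (2 ^ (-k)))) :
    ∀ᵐ y, ∀ k x, P y (D.cells.cell k x) := by
  have : ∀ᵐ y, ∀ (k : ℤ) (j : Fin n → ℤ), P y (D.cells.idx k ⁻¹' {j}) := by
    rw [ae_all_iff]; intro k
    rw [ae_all_iff]; intro j
    rw [D.fiber_eq]
    exact h _ _
  filter_upwards [this] with y hy k x
  exact hy k (D.cells.idx k x)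

theorem RectAp.ae_apCells_fst (hw : RectAp p s K w) (hp : 1 < p) (hK : K ≠ ∞)
    (D : DyadicGrid n) :
    ∀ᵐ y, CellSystem.ApCells D.cells volume p s K fun x => w (x, y) :=
  D.ae_forall_cell (P := fun y I => (∫⁻ x in I, w (x, y)) * (∫⁻ x in I, w (x, y) ^ s) ^ (p - 1) ≤
      K * volume I ^ p) fun a k => hw.ae_slice_le hp hK a (two_zpow_pos (-k))

theorem RectAp.ae_apCells_snd (hw : RectAp p s K w) (hp : 1 < p) (hK : K ≠ ∞)
    (E : DyadicGrid m) :
    ∀ᵐ x, CellSystem.ApCells E.cells volume p s K fun y => w (x, y) :=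
  hw.swap.ae_apCells_fst hp hK E

/-- Hölder applied to both integrals bounds the `A_p` product of the geometric mean by the geometric
mean of the `A_p` products, with no loss in `K`. -/
theorem RectAp.mul {u v : Space n m → ℝ≥0∞} (hu : RectAp p s K u) (hv : RectAp p s K v)
    (hp : 1 < p) {θ₁ θ₂ : ℝ} (h₁ : 0 ≤ θ₁) (h₂ : 0 ≤ θ₂) (h₁₂ : θ₁ + θ₂ = 1) :
    RectAp p s K fun z => u z ^ θ₁ * v z ^ θ₂ := by
  have hp1 : 0 ≤ p - 1 := by linarith
  have le₁ : ∀ R : Set (Space n m), ∫⁻ z in R, u z ^ θ₁ * v z ^ θ₂ ≤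
      (∫⁻ z in R, u z) ^ θ₁ * (∫⁻ z in R, v z) ^ θ₂ := fun R =>
    ENNReal.lintegral_mul_norm_pow_le hu.measurable.aemeasurable hv.measurable.aemeasurable
      h₁ h₂ h₁₂
  have le₂ : ∀ R : Set (Space n m), ∫⁻ z in R, (u z ^ θ₁ * v z ^ θ₂) ^ s ≤
      (∫⁻ z in R, u z ^ s) ^ θ₁ * (∫⁻ z in R, v z ^ s) ^ θ₂ := fun R => by
    refine le_of_eq_of_le (lintegral_congr fun z => ?_)
      (ENNReal.lintegral_mul_norm_pow_le (hu.measurable.pow_const s).aemeasurable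
      (hv.measurable.pow_const s).aemeasurable h₁ h₂ h₁₂)
    have hut : u z ^ θ₁ ≠ ∞ := ENNReal.rpow_ne_top_of_nonneg h₁ (hu.ne_top z)
    have hvt : v z ^ θ₂ ≠ ∞ := ENNReal.rpow_ne_top_of_nonneg h₂ (hv.ne_top z)
    rw [ENNReal.mul_rpow_of_ne_top hut hvt, ← ENNReal.rpow_mul, ← ENNReal.rpow_mul,
      ← ENNReal.rpow_mul, ← ENNReal.rpow_mul, mul_comm θ₁, mul_comm θ₂]
  refine ⟨(hu.measurable.pow_const _).mul (hv.measurable.pow_const _),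
    fun z => mul_ne_zero (hu.rpow_ne_zero _ z) (hv.rpow_ne_zero _ z), fun z => ENNReal.mul_ne_top
      (ENNReal.rpow_ne_top_of_nonneg h₁ (hu.ne_top z))
      (ENNReal.rpow_ne_top_of_nonneg h₂ (hv.ne_top z)),
    fun a h c l hh hl => ne_top_of_le_ne_top (ENNReal.mul_ne_top
      (ENNReal.rpow_ne_top_of_nonneg h₁ (hu.lintegral_ne_top a h c l hh hl))
      (ENNReal.rpow_ne_top_of_nonneg h₂ (hv.lintegral_ne_top a h c l hh hl))) (le₁ _),
    fun a h c l hh hl => ?_⟩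
  set R := cube a h ×ˢ cube c l
  set a₁ := ∫⁻ z in R, u z with ha₁
  set a₂ := ∫⁻ z in R, u z ^ s with ha₂
  set c₁ := ∫⁻ z in R, v z with hc₁
  set c₂ := ∫⁻ z in R, v z ^ s with hc₂
  calc _ ≤ (a₁ ^ θ₁ * c₁ ^ θ₂) * (a₂ ^ θ₁ * c₂ ^ θ₂) ^ (p - 1) :=
        mul_le_mul' (le₁ R) (ENNReal.rpow_le_rpow (le₂ R) hp1)
    _ = (a₁ * a₂ ^ (p - 1)) ^ θ₁ * (c₁ * c₂ ^ (p - 1)) ^ θ₂ := by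
        simp only [ENNReal.mul_rpow_of_nonneg _ _ hp1, ENNReal.mul_rpow_of_nonneg _ _ h₁,
          ENNReal.mul_rpow_of_nonneg _ _ h₂, ← ENNReal.rpow_mul]
        rw [mul_comm θ₁ (p - 1), mul_comm θ₂ (p - 1)]
        ring
    _ ≤ (K * volume R ^ p) ^ θ₁ * (K * volume R ^ p) ^ θ₂ := by
        exact mul_le_mul' (ENNReal.rpow_le_rpow (hu.ap_le a h c l hh hl) h₁)
          (ENNReal.rpow_le_rpow (hv.ap_le a h c l hh hl) h₂)
    _ = K * volume R ^ p := by
        rw [← ENNReal.rpow_add_of_nonneg _ _ h₁ h₂, h₁₂, ENNReal.rpow_one]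

end BiParam

/-! ### `A_∞` and oscillation for slices and partial averages. -/

namespace BiParam

variable {n m : ℕ} {p s θ : ℝ} {K : ℝ≥0∞} {u v : Space n m → ℝ≥0∞}

theorem RectAp.lintegral_bloomPow_ne_top (hu : RectAp p s K u) (hv : RectAp p s K v) (hp : 1 < p)
    (hs : s * (p - 1) = -1) (hK : K ≠ ∞) (hθ₀ : 0 ≤ θ) (hθ₁ : θ ≤ 1)
    (a : Fin n → ℝ) {h : ℝ} (c : Fin m → ℝ) {l : ℝ} (hh : 0 < h) (hl : 0 < l) :
    ∫⁻ z in cube a h ×ˢ cube c l, bloomPow p θ u v z ≠ ∞ := by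
  have hp0 : 0 < p := by linarith
  refine ne_top_of_le_ne_top ?_
    (lintegral_bloomPow_le hp hs hu.measurable hv.measurable hθ₀ hθ₁)
  refine ENNReal.mul_ne_top (ENNReal.rpow_ne_top_of_nonneg hθ₀ (ENNReal.mul_ne_top
    (ENNReal.rpow_ne_top_of_nonneg (by positivity) (hu.lintegral_ne_top a h c l hh hl))
    (ENNReal.rpow_ne_top_of_nonneg (div_nonneg (by linarith) hp0.le)
      (hv.lintegral_rpow_ne_top hp hK a c hh hl))))
    (ENNReal.rpow_ne_top_of_nonneg (by linarith) (volume_prod_cube_ne_top a h c l))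

theorem RectAp.ae_aInfty_fst (hu : RectAp p s K u) (hv : RectAp p s K v) (hp : 1 < p)
    (hs : s * (p - 1) = -1) (hK1 : 1 ≤ K) (hK : K ≠ ∞) (hθ₀ : 0 ≤ θ) (hθ₁ : θ ≤ 1)
    (D : DyadicGrid n) :
    ∀ᵐ y, CellSystem.AInfty D.cells volume (4 * K ^ 2) fun x => bloomPow p θ u v (x, y) := by
  filter_upwards [hu.ae_apCells_fst hp hK D, hv.ae_apCells_fst hp hK D] with y h₁ h₂ k x E _ hE hρ
  exact setLIntegral_bloomPow_le_of_subset (u := fun x => u (x, y)) (v := fun x => v (x, y))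
    hp hs hK1 (CellSystem.measurable_slice_fst hu.measurable y)
    (CellSystem.measurable_slice_fst hv.measurable y) (fun _ => hu.ne_zero _)
    (fun _ => hu.ne_top _) (fun _ => hv.ne_zero _) (fun _ => hv.ne_top _) (h₁ k x) (h₂ k x) hθ₀ hθ₁
    ((D.regular le_rfl).ne_top k x) hE hρ

/-- The integral over `F` of the partial average is `|I|⁻¹` times the integral over `I × F`. A
subset filling half of `J` gives a set filling half of `I × J`, so the rectangular estimate applies
with no slicing. -/
theorem RectAp.aInfty_snd (hu : RectAp p s K u) (hv : RectAp p s K v) (hp : 1 < p)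
    (hs : s * (p - 1) = -1) (hK1 : 1 ≤ K) (hθ₀ : 0 ≤ θ) (hθ₁ : θ ≤ 1)
    (D : DyadicGrid n) (E : DyadicGrid m) (k : ℤ) (x : Fin n → ℝ) :
    CellSystem.AInfty E.cells volume (4 * K ^ 2)
      fun y => D.cells.avg volume k (fun x => bloomPow p θ u v (x, y)) x := by
  intro l y F hF hFs hρ
  have hw := measurable_bloomPow (p := p) (θ := θ) hu.measurable hv.measurable
  obtain ⟨a, ha⟩ := D.cell_eq_cube k x
  obtain ⟨c, hc⟩ := E.cell_eq_cube l y
  have key : ∀ S : Set (Fin m → ℝ),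
      ∫⁻ y in S, D.cells.avg volume k (fun x => bloomPow p θ u v (x, y)) x =
      (volume (D.cells.cell k x))⁻¹ * ∫⁻ z in D.cells.cell k x ×ˢ S, bloomPow p θ u v z := by
    intro S
    rw [setLIntegral_prod_eq hw, ← lintegral_const_mul _ hw.lintegral_prod_left']
    rfl
  rw [key, key, mul_left_comm]
  gcongr
  have h₁ := hu.ap_le a _ c _ (two_zpow_pos (-k)) (two_zpow_pos (-l))
  have h₂ := hv.ap_le a _ c _ (two_zpow_pos (-k)) (two_zpow_pos (-l))
  have h₃ := volume_prod_cube_ne_top a ((2 : ℝ) ^ (-k)) c ((2 : ℝ) ^ (-l))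
  rw [← ha, ← hc] at h₁ h₂ h₃
  refine setLIntegral_bloomPow_le_of_subset hp hs hK1 hu.measurable hv.measurable hu.ne_zero
    hu.ne_top hv.ne_zero hv.ne_top h₁ h₂ hθ₀ hθ₁ h₃ (prod_mono subset_rfl hFs) ?_
  rw [Measure.volume_eq_prod, Measure.prod_prod, Measure.prod_prod, mul_left_comm]
  gcongr

section Oscillation

variable {b : Space n m → ℂ} {w : Space n m → ℝ≥0∞} {B : ℝ≥0∞}

theorem integrableOn_prod_cube {F : Type*} [NormedAddCommGroup F] {b : Space n m → F}
    (hb : LocallyIntegrable b) (a : Fin n → ℝ) {h : ℝ}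
    (c : Fin m → ℝ) {l : ℝ} (hh : 0 ≤ h) (hl : 0 ≤ l) : IntegrableOn b (cube a h ×ˢ cube c l) :=
  (hb.integrableOn_isCompact ((isCompact_closedBall _ _).prod (isCompact_closedBall _ _))).mono_set
    (prod_mono (cube_subset_closedBall a hh) (cube_subset_closedBall c hl))

theorem ae_integrableOn_slice (hb : LocallyIntegrable b) (a : Fin n → ℝ) {h : ℝ} (hh : 0 ≤ h) :
    ∀ᵐ y, IntegrableOn (fun x => b (x, y)) (cube a h) := by
  have : ∀ N : ℕ, ∀ᵐ y, y ∈ bigCube m N → IntegrableOn (fun x => b (x, y)) (cube a h) := fun N => by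
    rw [← ae_restrict_iff' (s := bigCube m N) (measurableSet_cube _ _)]
    have hi : IntegrableOn b (cube a h ×ˢ bigCube m N) :=
      integrableOn_prod_cube hb a _ hh (by positivity)
    rw [IntegrableOn, Measure.volume_eq_prod, ← Measure.prod_restrict] at hi
    exact hi.prod_left_ae
  filter_upwards [ae_all_iff.2 this] with y hy
  obtain ⟨N, hN⟩ := exists_mem_ball_two_pow y
  exact hy N (ball_subset_bigCube N hN)

theorem ae_locallyIntegrable_slice (hb : LocallyIntegrable b) :
    ∀ᵐ y, LocallyIntegrable fun x => b (x, y) := by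
  filter_upwards [ae_all_iff.2 fun N : ℕ =>
    ae_integrableOn_slice (n := n) hb (fun _ => -2 ^ N) (h := 2 ^ (N + 1)) (by positivity)] with y hy
  exact locallyIntegrable_of_bigCube hy

theorem locallyIntegrable_setAverage_slice (hb : LocallyIntegrable b) (a : Fin n → ℝ) {h : ℝ}
    (hh : 0 ≤ h) : LocallyIntegrable fun y => ⨍ x in cube a h, b (x, y) := by
  refine locallyIntegrable_of_bigCube fun N => ?_
  have hi : IntegrableOn b (cube a h ×ˢ bigCube m N) :=
    integrableOn_prod_cube hb a _ hh (by positivity)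
  rw [IntegrableOn, Measure.volume_eq_prod, ← Measure.prod_restrict] at hi
  simp_rw [setAverage_eq]
  exact hi.integral_prod_right.smul _

theorem setAverage_prod_eq (hb : LocallyIntegrable b) (a : Fin n → ℝ) {h : ℝ}
    (c : Fin m → ℝ) {l : ℝ} (hh : 0 ≤ h) (hl : 0 ≤ l) :
    ⨍ z in cube a h ×ˢ cube c l, b z = ⨍ y in cube c l, ⨍ x in cube a h, b (x, y) := by
  have hi : IntegrableOn b (cube a h ×ˢ cube c l) := integrableOn_prod_cube hb a c hh hl
  rw [IntegrableOn, Measure.volume_eq_prod, ← Measure.prod_restrict] at hi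
  simp_rw [setAverage_eq]
  rw [integral_smul, Measure.volume_eq_prod, ← Measure.prod_restrict, integral_prod_symm _ hi,
    smul_smul, Measure.real, Measure.real, Measure.real, Measure.prod_prod, ENNReal.toReal_mul,
    mul_inv, mul_comm]

/-- Weighted little `BMO` with norm at most `B`, on products of cubes with dyadic side lengths. -/
structure RectOsc (B : ℝ≥0∞) (w : Space n m → ℝ≥0∞) (b : Space n m → ℂ) : Prop where
  measurable : Measurable b
  locallyIntegrable : LocallyIntegrable b
  measurable_weight : Measurable w
  weight_ne_top : ∀ (a : Fin n → ℝ) (h : ℝ) (c : Fin m → ℝ) (l : ℝ), 0 < h → 0 < l →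
    ∫⁻ z in cube a h ×ˢ cube c l, w z ≠ ∞
  osc_le : ∀ (a : Fin n → ℝ) (k : ℤ) (c : Fin m → ℝ) (l : ℤ),
    ∫⁻ z in cube a (2 ^ (-k)) ×ˢ cube c (2 ^ (-l)),
      ‖b z - ⨍ z in cube a (2 ^ (-k)) ×ˢ cube c (2 ^ (-l)), b z‖ₑ ≤
    B * ∫⁻ z in cube a (2 ^ (-k)) ×ˢ cube c (2 ^ (-l)), w z

theorem measurable_setAverage_slice (hb : Measurable b) (I : Set (Fin n → ℝ)) :
    Measurable fun y => ⨍ x in I, b (x, y) := by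
  simp_rw [setAverage_eq]
  exact ((hb.comp measurable_swap).stronglyMeasurable.integral_prod_right'
    (ν := volume.restrict I)).measurable.const_smul _

/-- The average in the first variable has bounded oscillation. -/
theorem RectOsc.setLIntegral_snd_le (hb : RectOsc B w b) (a : Fin n → ℝ) (k : ℤ) (c : Fin m → ℝ)
    (l : ℤ) :
    ∫⁻ y in cube c (2 ^ (-l)), ‖(⨍ x in cube a (2 ^ (-k)), b (x, y)) -
      ⨍ z in cube a (2 ^ (-k)) ×ˢ cube c (2 ^ (-l)), b z‖ₑ ≤
    (volume (cube a (2 ^ (-k))))⁻¹ *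
      (B * ∫⁻ z in cube a (2 ^ (-k)) ×ˢ cube c (2 ^ (-l)), w z) := by
  set I := cube a ((2 : ℝ) ^ (-k))
  set J := cube c ((2 : ℝ) ^ (-l))
  set M := ⨍ z in I ×ˢ J, b z
  have hm : Measurable fun z => ‖b z - M‖ₑ := (hb.measurable.sub measurable_const).enorm
  calc _ ≤ ∫⁻ y in J, (volume I)⁻¹ * ∫⁻ x in I, ‖b (x, y) - M‖ₑ := by
        refine lintegral_mono_ae (ae_restrict_of_ae ?_)
        filter_upwards [ae_integrableOn_slice hb.locallyIntegrable a (two_zpow_pos (-k)).le]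
          with y hy
        exact CellSystem.enorm_setAverage_sub_le (volume_cube_ne_zero a (two_zpow_pos (-k)))
          (volume_cube_ne_top a _) hy M
    _ = (volume I)⁻¹ * ∫⁻ z in I ×ˢ J, ‖b z - M‖ₑ := by
        rw [setLIntegral_prod_eq hm, lintegral_const_mul _ hm.lintegral_prod_left']
    _ ≤ _ := mul_le_mul_right (hb.osc_le a k c l) _

/-- Comparing both `b` and its partial average with the average over the rectangle costs two copies
of the oscillation bound. Still an estimate on rectangles, it can be differentiated in `y`. -/
theorem RectOsc.setLIntegral_fst_le (hb : RectOsc B w b) (a : Fin n → ℝ) (k : ℤ) (c : Fin m → ℝ)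
    (l : ℤ) :
    ∫⁻ z in cube a (2 ^ (-k)) ×ˢ cube c (2 ^ (-l)), ‖b z - ⨍ x in cube a (2 ^ (-k)), b (x, z.2)‖ₑ ≤
      2 * B * ∫⁻ z in cube a (2 ^ (-k)) ×ˢ cube c (2 ^ (-l)), w z := by
  have h₁ := hb.osc_le a k c l
  have h₂ := hb.setLIntegral_snd_le a k c l
  have hI0 := volume_cube_ne_zero a (two_zpow_pos (-k))
  have hIt := volume_cube_ne_top a ((2 : ℝ) ^ (-k))
  set I := cube a ((2 : ℝ) ^ (-k))
  set J := cube c ((2 : ℝ) ^ (-l))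
  set M := ⨍ z in I ×ˢ J, b z
  have hc := measurable_setAverage_slice hb.measurable I
  have hm : Measurable fun z : Space n m => ‖(⨍ x in I, b (x, z.2)) - M‖ₑ :=
    ((hc.comp measurable_snd).sub measurable_const).enorm
  have hm' : Measurable fun y : Fin m → ℝ => ‖(⨍ x in I, b (x, y)) - M‖ₑ :=
    (hc.sub measurable_const).enorm
  calc _ ≤ ∫⁻ z in I ×ˢ J, (‖b z - M‖ₑ + ‖(⨍ x in I, b (x, z.2)) - M‖ₑ) := by
        refine lintegral_mono fun z => ?_
        rw [← enorm_neg ((⨍ x in I, b (x, z.2)) - M)]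
        exact (le_of_eq (by congr 1; ring)).trans (enorm_add_le _ _)
    _ = (∫⁻ z in I ×ˢ J, ‖b z - M‖ₑ) +
          volume I * ∫⁻ y in J, ‖(⨍ x in I, b (x, y)) - M‖ₑ := by
        rw [lintegral_add_right _ hm]
        congr 1
        rw [setLIntegral_prod_eq hm, ← lintegral_const_mul _ hm']
        refine lintegral_congr fun y => ?_
        simp only [setLIntegral_const, mul_comm]
    _ ≤ _ := add_le_add h₁ (mul_le_mul_right h₂ _)
    _ = _ := by
        rw [← mul_assoc (volume I), ENNReal.mul_inv_cancel hI0 hIt]; ring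

/-- Almost every slice in the first variable has bounded oscillation. -/
theorem RectOsc.ae_slice_le (hb : RectOsc B w b) (hB : B ≠ ∞) (a : Fin n → ℝ) (k : ℤ) :
    ∀ᵐ y, ∫⁻ x in cube a (2 ^ (-k)), ‖b (x, y) - ⨍ x in cube a (2 ^ (-k)), b (x, y)‖ₑ ≤
      2 * B * ∫⁻ x in cube a (2 ^ (-k)), w (x, y) := by
  have hc := measurable_setAverage_slice hb.measurable (cube a ((2 : ℝ) ^ (-k)))
  have hF : Measurable fun z : Space n m => ‖b z - ⨍ x in cube a (2 ^ (-k)), b (x, z.2)‖ₑ :=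
    (hb.measurable.sub (hc.comp measurable_snd)).enorm
  have h2B : 2 * B ≠ ∞ := ENNReal.mul_ne_top (by simp) hB
  have hw : ∀ N, ∫⁻ z in cube a (2 ^ (-k)) ×ˢ bigCube m N, w z ≠ ∞ := fun N =>
    hb.weight_ne_top a _ _ _ (two_zpow_pos (-k)) (by positivity)
  filter_upwards [ae_tendsto_slice hb.measurable_weight a _ hw,
    ae_tendsto_slice hF a (2 ^ (-k)) fun N => by
      have := hb.setLIntegral_fst_le a k (fun _ : Fin m => -2 ^ N) (-((N : ℤ) + 1))
      rw [← bigCube_eq] at this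
      exact ne_top_of_le_ne_top (ENNReal.mul_ne_top h2B (hw N)) this] with y h₁ h₂
  -- The oscillation bound is known only for dyadic side lengths, so the radius runs through
  -- `2^(-l)/2` and the cubes centred at `y` have side `2^(-l)`.
  refine le_of_tendsto_of_tendsto (h₂.comp tendsto_two_zpow_neg_div_two)
    ((ENNReal.Tendsto.const_mul h₁ (.inr h2B)).comp tendsto_two_zpow_neg_div_two)
    (Eventually.of_forall fun l => ?_)
  have e : 2 * ((2 : ℝ) ^ (-l) / 2) = 2 ^ (-l) := by ring
  simp only [Function.comp_apply]
  rw [e, ← mul_div_assoc (2 * B)]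
  exact ENNReal.div_le_div_right (hb.setLIntegral_fst_le a k _ l) _

theorem RectOsc.ae_hasOsc_slice (hb : RectOsc B w b) (hB : B ≠ ∞) (D : DyadicGrid n) :
    ∀ᵐ y, CellSystem.HasOsc D.cells volume (2 * B) (fun x => w (x, y)) fun x => b (x, y) := by
  let P : (Fin m → ℝ) → Set (Fin n → ℝ) → Prop := fun y I => IntegrableOn (fun x => b (x, y)) I
  let Q : (Fin m → ℝ) → Set (Fin n → ℝ) → Prop := fun y I =>
    ∫⁻ x' in I, ‖b (x', y) - ⨍ x in I, b (x, y)‖ₑ ≤ 2 * B * ∫⁻ x in I, w (x, y)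
  have hP : ∀ᵐ y, ∀ k x, P y (D.cells.cell k x) := D.ae_forall_cell fun a k =>
    ae_integrableOn_slice hb.locallyIntegrable a (two_zpow_pos (-k)).le
  have hQ : ∀ᵐ y, ∀ k x, Q y (D.cells.cell k x) := D.ae_forall_cell fun a k =>
    hb.ae_slice_le hB a k
  filter_upwards [hP, hQ] with y hy hy'
  exact ⟨hy, hy'⟩

theorem RectOsc.biOsc {Λ : ℝ≥0∞} (hb : RectOsc B w b) (hB : B ≠ ∞) (D : DyadicGrid n)
    (E : DyadicGrid m)
    (h₁ : ∀ᵐ y, CellSystem.AInfty D.cells volume Λ fun x => w (x, y))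
    (h₂ : ∀ k x, CellSystem.AInfty E.cells volume Λ
      fun y => D.cells.avg volume k (fun x => w (x, y)) x) :
    CellSystem.BiOsc D.cells E.cells volume volume Λ (2 * B) w b where
  measurable_weight := hb.measurable_weight
  measurable := hb.measurable
  aInfty_fst := h₁
  osc_fst := by
    filter_upwards [hb.ae_hasOsc_slice hB D] with y hy using hy
  lim_fst := by
    filter_upwards [ae_locallyIntegrable_slice hb.locallyIntegrable] with y hy
    exact D.ae_tendsto_cavg hy
  aInfty_snd := h₂
  osc_snd k x := by
    obtain ⟨a, ha⟩ := D.cell_eq_cube k x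
    have hloc : LocallyIntegrable fun y => D.cells.cavg volume k (fun x => b (x, y)) x := by
      unfold CellSystem.cavg
      rw [ha]
      exact locallyIntegrable_setAverage_slice hb.locallyIntegrable a (two_zpow_pos (-k)).le
    refine ⟨fun l y => ?_, fun l y => ?_⟩
    · obtain ⟨c, hc⟩ := E.cell_eq_cube l y
      rw [hc]
      exact (hloc.integrableOn_isCompact (isCompact_closedBall _ _)).mono_set
        (cube_subset_closedBall c (two_zpow_pos (-l)).le)
    · obtain ⟨c, hc⟩ := E.cell_eq_cube l y
      have h := hb.setLIntegral_snd_le a k c l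
      rw [setAverage_prod_eq hb.locallyIntegrable a c (two_zpow_pos (-k)).le
        (two_zpow_pos (-l)).le, ← ha, ← hc] at h
      refine h.trans ?_
      have e : ∫⁻ y in E.cells.cell l y, D.cells.avg volume k (fun x => w (x, y)) x =
          (volume (D.cells.cell k x))⁻¹ *
            ∫⁻ z in D.cells.cell k x ×ˢ E.cells.cell l y, w z := by
        rw [setLIntegral_prod_eq hb.measurable_weight,
          ← lintegral_const_mul _ hb.measurable_weight.lintegral_prod_left']
        rfl
      rw [e, mul_left_comm]
      gcongr
      exact le_mul_of_one_le_left' (by norm_num)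
  lim_snd k x := by
    obtain ⟨a, ha⟩ := D.cell_eq_cube k x
    refine E.ae_tendsto_cavg ?_
    unfold CellSystem.cavg
    rw [ha]
    exact locallyIntegrable_setAverage_slice hb.locallyIntegrable a (two_zpow_pos (-k)).le
  average_eq k l x y := by
    obtain ⟨a, ha⟩ := D.cell_eq_cube k x
    obtain ⟨c, hc⟩ := E.cell_eq_cube l y
    have := setAverage_prod_eq hb.locallyIntegrable a c (two_zpow_pos (-k)).le
      (two_zpow_pos (-l)).le
    rw [← ha, ← hc] at this
    exact this

end Oscillation

end BiParam

/-! ### Everywhere defined representatives of weights and symbols. -/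

namespace BiParam

variable {n m : ℕ} {p s θ : ℝ} {K : ℝ≥0∞} {u v : Space n m → ℝ≥0∞}

theorem one_sub_conjExponent_mul (hp : 1 < p) : (1 - Real.conjExponent p) * (p - 1) = -1 := by
  have : p - 1 ≠ 0 := by linarith
  rw [Real.conjExponent]
  field_simp
  ring

/-- A measurable representative, set to 1 on the null set where it is not positive, has the same
integrals and is nonzero and finite everywhere. -/
theorem IsApWeight.exists_rectAp {w : Space n m → ℝ} (hp : 1 < p) (hw : IsApWeight p w)
    (hK : apConst p w ≤ K) :
    ∃ u : Space n m → ℝ≥0∞, RectAp p (1 - Real.conjExponent p) K u ∧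
      (fun z => ENNReal.ofReal (w z)) =ᵐ[volume] u := by
  have hm : AEMeasurable w := hw.locallyIntegrable.aestronglyMeasurable.aemeasurable
  have hmk : Measurable fun z => ENNReal.ofReal (hm.mk w z) := hm.measurable_mk.ennreal_ofReal
  let u : Space n m → ℝ≥0∞ := fun z => if 0 < hm.mk w z then ENNReal.ofReal (hm.mk w z) else 1
  have hwu : ∀ᵐ z, ENNReal.ofReal (w z) = u z := by
    filter_upwards [hm.ae_eq_mk, hw.ae_pos] with z h₁ h₂
    rw [h₁] at h₂
    simp only [u]
    rw [if_pos h₂, h₁]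
  have hwus : ∀ᵐ z, ENNReal.ofReal (w z ^ (1 - Real.conjExponent p)) =
      u z ^ (1 - Real.conjExponent p) := by
    filter_upwards [hwu, hw.ae_pos] with z h₁ h₂
    rw [← h₁, ENNReal.ofReal_rpow_of_pos h₂]
  have hint : ∀ R : Set (Space n m), ∫⁻ z in R, ENNReal.ofReal (w z) = ∫⁻ z in R, u z := fun R =>
    lintegral_congr_ae (ae_restrict_of_ae hwu)
  refine ⟨u, ⟨Measurable.ite (hm.measurable_mk measurableSet_Ioi) hmk measurable_const,
    fun z => ?_, fun z => ?_, fun a h c l hh hl => ?_, fun a h c l hh hl => ?_⟩, hwu⟩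
  · simp only [u]
    split_ifs with hz
    · exact (ENNReal.ofReal_pos.2 hz).ne'
    · exact one_ne_zero
  · simp only [u]
    split_ifs with hz
    · exact ENNReal.ofReal_ne_top
    · exact ENNReal.one_ne_top
  · rw [← hint]
    exact (integrableOn_prod_cube hw.locallyIntegrable a c hh.le hl.le).lintegral_lt_top.ne
  · have h₁ := le_trans (le_iSup₂_of_le a h (le_iSup₂_of_le hh c (le_iSup₂_of_le l hl le_rfl))) hK
    have h0 := volume_prod_cube_ne_zero a c hh hl
    have ht := volume_prod_cube_ne_top a h c l
    rw [hint, lintegral_congr_ae (ae_restrict_of_ae hwus)] at h₁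
    set R := cube a h ×ˢ cube c l
    set V := volume R
    have hV : V ^ p = V * V ^ (p - 1) := by
      nth_rewrite 2 [← ENNReal.rpow_one V]
      rw [← ENNReal.rpow_add _ _ h0 ht]
      congr 1; ring
    have e : ∀ a : ℝ≥0∞, a = V * (V⁻¹ * a) := fun a => by
      rw [← mul_assoc, ENNReal.mul_inv_cancel h0 ht, one_mul]
    rw [e (∫⁻ z in R, u z), e (∫⁻ z in R, u z ^ _), ENNReal.mul_rpow_of_nonneg _ _ (by linarith),
      mul_mul_mul_comm, ← hV, mul_comm K]
    exact mul_le_mul_right h₁ _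

theorem ae_ofReal_bloomWeight_rpow {mu lam : Space n m → ℝ} (hmu : ∀ᵐ z, 0 < mu z)
    (hlam : ∀ᵐ z, 0 < lam z) (hu : (fun z => ENNReal.ofReal (mu z)) =ᵐ[volume] u)
    (hv : (fun z => ENNReal.ofReal (lam z)) =ᵐ[volume] v) (p θ : ℝ) :
    (fun z => ENNReal.ofReal (bloomWeight p mu lam z ^ θ)) =ᵐ[volume] bloomPow p θ u v := by
  filter_upwards [hmu, hlam, hu, hv] with z h₁ h₂ h₃ h₄
  have h₅ : 0 < mu z ^ (1 / p) := Real.rpow_pos_of_pos h₁ _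
  have h₆ : 0 < lam z ^ (-(1 / p)) := Real.rpow_pos_of_pos h₂ _
  rw [bloomPow, ← h₃, ← h₄, ENNReal.ofReal_rpow_of_pos h₁, ENNReal.ofReal_rpow_of_pos h₂,
    ← ENNReal.ofReal_mul h₅.le, ENNReal.ofReal_rpow_of_pos (mul_pos h₅ h₆), bloomWeight]

/-- Every cube of dyadic side belongs to some grid, so the supremum over all grids controls
rectangles in arbitrary position. This freedom is needed to centre cubes at `y` when slicing. -/
theorem MemBmo.exists_rectOsc {b : Space n m → ℂ} {ω : Space n m → ℝ} {w : Space n m → ℝ≥0∞}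
    (hb : MemBmo ω b) (hw : Measurable w) (hω : (fun z => ENNReal.ofReal (ω z)) =ᵐ[volume] w)
    (hw0 : ∀ z, w z ≠ 0)
    (hwt : ∀ (a : Fin n → ℝ) (h : ℝ) (c : Fin m → ℝ) (l : ℝ), 0 < h → 0 < l →
      ∫⁻ z in cube a h ×ˢ cube c l, w z ≠ ∞) :
    ∃ b' : Space n m → ℂ, b =ᵐ[volume] b' ∧ RectOsc (bmoNorm ω b) w b' := by
  have hm : AEMeasurable b := hb.locallyIntegrable.aestronglyMeasurable.aemeasurable
  have hbb := hm.ae_eq_mk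
  have havg : ∀ R : Set (Space n m), ⨍ z in R, b z = ⨍ z in R, hm.mk b z := fun R =>
    average_congr (ae_restrict_of_ae hbb)
  refine ⟨hm.mk b, hbb, hm.measurable_mk, fun z => ?_, hw, hwt, fun a k c l => ?_⟩
  · obtain ⟨U, hU, hi⟩ := hb.locallyIntegrable z
    exact ⟨U, hU, hi.congr (ae_restrict_of_ae hbb)⟩
  · obtain ⟨D, hD⟩ := exists_grid_cube_mem a k
    obtain ⟨E, hE⟩ := exists_grid_cube_mem c l
    have h₁ : _ ≤ bmoNorm ω b := le_iSup₂_of_le D E (le_iSup₂_of_le _ hD (le_iSup₂_of_le _ hE le_rfl))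
    have h0 := setLIntegral_ne_zero_of_ne_zero hw hw0
      (volume_prod_cube_ne_zero a c (two_zpow_pos (-k)) (two_zpow_pos (-l)))
    have ht := hwt a _ c _ (two_zpow_pos (-k)) (two_zpow_pos (-l))
    set R := cube a ((2 : ℝ) ^ (-k)) ×ˢ cube c ((2 : ℝ) ^ (-l))
    have hR : MeasurableSet R := (measurableSet_cube _ _).prod (measurableSet_cube _ _)
    rw [weightMeasure, withDensity_apply _ hR, lintegral_congr_ae (ae_restrict_of_ae hω),
      ENNReal.div_le_iff h0 ht, havg] at h₁
    refine le_of_eq_of_le (lintegral_congr_ae (ae_restrict_of_ae ?_)) h₁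
    filter_upwards [hbb] with z hz
    rw [hz]

/-! ### Pointwise domination of the maximal functions. -/

section Rectangles

variable (D : DyadicGrid n) (E : DyadicGrid m)

theorem measurable_iSup_indicator (a : Set (Fin n → ℝ) → Set (Fin m → ℝ) → ℝ≥0∞) :
    Measurable fun z : Space n m => ⨆ (I ∈ D.cubes) (J ∈ E.cubes),
      (I ×ˢ J).indicator (fun _ => a I J) z :=
  Measurable.biSup _ D.countable_cubes fun _ hI => Measurable.biSup _ E.countable_cubes
    fun _ hJ => measurable_const.indicator
      ((D.measurableSet_of_mem_cubes hI).prod (E.measurableSet_of_mem_cubes hJ))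

theorem iSup_indicator_le {a : Set (Fin n → ℝ) → Set (Fin m → ℝ) → ℝ≥0∞} {z : Space n m}
    {t : ℝ≥0∞} (h : ∀ k l, a (D.cells.cell k z.1) (E.cells.cell l z.2) ≤ t) :
    ⨆ (I ∈ D.cubes) (J ∈ E.cubes), (I ×ˢ J).indicator (fun _ => a I J) z ≤ t := by
  refine iSup₂_le fun I hI => iSup₂_le fun J hJ => ?_
  by_cases hz : z ∈ I ×ˢ J
  · rw [indicator_of_mem hz]
    obtain ⟨k, rfl⟩ := D.eq_cell hI hz.1
    obtain ⟨l, rfl⟩ := E.eq_cell hJ hz.2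
    exact h k l
  · rw [indicator_of_notMem hz]
    exact zero_le

/-- The maximal function over all rectangles of a pair of dyadic grids. -/
noncomputable abbrev gridMax (g : Space n m → ℝ≥0∞) : Space n m → ℝ≥0∞ :=
  CellSystem.strongMax D.cells E.cells volume volume g

theorem measurable_gridMax {g : Space n m → ℝ≥0∞} (hg : Measurable g) :
    Measurable (gridMax D E g) := CellSystem.measurable_strongMax hg

variable {D E}

theorem inv_mul_setLIntegral_le_gridMax {h : Space n m → ℝ≥0∞} (hh : Measurable h) (k l : ℤ)
    (z : Space n m) :
    (volume (D.cells.cell k z.1 ×ˢ E.cells.cell l z.2))⁻¹ *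
      ∫⁻ z in D.cells.cell k z.1 ×ˢ E.cells.cell l z.2, h z ≤ gridMax D E h z :=
  CellSystem.inv_mul_setLIntegral_prod_cells_le (D.regular le_rfl) hh k l z

variable {A Λ B B' : ℝ≥0∞} {w w' g : Space n m → ℝ≥0∞} {b b' c c' f : Space n m → ℂ}

theorem maximalOne_le (hA : 2 ^ n ≤ A) (hA' : 2 ^ m ≤ A)
    (hb : CellSystem.BiOsc D.cells E.cells volume volume Λ B w b) (hc : c =ᵐ[volume] b)
    (hg : Measurable g) (hf : (fun z => ‖f z‖ₑ) =ᵐ[volume] g) (z : Space n m) :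
    maximalOne D E c f z ≤ CellSystem.oscConst A Λ * B * 2 *
      gridMax D E (fun z => w z * gridMax D E g z) z := by
  refine iSup_indicator_le D E fun k l => ?_
  have hm : Measurable fun z => w z * gridMax D E g z :=
    hb.measurable_weight.mul (measurable_gridMax D E hg)
  have h₁ := hb.setLIntegral_le (D.regular hA) (E.regular hA') hg k l z.1 z.2
  set R := D.cells.cell k z.1 ×ˢ E.cells.cell l z.2
  have e : ∫⁻ y in R, ‖c y - ⨍ z in R, c z‖ₑ * ‖f y‖ₑ = ∫⁻ y in R, ‖b y - ⨍ z in R, b z‖ₑ * g y := by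
    rw [average_congr (ae_restrict_of_ae hc)]
    refine lintegral_congr_ae (ae_restrict_of_ae ?_)
    filter_upwards [hc, hf] with y h₂ h₃
    rw [h₂, h₃]
  rw [e]
  calc _ ≤ (volume R)⁻¹ * (CellSystem.oscConst A Λ * B * 2 * ∫⁻ y in R, w y * gridMax D E g y) :=
        mul_le_mul_right h₁ _
    _ = CellSystem.oscConst A Λ * B * 2 *
        ((volume R)⁻¹ * ∫⁻ y in R, w y * gridMax D E g y) := mul_left_comm _ _ _
    _ ≤ _ := mul_le_mul_right (inv_mul_setLIntegral_le_gridMax hm k l z) _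

theorem maximalTwo_le (hA : 2 ^ n ≤ A) (hA' : 2 ^ m ≤ A)
    (hb : CellSystem.BiOsc D.cells E.cells volume volume Λ B w b)
    (hb' : CellSystem.BiOsc D.cells E.cells volume volume Λ B' w' b')
    (hc : c =ᵐ[volume] b) (hc' : c' =ᵐ[volume] b')
    (hg : Measurable g) (hf : (fun z => ‖f z‖ₑ) =ᵐ[volume] g) (z : Space n m) :
    maximalTwo D E c c' f z ≤
      (2 * CellSystem.oscConstTwo A Λ + CellSystem.oscConst A Λ ^ 2) * B * B' *
      gridMax D E (fun z => w z * gridMax D E (fun z => w' z * gridMax D E g z) z +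
        w' z * gridMax D E (fun z => w z * gridMax D E g z) z) z := by
  refine iSup_indicator_le D E fun k l => ?_
  have hm : Measurable fun z => w z * gridMax D E (fun z => w' z * gridMax D E g z) z +
      w' z * gridMax D E (fun z => w z * gridMax D E g z) z := by
    have h₁ := hb.measurable_weight
    have h₂ := hb'.measurable_weight
    have h₃ := measurable_gridMax D E hg
    exact (h₁.mul (measurable_gridMax D E (h₂.mul h₃))).add
      (h₂.mul (measurable_gridMax D E (h₁.mul h₃)))
  have h₁ := hb.setLIntegral_mul_le (D.regular hA) (E.regular hA') hb' hg k l z.1 z.2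
  set R := D.cells.cell k z.1 ×ˢ E.cells.cell l z.2
  have e : ∫⁻ y in R, ‖c y - ⨍ z in R, c z‖ₑ * ‖c' y - ⨍ z in R, c' z‖ₑ * ‖f y‖ₑ =
      ∫⁻ y in R, ‖b y - ⨍ z in R, b z‖ₑ * ‖b' y - ⨍ z in R, b' z‖ₑ * g y := by
    rw [average_congr (ae_restrict_of_ae hc), average_congr (ae_restrict_of_ae hc')]
    refine lintegral_congr_ae (ae_restrict_of_ae ?_)
    filter_upwards [hc, hc', hf] with y h₂ h₃ h₄
    rw [h₂, h₃, h₄]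
  rw [e]
  refine (mul_le_mul_right h₁ _).trans ?_
  rw [mul_left_comm]
  exact mul_le_mul_right (inv_mul_setLIntegral_le_gridMax hm k l z) _

end Rectangles

/-! ### Weighted norm inequalities through intermediate weights. -/

section Norms

variable {D : DyadicGrid n} {E : DyadicGrid m} {w g : Space n m → ℝ≥0∞}

theorem RectAp.lintegral_gridMax_le (hw : RectAp p s K w) (hp : 1 < p) (hs : s * (p - 1) = -1)
    (hK : K ≠ ∞) (hg : Measurable g) :
    ∫⁻ z, gridMax D E g z ^ p * w z ≤
      CellSystem.strongConst p K * ∫⁻ z, g z ^ p * w z :=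
  CellSystem.lintegral_strongMax_rpow_mul_le (D.regular le_rfl)
    (E.regular le_rfl) hp hs hK hw.measurable hw.ne_zero hw.ne_top
    (hw.ae_apCells_fst hp hK D) (hw.ae_apCells_snd hp hK E) hg

/-- Multiplication by a power of the Bloom weight interpolates between the two weights. -/
theorem lintegral_bloomPow_mul_rpow (hu : RectAp p s K u) (hv : RectAp p s K v) (hp : 1 < p)
    (g : Space n m → ℝ≥0∞) (θ t : ℝ) :
    ∫⁻ z, (bloomPow p θ u v z * g z) ^ p * (u z ^ t * v z ^ (1 - t)) =
      ∫⁻ z, g z ^ p * (u z ^ (θ + t) * v z ^ (1 - (θ + t))) := by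
  refine lintegral_congr fun z => ?_
  have hu0 := hu.ne_zero z
  have hut := hu.ne_top z
  have hv0 := hv.ne_zero z
  have hvt := hv.ne_top z
  have h₁ : bloomPow p θ u v z ^ p = u z ^ θ * v z ^ (-θ) := by
    have hp0 : p ≠ 0 := by linarith
    rw [bloomPow, ← ENNReal.rpow_mul, ENNReal.mul_rpow_of_ne_top
      (by simp [ENNReal.rpow_eq_top_iff, hu0, hut]) (by simp [ENNReal.rpow_eq_top_iff, hv0, hvt]),
      ← ENNReal.rpow_mul, ← ENNReal.rpow_mul]
    congr 2 <;> field_simp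
  rw [ENNReal.mul_rpow_of_nonneg _ _ (by linarith), h₁, ENNReal.rpow_add _ _ hu0 hut,
    show 1 - (θ + t) = -θ + (1 - t) by ring, ENNReal.rpow_add _ _ hv0 hvt]
  ring

/-- One link of the chain: the maximal operator is bounded for the geometric mean `u^t v^(1-t)`, and
the factor `ν^θ` advances `t` to `θ + t`. -/
theorem lintegral_gridMax_bloomPow_mul_le (hu : RectAp p s K u) (hv : RectAp p s K v) (hp : 1 < p)
    (hs : s * (p - 1) = -1) (hK : K ≠ ∞) (hg : Measurable g) {t : ℝ} (ht₀ : 0 ≤ t)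
    (ht₁ : t ≤ 1) :
    ∫⁻ z, gridMax D E (fun z => bloomPow p θ u v z * g z) z ^ p * (u z ^ t * v z ^ (1 - t)) ≤
      CellSystem.strongConst p K * ∫⁻ z, g z ^ p * (u z ^ (θ + t) * v z ^ (1 - (θ + t))) := by
  rw [← lintegral_bloomPow_mul_rpow hu hv hp]
  exact (hu.mul hv hp ht₀ (sub_nonneg.2 ht₁) (by ring)).lintegral_gridMax_le hp hs hK
    ((measurable_bloomPow hu.measurable hv.measurable).mul hg)

/-- The exponent of `u` goes from `0` to `θ₁` and on to `θ₁ + θ₂ = 1`. One maximal operator acts at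
the intermediate weight and one at `u`, hence the square. -/
theorem lintegral_bloomPow_mul_gridMax_le (hu : RectAp p s K u) (hv : RectAp p s K v) (hp : 1 < p)
    (hs : s * (p - 1) = -1) (hK : K ≠ ∞) (hg : Measurable g) {θ₁ θ₂ : ℝ} (h₁ : 0 ≤ θ₁)
    (h₂ : 0 ≤ θ₂) (h₁₂ : θ₁ + θ₂ = 1) :
    ∫⁻ z, (bloomPow p θ₁ u v z *
        gridMax D E (fun z => bloomPow p θ₂ u v z * gridMax D E g z) z) ^ p * v z ≤
      CellSystem.strongConst p K ^ 2 * ∫⁻ z, g z ^ p * u z := by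
  have e := lintegral_bloomPow_mul_rpow hu hv hp
    (gridMax D E fun z => bloomPow p θ₂ u v z * gridMax D E g z) θ₁ 0
  simp only [ENNReal.rpow_zero, one_mul, sub_zero, ENNReal.rpow_one, add_zero] at e
  rw [e]
  have h₃ := lintegral_gridMax_bloomPow_mul_le (D := D) (E := E) hu hv hp hs hK
    (measurable_gridMax D E hg) (θ := θ₂) h₁ (by linarith)
  rw [add_comm θ₂, h₁₂] at h₃
  simp only [sub_self, ENNReal.rpow_zero, mul_one, ENNReal.rpow_one] at h₃
  refine h₃.trans ?_
  rw [pow_two, mul_assoc]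
  exact mul_le_mul_right (hu.lintegral_gridMax_le hp hs hK hg) _

theorem lintegral_gridMax_bloomPow_le (hu : RectAp p s K u) (hv : RectAp p s K v) (hp : 1 < p)
    (hs : s * (p - 1) = -1) (hK : K ≠ ∞) (hg : Measurable g) :
    ∫⁻ z, gridMax D E (fun z => bloomPow p 1 u v z * gridMax D E g z) z ^ p * v z ≤
      CellSystem.strongConst p K ^ 2 * ∫⁻ z, g z ^ p * u z := by
  have h₃ := lintegral_gridMax_bloomPow_mul_le (D := D) (E := E) hu hv hp hs hK
    (measurable_gridMax D E hg) (θ := 1) le_rfl zero_le_one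
  simp only [sub_self, ENNReal.rpow_zero, mul_one, one_mul, add_zero, sub_zero,
    ENNReal.rpow_one] at h₃
  refine h₃.trans ?_
  rw [pow_two, mul_assoc]
  exact mul_le_mul_right (hu.lintegral_gridMax_le hp hs hK hg) _

theorem lintegral_gridMax_bloomPow_add_le (hu : RectAp p s K u) (hv : RectAp p s K v) (hp : 1 < p)
    (hs : s * (p - 1) = -1) (hK : K ≠ ∞) (hg : Measurable g) {θ₁ θ₂ : ℝ} (h₁ : 0 ≤ θ₁)
    (h₂ : 0 ≤ θ₂) (h₁₂ : θ₁ + θ₂ = 1) :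
    ∫⁻ z, gridMax D E (fun z =>
        bloomPow p θ₁ u v z * gridMax D E (fun z => bloomPow p θ₂ u v z * gridMax D E g z) z +
        bloomPow p θ₂ u v z * gridMax D E (fun z => bloomPow p θ₁ u v z * gridMax D E g z) z) z ^ p
        * v z ≤
      CellSystem.strongConst p K ^ 3 * 2 ^ p * ∫⁻ z, g z ^ p * u z := by
  have hm : ∀ θ θ' : ℝ, Measurable fun z =>
      bloomPow p θ u v z * gridMax D E (fun z => bloomPow p θ' u v z * gridMax D E g z) z :=
    fun θ θ' => (measurable_bloomPow hu.measurable hv.measurable).mul (measurable_gridMax D E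
      ((measurable_bloomPow hu.measurable hv.measurable).mul (measurable_gridMax D E hg)))
  have h₃ := lintegral_bloomPow_mul_gridMax_le (D := D) (E := E) hu hv hp hs hK hg h₁ h₂ h₁₂
  have h₄ := lintegral_bloomPow_mul_gridMax_le (D := D) (E := E) hu hv hp hs hK hg h₂ h₁
    (by linarith)
  refine (hv.lintegral_gridMax_le hp hs hK ((hm _ _).add (hm _ _))).trans ?_
  set S := CellSystem.strongConst p K
  set G₁ := fun z =>
    bloomPow p θ₁ u v z * gridMax D E (fun z => bloomPow p θ₂ u v z * gridMax D E g z) z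
  set G₂ := fun z =>
    bloomPow p θ₂ u v z * gridMax D E (fun z => bloomPow p θ₁ u v z * gridMax D E g z) z
  have hG : ∫⁻ z, (G₁ z + G₂ z) ^ p * v z ≤
      2 ^ (p - 1) * ((∫⁻ z, G₁ z ^ p * v z) + ∫⁻ z, G₂ z ^ p * v z) := by
    have hm₁ : Measurable fun z => G₁ z ^ p * v z := ((hm _ _).pow_const p).mul hv.measurable
    rw [← lintegral_add_left hm₁, ← lintegral_const_mul' _ _
      (ENNReal.rpow_ne_top_of_nonneg (by linarith) (by simp))]
    refine lintegral_mono fun z => ?_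
    rw [← add_mul, ← mul_assoc]
    exact mul_le_mul_left (ENNReal.rpow_add_le_mul_rpow_add_rpow _ _ hp.le) _
  refine (mul_le_mul_right (hG.trans (mul_le_mul_right (add_le_add h₃ h₄) _)) S).trans_eq ?_
  have h2 : (2 : ℝ≥0∞) ^ p = 2 ^ (p - 1) * 2 := by
    nth_rewrite 3 [← ENNReal.rpow_one 2]
    rw [← ENNReal.rpow_add _ _ (by simp) (by simp)]
    congr 1; ring
  rw [h2]
  ring

theorem eLpNorm_withDensity_eq {ε : Type*} [TopologicalSpace ε] [ContinuousENorm ε]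
    {F : Space n m → ε} (hF : Measurable fun z => ‖F z‖ₑ) (hw : Measurable w) (hp : 0 < p) :
    eLpNorm F (ENNReal.ofReal p) (volume.withDensity w) =
      (∫⁻ z, ‖F z‖ₑ ^ p * w z) ^ (1 / p) := by
  rw [eLpNorm_eq_lintegral_rpow_enorm_toReal (ENNReal.ofReal_pos.2 hp).ne' ENNReal.ofReal_ne_top,
    ENNReal.toReal_ofReal hp.le, lintegral_withDensity_eq_lintegral_mul _ hw (hF.pow_const p)]
  simp only [Pi.mul_apply, mul_comm]

theorem eLpNorm_withDensity_le {F G : Space n m → ℝ≥0∞} {a c : ℝ≥0∞} {f : Space n m → ℂ}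
    (hp : 0 < p) (hF : Measurable F) (hf : Measurable f) (hu : Measurable u) (hv : Measurable v)
    (ha : a ≠ ∞) (hFG : ∀ z, F z ≤ a * G z)
    (hG : ∫⁻ z, G z ^ p * v z ≤ c * ∫⁻ z, ‖f z‖ₑ ^ p * u z) :
    eLpNorm F (ENNReal.ofReal p) (volume.withDensity v) ≤
      a * c ^ (1 / p) * eLpNorm f (ENNReal.ofReal p) (volume.withDensity u) := by
  rw [eLpNorm_withDensity_eq (by simpa using hF) hv hp, eLpNorm_withDensity_eq hf.enorm hu hp]
  have hr : 0 ≤ 1 / p := by positivity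
  calc _ ≤ (a ^ p * (c * ∫⁻ z, ‖f z‖ₑ ^ p * u z)) ^ (1 / p) := by
        refine ENNReal.rpow_le_rpow ?_ hr
        refine le_trans ?_ (mul_le_mul_right hG _)
        rw [← lintegral_const_mul' _ _ (ENNReal.rpow_ne_top_of_nonneg hp.le ha)]
        refine lintegral_mono fun z => ?_
        rw [← mul_assoc, ← ENNReal.mul_rpow_of_nonneg _ _ hp.le, enorm_eq_self]
        exact mul_le_mul_left (ENNReal.rpow_le_rpow (hFG z) hp.le) _
    _ = _ := by
        rw [ENNReal.mul_rpow_of_nonneg _ _ hr, ENNReal.mul_rpow_of_nonneg _ _ hr,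
          ← ENNReal.rpow_mul, mul_one_div_cancel hp.ne', ENNReal.rpow_one, mul_assoc]

end Norms

end BiParam

/-! ### Constants and the final estimates. -/

namespace BiParam

variable {n m : ℕ} {p s θ : ℝ} {K A B B' : ℝ≥0∞} {u v : Space n m → ℝ≥0∞}
  {D : DyadicGrid n} {E : DyadicGrid m}

/-- Lets a representative of `f`, chosen modulo the weighted measure, be used in Lebesgue integrals.
-/
theorem RectAp.withDensity_ac (hu : RectAp p s K u) : volume ≪ volume.withDensity u :=
  withDensity_absolutelyContinuous' hu.measurable.aemeasurable (Eventually.of_forall hu.ne_zero)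

theorem RectOsc.biOsc_bloomPow {b : Space n m → ℂ} (hb : RectOsc B (bloomPow p θ u v) b)
    (hB : B ≠ ∞) (hu : RectAp p s K u) (hv : RectAp p s K v) (hp : 1 < p)
    (hs : s * (p - 1) = -1) (hK1 : 1 ≤ K) (hK : K ≠ ∞) (hθ₀ : 0 ≤ θ) (hθ₁ : θ ≤ 1)
    (D : DyadicGrid n) (E : DyadicGrid m) :
    CellSystem.BiOsc D.cells E.cells volume volume (4 * K ^ 2) (2 * B) (bloomPow p θ u v) b :=
  hb.biOsc hB D E (hu.ae_aInfty_fst hv hp hs hK1 hK hθ₀ hθ₁ D)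
    (hu.aInfty_snd hv hp hs hK1 hθ₀ hθ₁ D E)

/-- The constant in the norm inequality for `maximalOne`. -/
noncomputable def maximalOneConst (p : ℝ) (K A : ℝ≥0∞) : ℝ≥0∞ :=
  CellSystem.oscConst A (4 * K ^ 2) * 4 * (CellSystem.strongConst p K ^ 2) ^ (1 / p)

/-- The constant in the norm inequality for `maximalTwo`. -/
noncomputable def maximalTwoConst (p : ℝ) (K A : ℝ≥0∞) : ℝ≥0∞ :=
  (2 * CellSystem.oscConstTwo A (4 * K ^ 2) + CellSystem.oscConst A (4 * K ^ 2) ^ 2) * 4 *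
    (CellSystem.strongConst p K ^ 3 * 2 ^ p) ^ (1 / p)

theorem oscConst_ne_top (hA : A ≠ ∞) (hK : K ≠ ∞) : CellSystem.oscConst A (4 * K ^ 2) ≠ ∞ :=
  ENNReal.mul_ne_top (ENNReal.add_ne_top.2 ⟨by simp, ENNReal.mul_ne_top hA (by simp)⟩)
    (ENNReal.mul_ne_top (by simp) (ENNReal.pow_ne_top hK))

theorem oscConstTwo_add_ne_top (hA : A ≠ ∞) (hK : K ≠ ∞) :
    2 * CellSystem.oscConstTwo A (4 * K ^ 2) + CellSystem.oscConst A (4 * K ^ 2) ^ 2 ≠ ∞ := by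
  have h := ENNReal.pow_ne_top (n := 2) (oscConst_ne_top hA hK)
  exact ENNReal.add_ne_top.2 ⟨ENNReal.mul_ne_top (by simp) (ENNReal.mul_ne_top (by simp) h), h⟩

theorem maximalOneConst_ne_top (hp : 1 < p) (hA : A ≠ ∞) (hK : K ≠ ∞) :
    maximalOneConst p K A ≠ ∞ :=
  ENNReal.mul_ne_top (ENNReal.mul_ne_top (oscConst_ne_top hA hK) (by simp))
    (ENNReal.rpow_ne_top_of_nonneg (by positivity)
      (ENNReal.pow_ne_top (CellSystem.strongConst_ne_top hp hK)))

theorem maximalTwoConst_ne_top (hp : 1 < p) (hA : A ≠ ∞) (hK : K ≠ ∞) :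
    maximalTwoConst p K A ≠ ∞ :=
  ENNReal.mul_ne_top (ENNReal.mul_ne_top (oscConstTwo_add_ne_top hA hK) (by simp))
    (ENNReal.rpow_ne_top_of_nonneg (by positivity)
      (ENNReal.mul_ne_top (ENNReal.pow_ne_top (CellSystem.strongConst_ne_top hp hK))
        (ENNReal.rpow_ne_top_of_nonneg (by positivity) (by simp))))

theorem eLpNorm_maximalOne_le (hu : RectAp p s K u) (hv : RectAp p s K v) (hp : 1 < p)
    (hs : s * (p - 1) = -1) (hK1 : 1 ≤ K) (hK : K ≠ ∞) (hA : 2 ^ n ≤ A) (hA' : 2 ^ m ≤ A)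
    (hAt : A ≠ ∞) {b c : Space n m → ℂ} (hb : RectOsc B (bloomPow p 1 u v) b) (hB : B ≠ ∞)
    (hc : c =ᵐ[volume] b) {f : Space n m → ℂ}
    (hf : AEStronglyMeasurable f (volume.withDensity u)) :
    eLpNorm (maximalOne D E c f) (ENNReal.ofReal p) (volume.withDensity v) ≤
      maximalOneConst p K A * B * eLpNorm f (ENNReal.ofReal p) (volume.withDensity u) := by
  have hfm := hf.aemeasurable
  have hff : (fun z => ‖f z‖ₑ) =ᵐ[volume] fun z => ‖hfm.mk f z‖ₑ := by
    filter_upwards [hu.withDensity_ac.ae_eq hfm.ae_eq_mk] with z hz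
    rw [hz]
  have hg : Measurable fun z => ‖hfm.mk f z‖ₑ := hfm.measurable_mk.enorm
  rw [eLpNorm_congr_ae hfm.ae_eq_mk]
  refine (eLpNorm_withDensity_le (by linarith) (measurable_iSup_indicator D E _)
    hfm.measurable_mk hu.measurable hv.measurable
    (ENNReal.mul_ne_top (ENNReal.mul_ne_top (oscConst_ne_top hAt hK)
      (ENNReal.mul_ne_top (by simp) hB)) (by simp))
    (maximalOne_le hA hA'
      (hb.biOsc_bloomPow hB hu hv hp hs hK1 hK zero_le_one le_rfl D E) hc hg hff)
    (lintegral_gridMax_bloomPow_le hu hv hp hs hK hg)).trans_eq ?_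
  -- The 4 in the constant is the 2 lost on slices times the 2 from the oscillations in `x` and in
  -- `y`.
  rw [maximalOneConst]
  ring

theorem eLpNorm_maximalTwo_le (hu : RectAp p s K u) (hv : RectAp p s K v) (hp : 1 < p)
    (hs : s * (p - 1) = -1) (hK1 : 1 ≤ K) (hK : K ≠ ∞) (hA : 2 ^ n ≤ A) (hA' : 2 ^ m ≤ A)
    (hAt : A ≠ ∞) {θ₁ θ₂ : ℝ} (h₁ : 0 ≤ θ₁) (h₂ : 0 ≤ θ₂) (h₁₂ : θ₁ + θ₂ = 1)
    {b c b' c' : Space n m → ℂ} (hb : RectOsc B (bloomPow p θ₁ u v) b) (hB : B ≠ ∞)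
    (hb' : RectOsc B' (bloomPow p θ₂ u v) b') (hB' : B' ≠ ∞) (hc : c =ᵐ[volume] b)
    (hc' : c' =ᵐ[volume] b') {f : Space n m → ℂ}
    (hf : AEStronglyMeasurable f (volume.withDensity u)) :
    eLpNorm (maximalTwo D E c c' f) (ENNReal.ofReal p) (volume.withDensity v) ≤
      maximalTwoConst p K A * B * B' *
        eLpNorm f (ENNReal.ofReal p) (volume.withDensity u) := by
  have hfm := hf.aemeasurable
  have hff : (fun z => ‖f z‖ₑ) =ᵐ[volume] fun z => ‖hfm.mk f z‖ₑ := by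
    filter_upwards [hu.withDensity_ac.ae_eq hfm.ae_eq_mk] with z hz
    rw [hz]
  have hg : Measurable fun z => ‖hfm.mk f z‖ₑ := hfm.measurable_mk.enorm
  rw [eLpNorm_congr_ae hfm.ae_eq_mk]
  refine (eLpNorm_withDensity_le (by linarith) (measurable_iSup_indicator D E _)
    hfm.measurable_mk hu.measurable hv.measurable
    (ENNReal.mul_ne_top (ENNReal.mul_ne_top (oscConstTwo_add_ne_top hAt hK)
      (ENNReal.mul_ne_top (by simp) hB)) (ENNReal.mul_ne_top (by simp) hB'))
    (maximalTwo_le hA hA'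
      (hb.biOsc_bloomPow hB hu hv hp hs hK1 hK h₁ (by linarith) D E)
      (hb'.biOsc_bloomPow hB' hu hv hp hs hK1 hK h₂ (by linarith) D E) hc hc' hg hff)
    (lintegral_gridMax_bloomPow_add_le hu hv hp hs hK hg h₁ h₂ h₁₂)).trans_eq ?_
  rw [maximalTwoConst]
  ring

theorem MemBmo.exists_rectOsc_bloomPow {b : Space n m → ℂ} {ω : Space n m → ℝ}
    (hb : MemBmo ω b) (hu : RectAp p s K u) (hv : RectAp p s K v) (hp : 1 < p)
    (hs : s * (p - 1) = -1) (hK : K ≠ ∞) (hθ₀ : 0 ≤ θ) (hθ₁ : θ ≤ 1)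
    (hω : (fun z => ENNReal.ofReal (ω z)) =ᵐ[volume] bloomPow p θ u v) :
    ∃ b' : Space n m → ℂ, b =ᵐ[volume] b' ∧ RectOsc (bmoNorm ω b) (bloomPow p θ u v) b' :=
  hb.exists_rectOsc (measurable_bloomPow hu.measurable hv.measurable) hω
    (bloomPow_ne_zero hu.ne_zero hu.ne_top hv.ne_zero hv.ne_top)
    fun a _ c _ hh hl => hu.lintegral_bloomPow_ne_top hv hp hs hK hθ₀ hθ₁ a c hh hl

end BiParam

theorem proposition4p2 (n m : ℕ) (hn : 0 < n) (hm : 0 < m) (p : ℝ) (hp : 1 < p) (K L : ℝ≥0) :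
    ∃ C : ℝ≥0, ∀ mu lam : BiParam.Space n m → ℝ,
      BiParam.IsApWeight p mu → BiParam.IsApWeight p lam →
      BiParam.apConst p mu ≤ K → BiParam.apConst p lam ≤ L →
      ∀ (D : BiParam.DyadicGrid n) (E : BiParam.DyadicGrid m),
        (∀ b : BiParam.Space n m → ℂ, BiParam.MemBmo (BiParam.bloomWeight p mu lam) b →
          ∀ f : BiParam.Space n m → ℂ,
            MemLp f (ENNReal.ofReal p) (BiParam.weightMeasure mu) →
              MemLp (BiParam.maximalOne D E b f) (ENNReal.ofReal p)
                (BiParam.weightMeasure lam) ∧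
              eLpNorm (BiParam.maximalOne D E b f) (ENNReal.ofReal p)
                  (BiParam.weightMeasure lam) ≤
                C * BiParam.bmoNorm (BiParam.bloomWeight p mu lam) b *
                  eLpNorm f (ENNReal.ofReal p) (BiParam.weightMeasure mu)) ∧
        (∀ θ₁ θ₂ : ℝ, 0 ≤ θ₁ → 0 ≤ θ₂ → θ₁ + θ₂ = 1 →
          ∀ b₁ b₂ : BiParam.Space n m → ℂ,
            BiParam.MemBmo (fun x => BiParam.bloomWeight p mu lam x ^ θ₁) b₁ →
            BiParam.MemBmo (fun x => BiParam.bloomWeight p mu lam x ^ θ₂) b₂ →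
          ∀ f : BiParam.Space n m → ℂ,
            MemLp f (ENNReal.ofReal p) (BiParam.weightMeasure mu) →
              MemLp (BiParam.maximalTwo D E b₁ b₂ f) (ENNReal.ofReal p)
                (BiParam.weightMeasure lam) ∧
              eLpNorm (BiParam.maximalTwo D E b₁ b₂ f) (ENNReal.ofReal p)
                  (BiParam.weightMeasure lam) ≤
                C * BiParam.bmoNorm (fun x => BiParam.bloomWeight p mu lam x ^ θ₁) b₁ *
                  BiParam.bmoNorm (fun x => BiParam.bloomWeight p mu lam x ^ θ₂) b₂ *
                  eLpNorm f (ENNReal.ofReal p) (BiParam.weightMeasure mu)) := by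
  -- One constant dominating both `A_p` bounds; the summand 1 secures `1 ≤ K'`.
  set K' : ℝ≥0∞ := K + L + 1 with hK'
  set A : ℝ≥0∞ := 2 ^ (n + m)
  have hK1 : 1 ≤ K' := le_add_self
  have hKt : K' ≠ ∞ := by simp [hK']
  have hA : 2 ^ n ≤ A := pow_le_pow_right₀ (by norm_num) (by omega)
  have hA' : 2 ^ m ≤ A := pow_le_pow_right₀ (by norm_num) (by omega)
  have hAt : A ≠ ∞ := ENNReal.pow_ne_top (by simp)
  have hs := BiParam.one_sub_conjExponent_mul hp
  have h₁t := BiParam.maximalOneConst_ne_top hp hAt hKt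
  have h₂t := BiParam.maximalTwoConst_ne_top hp hAt hKt
  refine ⟨(BiParam.maximalOneConst p K' A + BiParam.maximalTwoConst p K' A).toNNReal,
    fun mu lam hmu hlam hmuK hlamL D E => ?_⟩
  rw [ENNReal.coe_toNNReal (ENNReal.add_ne_top.2 ⟨h₁t, h₂t⟩)]
  obtain ⟨u, hu, hmu'⟩ := hmu.exists_rectAp hp
    (hmuK.trans (le_self_add.trans (le_self_add : (K + L : ℝ≥0∞) ≤ K')))
  obtain ⟨v, hv, hlam'⟩ := hlam.exists_rectAp hp
    (hlamL.trans (le_add_self.trans (le_self_add : (K + L : ℝ≥0∞) ≤ K')))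
  have hbloom := BiParam.ae_ofReal_bloomWeight_rpow hmu.ae_pos hlam.ae_pos hmu' hlam' p
  have hmuw : BiParam.weightMeasure mu = volume.withDensity u := withDensity_congr_ae hmu'
  have hlamw : BiParam.weightMeasure lam = volume.withDensity v := withDensity_congr_ae hlam'
  rw [hmuw, hlamw]
  refine ⟨fun b hb f hf => ?_, fun θ₁ θ₂ h₁ h₂ h₁₂ b₁ b₂ hb₁ hb₂ f hf => ?_⟩
  · obtain ⟨b', hbb', hosc⟩ := hb.exists_rectOsc_bloomPow hu hv hp hs hKt zero_le_one le_rfl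
      (by simpa using hbloom 1)
    have hle := (BiParam.eLpNorm_maximalOne_le (D := D) (E := E) hu hv hp hs hK1 hKt hA hA' hAt
      hosc hb.bmoNorm_lt_top.ne hbb' hf.aestronglyMeasurable).trans
      (mul_le_mul_left (mul_le_mul_left (le_self_add (b := BiParam.maximalTwoConst p K' A)) _) _)
    refine ⟨⟨(BiParam.measurable_iSup_indicator D E _).aestronglyMeasurable,
      hle.trans_lt (ENNReal.mul_lt_top (ENNReal.mul_lt_top ?_ hb.bmoNorm_lt_top)
        hf.eLpNorm_lt_top)⟩, hle⟩
    exact (ENNReal.add_ne_top.2 ⟨h₁t, h₂t⟩).lt_top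
  · obtain ⟨b₁', hbb₁, hosc₁⟩ := hb₁.exists_rectOsc_bloomPow hu hv hp hs hKt h₁ (by linarith)
      (hbloom θ₁)
    obtain ⟨b₂', hbb₂, hosc₂⟩ := hb₂.exists_rectOsc_bloomPow hu hv hp hs hKt h₂ (by linarith)
      (hbloom θ₂)
    have hle := (BiParam.eLpNorm_maximalTwo_le (D := D) (E := E) hu hv hp hs hK1 hKt hA hA' hAt
      h₁ h₂ h₁₂ hosc₁ hb₁.bmoNorm_lt_top.ne hosc₂ hb₂.bmoNorm_lt_top.ne hbb₁ hbb₂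
      hf.aestronglyMeasurable).trans
      (mul_le_mul_left (mul_le_mul_left (mul_le_mul_left
        (le_add_self (a := BiParam.maximalTwoConst p K' A)
          (b := BiParam.maximalOneConst p K' A)) _) _) _)
    refine ⟨⟨(BiParam.measurable_iSup_indicator D E _).aestronglyMeasurable,
      hle.trans_lt (ENNReal.mul_lt_top (ENNReal.mul_lt_top (ENNReal.mul_lt_top ?_
        hb₁.bmoNorm_lt_top) hb₂.bmoNorm_lt_top) hf.eLpNorm_lt_top)⟩, hle⟩
    exact (ENNReal.add_ne_top.2 ⟨h₁t, h₂t⟩).lt_top
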